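/- For integers $n,d\ge 1$ and reals $p\in(0,1/2]$, $k\in[0,n]$, let $\mathcal Q=\mathcal G(n,p)$ be the Erdős–Rényi law on graphs with vertex set $[n]$ and let $\mathcal P=\mathcal G(n,p,d,k)$ be the law of the following random graph. Every vertex joins a community $S$ independently with probability $k/n$; the vertices $i\in S$ receive independent uniform latent vectors $U_i$ on the unit sphere $\mathbb S^{d-1}\subset\mathbb R^d$; a pair $i\ne j$ of vertices of $S$ is an edge if and only if $\langle U_i,U_j\rangle\ge\tau(p,d)$, where $\tau(p,d)$ is the number with $\mathbb P(\langle U,V\rangle\ge\tau(p,d))=p$ for independent uniform $U,V$ on $\mathbb S^{d-1}$ (it exists and is unique for $d\ge2$); every other pair is an edge independently with probability $p$. For $\ell\ge 3$ the global signed count of cycles of length $\ell$ is $$f_\ell(G)=\sum_{C}\ \prod_{ij\in E(C)}(G_{ij}-p),$$ where $C$ runs over all cycles of length $\ell$ in the complete graph on $[n]$ and $G_{ij}\in\{0,1\}$ is the indicator of the edge $ij$. For sequences $p=p(n)$, $d=d(n)$, $k=k(n)$, the statistic $f_\ell$ achieves strong separation if, as $n\to\infty$, $$\sqrt{\operatorname{Var}_{\mathcal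 Q}f_\ell}\vee\sqrt{\operatorname{Var}_{\mathcal P}f_\ell}=o\bigl(\mathbb E_{\mathcal P}f_\ell-\mathbb E_{\mathcal Q}f_\ell\bigr).$$ **Proposition 2.9 (suboptimality of longer cycle counts).** There is an absolute constant $d_0$ such that the following holds for every fixed integer $\ell\ge3$. Let $p=p(n)\in(0,1/2]$, $k=k(n)\in[0,n]$ with $k\to\infty$, and $d=d(n)$ with $d\ge d_0$ and $d\ge(5\log(1/p))^4$, for all sufficiently large $n$. If the global signed count of cycles of length $\ell$ achieves strong separation, then, as $n\to\infty$, $$d\ll\left(\frac{k^2p\log(1/p)}{n}\right)^{\ell/(\ell-2)}.$$ Moreover, in this case the right-hand side is largest for triangles: for all sufficiently large $n$ and all integers $m\ge4$, $$\left(\frac{k^2p\log(1/p)}{n}\right)^{m/(m-2)}<\left(\frac{k^2p\log(1/p)}{n}\right)^{3}.$$ -/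

import Mathlib

open MeasureTheory ProbabilityTheory Filter Asymptotics

noncomputable section

namespace LocalGeometry

/-- The unit sphere `𝕊^{d-1}` of `ℝ^d`. -/
abbrev Sphere (d : ℕ) : Type := Metric.sphere (0 : EuclideanSpace ℝ (Fin d)) 1

/-- The uniform probability distribution on `𝕊^{d-1}`: normalized surface measure. -/
def sphereUniform (d : ℕ) : Measure (Sphere d) :=
  ((volume : Measure (EuclideanSpace ℝ (Fin d))).toSphere Set.univ)⁻¹ •
    (volume : Measure (EuclideanSpace ℝ (Fin d))).toSphere

/-- The probability that `⟨U, V⟩ ≥ t` for independent uniform points `U, V` of `𝕊^{d-1}`. -/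
def innerTail (d : ℕ) (t : ℝ) : ℝ :=
  ((sphereUniform d).prod (sphereUniform d)).real
    {x | t ≤ inner ℝ (x.1 : EuclideanSpace ℝ (Fin d)) (x.2 : EuclideanSpace ℝ (Fin d))}

/-- The threshold `τ(p, d)`, as the upper `p`-quantile of `⟨U, V⟩`. For `d ≥ 2` the law of
`⟨U, V⟩` has no atoms and charges every nontrivial interval of `[-1, 1]`, so that for `0 < p < 1`
this is the one and only `t` with `P(⟨U, V⟩ ≥ t) = p`. -/
def threshold (p : ℝ) (d : ℕ) : ℝ := sSup {t : ℝ | p ≤ innerTail d t}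

/-- The graph built from a community `S`, latent vectors `u` and a background graph `H`:
inside `S` two vertices are joined iff the inner product of their latent vectors is at least `τ`;
any other pair is joined iff it is joined in `H`. -/
def plantedGraph {n d : ℕ} (τ : ℝ) (S : Set (Fin n)) (u : Fin n → Sphere d)
    (H : SimpleGraph (Fin n)) : SimpleGraph (Fin n) where
  Adj i j := i ≠ j ∧
    ((i ∈ S ∧ j ∈ S ∧
        τ ≤ inner ℝ (u i : EuclideanSpace ℝ (Fin d)) (u j : EuclideanSpace ℝ (Fin d))) ∨
      (¬ (i ∈ S ∧ j ∈ S) ∧ H.Adj i j))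
  symm := ⟨fun i j h => by
    refine ⟨h.1.symm, ?_⟩
    rcases h.2 with ⟨hi, hj, h⟩ | ⟨hS, h⟩
    · exact Or.inl ⟨hj, hi, by rwa [real_inner_comm]⟩
    · exact Or.inr ⟨fun h' => hS h'.symm, h.symm⟩⟩
  loopless := ⟨fun _ h => h.1 rfl⟩

/-- The null law `𝒢(n, p)`: each of the pairs is an edge independently with probability `p`. -/
def nullLaw (n : ℕ) (p : unitInterval) : Measure (SimpleGraph (Fin n)) :=
  SimpleGraph.binomialRandom (Fin n) p

/-- The planted law `𝒢(n, p, d, k)`. Independently: every vertex joins the community with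
probability `k / n`; every vertex gets a uniform latent vector on `𝕊^{d-1}` (only those of
community vertices are used); a background graph is drawn from `𝒢(n, p)`. The law is meant for
`0 ≤ k ≤ n` (then `Set.projIcc` does not change `k / n`). -/
def plantedLaw (n : ℕ) (p : unitInterval) (d : ℕ) (k : ℝ) : Measure (SimpleGraph (Fin n)) :=
  ((setBernoulli (Set.univ : Set (Fin n)) (Set.projIcc 0 1 zero_le_one (k / n))).prod
      ((Measure.pi fun _ : Fin n => sphereUniform d).prod
        (SimpleGraph.binomialRandom (Fin n) p))).map
    fun ω => plantedGraph (threshold p d) ω.1 ω.2.1 ω.2.2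

open Classical in
/-- The cycles of length `ℓ` in the complete graph on `n` vertices, i.e. the graphs on the vertex
set `Fin n` whose edges form a copy of the cycle graph on `ℓ` vertices. Each cycle occurs once. -/
def cycles (ℓ n : ℕ) : Finset (SimpleGraph (Fin n)) :=
  Finset.univ.filter fun H => ∃ v : Fin ℓ ↪ Fin n, H = (SimpleGraph.cycleGraph ℓ).map v

open Classical in
/-- The global signed count of cycles of length `ℓ`: the sum of `∏_{ij ∈ E(C)} (G_{ij} - p)` over
all cycles `C` of length `ℓ` in the complete graph, `G_{ij}` being the indicator of the edge. -/
def signedCycleCount (ℓ n : ℕ) (p : ℝ) (G : SimpleGraph (Fin n)) : ℝ :=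
  ∑ C ∈ cycles ℓ n, ∏ e ∈ C.edgeFinset, ((if e ∈ G.edgeSet then 1 else 0) - p)

/-- Strong separation of the laws `P n` and `Q n` by the statistics `f n`, as `n → ∞`:
`E_P f - E_Q f = ω(√Var_Q f ∨ √Var_P f)`. -/
def StrongSeparation (P Q : (n : ℕ) → Measure (SimpleGraph (Fin n)))
    (f : (n : ℕ) → SimpleGraph (Fin n) → ℝ) : Prop :=
  (fun n => max (√(variance (f n) (Q n))) (√(variance (f n) (P n)))) =o[atTop]
    (fun n => (∫ G, f n G ∂(P n)) - ∫ G, f n G ∂(Q n))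

/-- The quantity `k² p log(1/p) / n`. -/
def signalRatio (n : ℕ) (p k : ℝ) : ℝ := k ^ 2 * p * Real.log (1 / p) / n

end LocalGeometry

end

/-!
# Strong separation by signed cycle counts bounds the dimension

Only two moments matter: the standard deviation of the signed count of `ℓ`-cycles under the null
law, and its mean under the planted law. Distinct cycles are uncorrelated under `𝒢(n, p)`, so the
null variance is `N (p (1 - p)) ^ ℓ`, where `N ≤ n ^ ℓ` is the number of cycles
(`variance_signedCycleCount_nullLaw`); the null mean is `0`. A cycle contributes to the planted mean
only if all its vertices lie in the community, so this mean is `N (k / n) ^ ℓ T`, where `T` is the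
trace of the `ℓ`-th power of the integral operator on `L²` of the sphere with the centered kernel
`1{⟨x, y⟩ ≥ τ} - p` (`integral_signedCycleCount_plantedLaw`, `integral_cycle_eq_integral_iterate`).
Everything rests on a bound of the right order for this trace: with `m = d - 2`,
`L = log (1 / p)` and `ε = p √(L / m)`, one has `|T| ≤ C ^ ℓ m ε ^ ℓ`
(`Regime.abs_cycleIntegral_le`). Morally, the operator has about `m` leading eigenvalues of
order `ε`, carried by the linear functions on the sphere.

No spherical harmonics are used for the trace bound.

* The two-step kernel is `g - p²`, where `g x y` is the measure of the intersection of two caps.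
  The projection of a uniform point to the plane of `x` and `y` has a uniform direction and a norm
  `R` with `P(R ≥ r) = (1 - r²) ^ (m / 2)`, whence an exact formula for `g` as an integral over
  the angles from half the angle between `x` and `y` up to `π / 2` (`capInter_eq`). It shows that
  `g` deviates from its value for orthogonal centers by at most of order
  `L p² |⟨x, y⟩| exp (4 L |⟨x, y⟩|)` (`Regime.abs_capInter_sub_le`). As `⟨x, y⟩` has a Gaussian
  tail at scale `m ^ (-1/2)`, the rows of the two-step kernel have squared `L²` norm of order
  `m ε⁴` (`Regime.integral_sq_capInter_sub_le`), and the three-step kernel on the diagonal is of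
  order `m ε³` (`Regime.abs_integral_capKernel_mul_le`). These settle `ℓ = 4` and `ℓ = 3`.
* Each further step costs a factor of order `ε`. A rotation that takes `x` to `y` moves `w` by
  `‖x - y‖` times the norm of the projection of `w` to the plane of rotation; integrated over a cap,
  this shows that the operator contracts the Lipschitz seminorm by `16 ε`
  (`Regime.lipBound_kernelOp`). The rows of the two-step kernel are Lipschitz with mean zero, so
  the operator's iterates on them decay at this rate in the supremum norm. For a symmetric operator
  the `L²` norms of the iterates of a function are log-convex, so they contract at this rate from
  the first step on, with no loss in the constant (`integral_sq_iterate_kernelOp_le`).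

If the null standard deviation is at most `c` times the signal, these facts give
`m ^ (ℓ - 2) ≤ c² C ^ ℓ ρ ^ ℓ` for `ρ = k² p L / n` (`pow_le_of_sqrt_variance_le`), which is the
dimension bound as `c → 0`. It also forces `ρ > 1`, so that among the powers `ρ ^ (m / (m - 2))`
the one with the largest exponent, `m = 3`, is the largest.
-/

noncomputable section

namespace LocalGeometry

open scoped unitInterval ENNReal

/-! ### Bernoulli product weights -/

/-- The ambient space `ℝ^d` of the sphere. -/
abbrev Space (d : ℕ) : Type := EuclideanSpace ℝ (Fin d)

lemma integral_setBernoulli_prod {ι : Type*} [Fintype ι] (u : Set ι) (p : I)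
    (h : ι → Prop → ℝ) :
    ∫ S, ∏ i, h i (i ∈ S) ∂(setBernoulli u p) =
      ∏ i, ((p : ℝ) * h i (i ∈ u) + (1 - p) * h i False) := by
  rw [setBernoulli_eq_map, integral_map (by fun_prop)]
  · rw [Measure.infinitePi_eq_pi]
    simp only [Set.mem_ofPred_eq]
    rw [integral_fintype_prod_eq_prod]
    refine Finset.prod_congr rfl fun i _ => ?_
    rw [integral_add_measure .of_finite .of_finite, integral_smul_nnreal_measure,
      integral_smul_nnreal_measure, integral_dirac, integral_dirac]
    simp [NNReal.smul_def]
  · refine Measurable.aestronglyMeasurable ?_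
    refine Finset.measurable_prod _ fun i _ => ?_
    exact (measurable_of_finite (h i)).comp (by fun_prop)

/-- Under `𝒢(V, p)` the expectation of a product of edge weights factorizes. -/
lemma integral_binomialRandom_prod {V : Type*} [Fintype V] (p : I) (F : Finset (Sym2 V))
    (hF : ∀ e ∈ F, ¬ e.IsDiag) (h : Sym2 V → Prop → ℝ) :
    ∫ G : SimpleGraph V, ∏ e ∈ F, h e (e ∈ G.edgeSet) ∂(SimpleGraph.binomialRandom V p) =
      ∏ e ∈ F, ((p : ℝ) * h e True + (1 - p) * h e False) := by
  classical
  have hm : Measurable fun G : SimpleGraph V => ∏ e ∈ F, h e (e ∈ G.edgeSet) := by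
    refine Finset.measurable_prod _ fun e _ => ?_
    exact (measurable_of_finite (h e)).comp (measurable_set_iff.1 SimpleGraph.measurable_edgeSet e)
  rw [SimpleGraph.binomialRandom_eq_map,
    integral_map (by fun_prop) hm.aestronglyMeasurable]
  have := integral_setBernoulli_prod (Sym2.diagSetᶜ : Set (Sym2 V)) p
    (fun e P => if e ∈ F then h e P else 1)
  rw [← Finset.prod_subset (Finset.subset_univ F)] at this
  · rw [Finset.prod_congr rfl (g := fun e => (p : ℝ) * h e True + (1 - p) * h e False)] at this
    · rw [← this]
      refine integral_congr_ae (ae_of_all _ fun S => ?_)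
      simp only
      rw [← Finset.prod_subset (Finset.subset_univ F)]
      · refine Finset.prod_congr rfl fun e he => ?_
        have := hF e he
        simp [he, SimpleGraph.edgeSet_fromEdgeSet, this]
      · intro e _ he
        simp [he]
    · intro e he
      have := hF e he
      simp [he, this]
  · intro e _ he
    simp [he]

/-! ### Cycles and the null law of the signed count -/

instance {V : Type*} [Finite V] : MeasurableSingletonClass (SimpleGraph V) where
  measurableSet_singleton G := by
    have : ({G} : Set (SimpleGraph V)) = SimpleGraph.edgeSet ⁻¹' {G.edgeSet} := by
      ext H; simp
    rw [this]
    exact SimpleGraph.measurable_edgeSet (measurableSet_singleton _)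

lemma edgeFinset_map_cycleGraph {m n : ℕ} (v : Fin (m + 3) ↪ Fin n)
    [Fintype ((SimpleGraph.cycleGraph (m + 3)).map v).edgeSet] :
    ((SimpleGraph.cycleGraph (m + 3)).map v).edgeFinset =
      Finset.univ.image fun i => s(v i, v (i + 1)) := by
  ext e
  induction e with
  | _ a b =>
    simp only [SimpleGraph.mem_edgeFinset, SimpleGraph.mem_edgeSet, SimpleGraph.map_adj,
      Finset.mem_image, Finset.mem_univ, true_and, Sym2.eq_iff]
    constructor
    · rintro ⟨i, j, h, rfl, rfl⟩
      rw [SimpleGraph.cycleGraph_adj] at h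
      rcases h with h | h
      · exact ⟨j, Or.inr ⟨rfl, by rw [← h, add_sub_cancel]⟩⟩
      · exact ⟨i, Or.inl ⟨rfl, by rw [← h, add_sub_cancel]⟩⟩
    · rintro ⟨i, ⟨rfl, rfl⟩ | ⟨rfl, rfl⟩⟩
      · exact ⟨i, i + 1, by simp [SimpleGraph.cycleGraph_adj], rfl, rfl⟩
      · exact ⟨i + 1, i, by simp [SimpleGraph.cycleGraph_adj], rfl, rfl⟩

lemma injective_cycle_edge {m n : ℕ} (v : Fin (m + 3) ↪ Fin n) :
    Function.Injective fun i => s(v i, v (i + 1)) := by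
  intro i j h
  simp only [Sym2.eq_iff, v.injective.eq_iff] at h
  rcases h with h | ⟨h1, h2⟩
  · exact h.1
  · exfalso
    rw [h1, add_assoc, add_eq_left] at h2
    have := congrArg Fin.val h2
    simp [Fin.val_add, Nat.mod_eq_of_lt] at this

lemma prod_edgeFinset_map_cycleGraph {m n : ℕ} (v : Fin (m + 3) ↪ Fin n)
    [Fintype ((SimpleGraph.cycleGraph (m + 3)).map v).edgeSet] (F : Sym2 (Fin n) → ℝ) :
    ∏ e ∈ ((SimpleGraph.cycleGraph (m + 3)).map v).edgeFinset, F e =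
      ∏ i, F s(v i, v (i + 1)) := by
  rw [edgeFinset_map_cycleGraph, Finset.prod_image (injective_cycle_edge v).injOn]

lemma card_edgeFinset_of_mem_cycles {m n : ℕ} {C : SimpleGraph (Fin n)}
    (hC : C ∈ cycles (m + 3) n) [Fintype C.edgeSet] : C.edgeFinset.card = m + 3 := by
  classical
  obtain ⟨v, rfl⟩ := (Finset.mem_filter.1 hC).2
  rw [edgeFinset_map_cycleGraph, Finset.card_image_of_injective _ (injective_cycle_edge v)]
  simp

lemma card_cycles_le (ℓ n : ℕ) : (cycles ℓ n).card ≤ n ^ ℓ := by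
  classical
  have : cycles ℓ n ⊆ Finset.univ.image fun v : Fin ℓ ↪ Fin n =>
      (SimpleGraph.cycleGraph ℓ).map v := by
    intro C hC
    obtain ⟨v, rfl⟩ := (Finset.mem_filter.1 hC).2
    exact Finset.mem_image_of_mem _ (Finset.mem_univ v)
  refine (Finset.card_le_card this).trans (Finset.card_image_le.trans ?_)
  rw [Finset.card_univ, Fintype.card_embedding_eq]
  simpa using Nat.descFactorial_le_pow n ℓ

lemma card_cycles_pos {ℓ n : ℕ} (h : ℓ ≤ n) : 0 < (cycles ℓ n).card := by
  classical
  exact Finset.card_pos.2 ⟨_, Finset.mem_filter.2 ⟨Finset.mem_univ _, Fin.castLEEmb h, rfl⟩⟩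

lemma not_isDiag_of_mem_edgeFinset {V : Type*} (C : SimpleGraph V) [Fintype C.edgeSet]
    (e : Sym2 V) (he : e ∈ C.edgeFinset) : ¬ e.IsDiag :=
  C.not_isDiag_of_mem_edgeSet (SimpleGraph.mem_edgeFinset.1 he)

open Classical in
/-- The centered indicator `1_P - p` of a proposition `P`. -/
def centered (p : ℝ) (P : Prop) : ℝ := (if P then 1 else 0) - p

lemma centered_true (p : ℝ) : centered p True = 1 - p := by simp [centered]

lemma centered_false (p : ℝ) : centered p False = -p := by simp [centered]

open Classical in
lemma signedCycleCount_eq (ℓ n : ℕ) (p : ℝ) (G : SimpleGraph (Fin n)) :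
    signedCycleCount ℓ n p G =
      ∑ C ∈ cycles ℓ n, ∏ e ∈ C.edgeFinset, centered p (e ∈ G.edgeSet) := by
  unfold signedCycleCount centered
  refine Finset.sum_congr rfl fun C _ => Finset.prod_congr (by congr!) fun e _ => by congr

lemma integral_signedCycleCount_nullLaw (m n : ℕ) (p : I) :
    ∫ G, signedCycleCount (m + 3) n p G ∂(nullLaw n p) = 0 := by
  classical
  simp_rw [signedCycleCount_eq]
  unfold nullLaw
  rw [integral_finsetSum _ fun C _ => Integrable.of_finite]
  refine Finset.sum_eq_zero fun C hC => ?_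
  rw [integral_binomialRandom_prod p C.edgeFinset (not_isDiag_of_mem_edgeFinset C)
    fun _ P => centered p P, Finset.prod_const, card_edgeFinset_of_mem_cycles hC,
    centered_true, centered_false, show (p : ℝ) * (1 - p) + (1 - p) * (-p) = 0 by ring]
  simp

open Classical in
/-- Distinct subgraphs have uncorrelated signed weights under `𝒢(n, p)`, since some edge occurs in
exactly one of them. -/
lemma integral_nullLaw_prod_mul_prod {n : ℕ} (p : I) (C C' : SimpleGraph (Fin n)) :
    ∫ G : SimpleGraph (Fin n), (∏ e ∈ C.edgeFinset, centered p (e ∈ G.edgeSet)) *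
      ∏ e ∈ C'.edgeFinset, centered p (e ∈ G.edgeSet) ∂(nullLaw n p) =
      if C = C' then ((p : ℝ) * (1 - p)) ^ C.edgeFinset.card else 0 := by
  set h : Sym2 (Fin n) → Prop → ℝ := fun e P =>
    (if e ∈ C.edgeFinset then centered p P else 1) *
      (if e ∈ C'.edgeFinset then centered p P else 1) with hh
  have key : ∀ G : SimpleGraph (Fin n),
      (∏ e ∈ C.edgeFinset, centered p (e ∈ G.edgeSet)) *
      ∏ e ∈ C'.edgeFinset, centered p (e ∈ G.edgeSet) =
      ∏ e ∈ C.edgeFinset ∪ C'.edgeFinset, h e (e ∈ G.edgeSet) := by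
    intro G
    rw [Finset.prod_mul_distrib, Finset.prod_ite_mem, Finset.prod_ite_mem,
      Finset.union_inter_cancel_left, Finset.union_inter_cancel_right]
  simp_rw [key]
  unfold nullLaw
  rw [integral_binomialRandom_prod p _ (fun e he => (Finset.mem_union.1 he).elim
    (not_isDiag_of_mem_edgeFinset C e) (not_isDiag_of_mem_edgeFinset C' e)) h]
  simp only [hh, centered_true, centered_false]
  split_ifs with hCC
  · subst hCC
    rw [Finset.union_self, ← Finset.prod_const]
    refine Finset.prod_congr rfl fun e he => ?_
    rw [if_pos he, if_pos he]
    ring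
  · have hne : C.edgeFinset ≠ C'.edgeFinset := by
      intro h
      exact hCC (SimpleGraph.edgeSet_injective (by
        rw [← SimpleGraph.coe_edgeFinset C, h, SimpleGraph.coe_edgeFinset]))
    have : ∃ e ∈ C.edgeFinset ∪ C'.edgeFinset, ¬ (e ∈ C.edgeFinset ↔ e ∈ C'.edgeFinset) := by
      by_contra! hcon
      refine hne (Finset.ext fun e => ?_)
      by_cases he : e ∈ C.edgeFinset ∪ C'.edgeFinset
      · exact hcon e he
      · simp only [Finset.mem_union, not_or] at he
        simp only [he.1, he.2]
    obtain ⟨e, he, hi⟩ := this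
    refine Finset.prod_eq_zero he ?_
    by_cases h1 : e ∈ C.edgeFinset <;> by_cases h2 : e ∈ C'.edgeFinset
    · exact absurd (by simp only [h1, h2]) hi
    · rw [if_pos h1, if_neg h2, if_pos h1, if_neg h2]; ring
    · rw [if_neg h1, if_pos h2, if_neg h1, if_pos h2]; ring
    · exact absurd (by simp only [h1, h2]) hi

lemma variance_signedCycleCount_nullLaw (m n : ℕ) (p : I) :
    variance (signedCycleCount (m + 3) n p) (nullLaw n p) =
      (cycles (m + 3) n).card * ((p : ℝ) * (1 - p)) ^ (m + 3) := by
  classical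
  have : IsProbabilityMeasure (nullLaw n p) := by unfold nullLaw; infer_instance
  rw [variance_of_integral_eq_zero (measurable_of_finite _).aemeasurable
    (integral_signedCycleCount_nullLaw m n p)]
  simp_rw [sq, signedCycleCount_eq, Finset.sum_mul_sum]
  rw [integral_finsetSum _ fun C _ => Integrable.of_finite]
  rw [← nsmul_eq_mul]
  refine Finset.sum_eq_card_nsmul fun C hC => ?_
  rw [integral_finsetSum _ fun C _ => Integrable.of_finite]
  simp_rw [integral_nullLaw_prod_mul_prod]
  rw [Finset.sum_ite_eq, if_pos hC, card_edgeFinset_of_mem_cycles hC]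

/-! ### The planted mean as a cycle integral -/

/-- Coordinates picked by an embedding are again independent and identically distributed. -/
lemma map_comp_embedding_pi {ι κ X : Type*} [Fintype ι] [Fintype κ] [MeasurableSpace X]
    (μ : Measure X) [IsProbabilityMeasure μ] (v : ι ↪ κ) :
    (Measure.pi fun _ : κ => μ).map (fun u i => u (v i)) = Measure.pi fun _ : ι => μ := by
  classical
  refine (Measure.pi_eq fun s hs => ?_).symm
  rw [Measure.map_apply (by fun_prop) (MeasurableSet.univ_pi hs)]
  have : (fun (u : κ → X) i => u (v i)) ⁻¹' Set.pi Set.univ s =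
      Set.pi Set.univ fun j => ⋂ i, ⋂ (_ : v i = j), s i := by
    ext u
    simp only [Set.mem_preimage, Set.mem_pi, Set.mem_univ, true_implies, Set.mem_iInter]
    exact ⟨fun h j i hij => hij ▸ h i, fun h i => h _ i rfl⟩
  rw [this, Measure.pi_pi, ← Finset.prod_subset (Finset.subset_univ (Finset.univ.map v))]
  · rw [Finset.prod_map]
    refine Finset.prod_congr rfl fun i _ => ?_
    congr 1
    ext x
    simp
  · intro j _ hj
    have : (⋂ i, ⋂ (_ : v i = j), s i) = Set.univ := by
      refine Set.eq_univ_of_forall fun x => ?_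
      simp only [Set.mem_iInter]
      rintro i rfl
      exact absurd (Finset.mem_map_of_mem v (Finset.mem_univ i)) hj
    rw [this, measure_univ]

/-- The centered adjacency kernel `1{⟨x, y⟩ ≥ τ} - p` on the sphere. -/
def capKernel {d : ℕ} (p τ : ℝ) (x y : Sphere d) : ℝ :=
  centered p (τ ≤ inner ℝ (x : Space d) (y : Space d))

/-- The expected signed weight of a cycle of length `ℓ` all of whose vertices are in the
community: the integral of the product of the centered kernel along the cycle. -/
def cycleIntegral (ℓ d : ℕ) [NeZero ℓ] (p τ : ℝ) : ℝ :=
  ∫ w : Fin ℓ → Sphere d, ∏ i, capKernel p τ (w i) (w (i + 1))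
    ∂(Measure.pi fun _ => sphereUniform d)

lemma capKernel_comm {d : ℕ} (p τ : ℝ) (x y : Sphere d) :
    capKernel p τ x y = capKernel p τ y x := by
  unfold capKernel; rw [real_inner_comm]

lemma measurable_capKernel {d : ℕ} (p τ : ℝ) :
    Measurable fun x : Sphere d × Sphere d => capKernel p τ x.1 x.2 := by
  unfold capKernel
  refine (measurable_of_finite (centered p)).comp ?_
  refine Measurable.of_discrete.comp (f := fun x : Sphere d × Sphere d =>
    τ ≤ inner ℝ (x.1 : Space d) (x.2 : Space d)) (g := id) ?_
  exact measurableSet_setOfPred.1 (measurableSet_le measurable_const (by fun_prop))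

lemma measurable_plantedGraph {n d : ℕ} (τ : ℝ) :
    Measurable fun ω : Set (Fin n) × (Fin n → Sphere d) × SimpleGraph (Fin n) =>
      plantedGraph τ ω.1 ω.2.1 ω.2.2 := by
  rw [SimpleGraph.measurable_iff_adj]
  intro i j
  have h1 : ∀ i : Fin n, Measurable fun ω : Set (Fin n) × (Fin n → Sphere d) ×
      SimpleGraph (Fin n) => i ∈ ω.1 := fun i => by fun_prop
  have h2 : Measurable fun ω : Set (Fin n) × (Fin n → Sphere d) ×
      SimpleGraph (Fin n) => τ ≤ inner ℝ (ω.2.1 i : Space d) (ω.2.1 j) :=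
    measurableSet_setOfPred.1 (measurableSet_le measurable_const (by fun_prop))
  have h3 : Measurable fun ω : Set (Fin n) × (Fin n → Sphere d) ×
      SimpleGraph (Fin n) => ω.2.2.Adj i j :=
    (SimpleGraph.measurable_iff_adj.1 measurable_id i j).comp (measurable_snd.comp measurable_snd)
  have h4 : Measurable fun ω : Set (Fin n) × (Fin n → Sphere d) ×
      SimpleGraph (Fin n) => i ≠ j := measurable_const
  exact h4.and ((((h1 i).and ((h1 j).and h2))).or ((((h1 i).and (h1 j)).not).and h3))

lemma mem_edgeSet_plantedGraph_iff {n d : ℕ} (τ : ℝ) (S : Set (Fin n)) (u : Fin n → Sphere d)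
    (H : SimpleGraph (Fin n)) (e : Sym2 (Fin n)) (he : ¬ e.IsDiag) :
    e ∈ (plantedGraph τ S u H).edgeSet ↔
      e ∈ (plantedGraph τ S u (SimpleGraph.mk fun i j => i ≠ j ∧ e ∈ H.edgeSet)).edgeSet := by
  induction e with
  | _ a b =>
    have : a ≠ b := by simpa using he
    simp [plantedGraph, this]

open Classical in
/-- Averaging over the background graph annihilates a cycle with a vertex outside the community,
since an edge at that vertex has signed weight of mean zero. -/
lemma integral_binomialRandom_prod_plantedGraph {m n d : ℕ} (p : I) (τ : ℝ) (S : Set (Fin n))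
    (u : Fin n → Sphere d) (v : Fin (m + 3) ↪ Fin n) (C : SimpleGraph (Fin n))
    (hC : C = (SimpleGraph.cycleGraph (m + 3)).map v) :
    ∫ H, ∏ e ∈ C.edgeFinset,
      centered p (e ∈ (plantedGraph τ S u H).edgeSet) ∂(SimpleGraph.binomialRandom (Fin n) p) =
    (∏ j, if j ∈ Set.range v → j ∈ S then 1 else 0) *
      ∏ i, capKernel p τ (u (v i)) (u (v (i + 1))) := by
  set h : Sym2 (Fin n) → Prop → ℝ := fun e P =>
    centered p (e ∈ (plantedGraph τ S u (SimpleGraph.mk fun i j => i ≠ j ∧ P)).edgeSet) with hh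
  have h1 : ∀ H : SimpleGraph (Fin n), ∏ e ∈ C.edgeFinset,
      centered p (e ∈ (plantedGraph τ S u H).edgeSet) =
      ∏ e ∈ C.edgeFinset, h e (e ∈ H.edgeSet) := by
    intro H
    refine Finset.prod_congr rfl fun e he => ?_
    simp only [hh]
    rw [mem_edgeSet_plantedGraph_iff τ S u H e (not_isDiag_of_mem_edgeFinset C e he)]
  simp_rw [h1]
  rw [integral_binomialRandom_prod p _ (not_isDiag_of_mem_edgeFinset C) h]
  subst hC
  rw [prod_edgeFinset_map_cycleGraph]
  have hne : ∀ i : Fin (m + 3), v i ≠ v (i + 1) := by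
    intro i hi
    have := congrArg Fin.val (left_eq_add.1 (v.injective hi))
    simp at this
  have h2 : ∀ i, (p : ℝ) * h s(v i, v (i + 1)) True + (1 - p) * h s(v i, v (i + 1)) False =
      if v i ∈ S ∧ v (i + 1) ∈ S then capKernel p τ (u (v i)) (u (v (i + 1))) else 0 := by
    intro i
    simp only [hh, SimpleGraph.mem_edgeSet, plantedGraph, ne_eq, hne i, not_false_eq_true,
      true_and, and_true, and_false, or_false]
    split_ifs with hS
    · simp only [hS, true_and, not_true, or_false, capKernel]
      ring
    · have : ¬ (v i ∈ S ∧ v (i + 1) ∈ S ∧ τ ≤ inner ℝ (u (v i) : Space d)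
        (u (v (i + 1)) : Space d)) := fun h => hS ⟨h.1, h.2.1⟩
      simp only [this, hS, false_or, not_false_eq_true, centered_true, centered_false]
      ring
  simp_rw [h2]
  by_cases hall : ∀ i, v i ∈ S
  · rw [Finset.prod_eq_one (s := Finset.univ) (f := fun j => if j ∈ Set.range v → j ∈ S
      then (1 : ℝ) else 0), one_mul]
    · exact Finset.prod_congr rfl fun i _ => if_pos ⟨hall i, hall (i + 1)⟩
    · intro j _
      rw [if_pos]
      rintro ⟨i, rfl⟩
      exact hall i
  · push Not at hall
    obtain ⟨i, hi⟩ := hall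
    rw [Finset.prod_eq_zero (Finset.mem_univ i) (if_neg fun h => hi h.1),
      Finset.prod_eq_zero (Finset.mem_univ (v i)) (if_neg fun h => hi (h ⟨i, rfl⟩)), zero_mul]

lemma abs_centered_le {p : ℝ} (h0 : 0 ≤ p) (h1 : p ≤ 1) (P : Prop) : |centered p P| ≤ 1 := by
  unfold centered
  split_ifs
  · rw [abs_le]; constructor <;> linarith
  · rw [abs_le]; constructor <;> linarith

open Classical in
lemma integral_plantedLaw_cycle {m n d : ℕ} [IsProbabilityMeasure (sphereUniform d)] (p : I)
    {k : ℝ} (hk : 0 ≤ k) (hkn : k ≤ n) (C : SimpleGraph (Fin n))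
    (hC : C ∈ cycles (m + 3) n) :
    ∫ G : SimpleGraph (Fin n), ∏ e ∈ C.edgeFinset, centered p (e ∈ G.edgeSet)
      ∂(plantedLaw n p d k) =
    (k / n) ^ (m + 3) * cycleIntegral (m + 3) d p (threshold p d) := by
  obtain ⟨v, hv⟩ := (Finset.mem_filter.1 hC).2
  have hf : Measurable fun G : SimpleGraph (Fin n) =>
      ∏ e ∈ C.edgeFinset, centered p (e ∈ G.edgeSet) := measurable_of_finite _
  have hf1 : ∀ G : SimpleGraph (Fin n),
      ‖∏ e ∈ C.edgeFinset, centered p (e ∈ G.edgeSet)‖ ≤ 1 := by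
    intro G
    rw [Real.norm_eq_abs, Finset.abs_prod]
    exact Finset.prod_le_one (fun _ _ => abs_nonneg _) fun _ _ => abs_centered_le p.2.1 p.2.2 _
  have hint : Integrable (fun ω : Set (Fin n) × (Fin n → Sphere d) × SimpleGraph (Fin n) =>
      ∏ e ∈ C.edgeFinset, centered p (e ∈ (plantedGraph (threshold p d) ω.1 ω.2.1 ω.2.2).edgeSet))
      ((setBernoulli (Set.univ : Set (Fin n)) (Set.projIcc 0 1 zero_le_one (k / n))).prod
      ((Measure.pi fun _ : Fin n => sphereUniform d).prod
        (SimpleGraph.binomialRandom (Fin n) p))) :=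
    Integrable.of_bound (hf.comp (measurable_plantedGraph _)).aestronglyMeasurable 1
      (ae_of_all _ fun ω => hf1 _)
  unfold plantedLaw
  rw [integral_map (measurable_plantedGraph _).aemeasurable hf.aestronglyMeasurable,
    integral_prod _ hint]
  have hinner : ∀ S : Set (Fin n),
      ∫ y : (Fin n → Sphere d) × SimpleGraph (Fin n), ∏ e ∈ C.edgeFinset,
        centered p (e ∈ (plantedGraph (threshold p d) S y.1 y.2).edgeSet)
        ∂((Measure.pi fun _ : Fin n => sphereUniform d).prod
          (SimpleGraph.binomialRandom (Fin n) p)) =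
      (∏ j, if j ∈ Set.range v → j ∈ S then 1 else 0) *
        cycleIntegral (m + 3) d p (threshold p d) := by
    intro S
    rw [integral_prod]
    · simp only
      simp_rw [integral_binomialRandom_prod_plantedGraph p _ S _ v C hv]
      rw [integral_const_mul]
      congr 1
      unfold cycleIntegral
      rw [← map_comp_embedding_pi (sphereUniform d) v, integral_map
        (Measurable.aemeasurable (measurable_pi_lambda _ fun i => measurable_pi_apply _))]
      refine Measurable.aestronglyMeasurable ?_
      refine Finset.measurable_prod _ fun i _ => ?_
      exact (measurable_capKernel p (threshold p d)).comp
        (f := fun w : Fin (m + 3) → Sphere d => (w i, w (i + 1))) (by fun_prop)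
    · refine Integrable.of_bound (Measurable.aestronglyMeasurable ?_) 1 (ae_of_all _ fun ω => hf1 _)
      exact (hf.comp (measurable_plantedGraph _)).comp
        (f := fun y : (Fin n → Sphere d) × SimpleGraph (Fin n) => (S, y)) (by fun_prop)
  simp only
  simp_rw [hinner]
  rw [integral_mul_const]
  congr 1
  rw [integral_setBernoulli_prod _ _ fun j P => if j ∈ Set.range v → P then (1 : ℝ) else 0]
  have hq : ((Set.projIcc (0 : ℝ) 1 zero_le_one (k / n) : I) : ℝ) = k / n := by
    rw [Set.projIcc_of_mem]
    exact ⟨by positivity, div_le_one_of_le₀ hkn (by positivity)⟩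
  rw [hq]
  refine (Finset.prod_congr rfl
    (g := fun j => if j ∈ Finset.univ.map v then k / (n : ℝ) else 1) fun j _ => ?_).trans ?_
  · by_cases hj : j ∈ Set.range v
    · have : j ∈ Finset.univ.map v := by simpa using hj
      simp only [hj, this, Set.mem_univ, implies_true, if_true, true_implies, if_false]
      ring
    · have : j ∉ Finset.univ.map v := by simpa using hj
      simp only [hj, this, false_implies, if_true, if_false]
      ring
  · rw [Finset.prod_ite_mem, Finset.univ_inter, Finset.prod_const, Finset.card_map,
      Finset.card_univ, Fintype.card_fin]

lemma integral_signedCycleCount_plantedLaw {m n d : ℕ} [IsProbabilityMeasure (sphereUniform d)]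
    (p : I) {k : ℝ} (hk : 0 ≤ k) (hkn : k ≤ n) :
    ∫ G, signedCycleCount (m + 3) n p G ∂(plantedLaw n p d k) =
      (cycles (m + 3) n).card * ((k / n) ^ (m + 3) *
        cycleIntegral (m + 3) d p (threshold p d)) := by
  classical
  have : IsProbabilityMeasure (plantedLaw n p d k) :=
    Measure.isProbabilityMeasure_map (measurable_plantedGraph _).aemeasurable
  simp_rw [signedCycleCount_eq]
  rw [integral_finsetSum _ fun C _ => Integrable.of_finite, ← nsmul_eq_mul]
  exact Finset.sum_eq_card_nsmul fun C hC => integral_plantedLaw_cycle p hk hkn C hC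

/-! ### Kernel operators and traces of their powers -/

section KernelOp

variable {X : Type*} [MeasurableSpace X] (μ : Measure X) [IsProbabilityMeasure μ] (a : X → X → ℝ)

/-- The integral operator with kernel `a`. -/
def kernelOp (f : X → ℝ) (x : X) : ℝ := ∫ y, a x y * f y ∂μ

/-- Bounded measurable functions. -/
def BddMeas (f : X → ℝ) : Prop := Measurable f ∧ ∃ K, ∀ x, |f x| ≤ K

variable {μ a}

lemma BddMeas.integrable {f : X → ℝ} (hf : BddMeas f) : Integrable f μ := by
  obtain ⟨hm, K, hK⟩ := hf
  exact Integrable.of_bound hm.aestronglyMeasurable K (ae_of_all _ hK)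

lemma BddMeas.mul {f g : X → ℝ} (hf : BddMeas f) (hg : BddMeas g) :
    BddMeas fun x => f x * g x := by
  obtain ⟨hf, K, hK⟩ := hf
  obtain ⟨hg, K', hK'⟩ := hg
  refine ⟨hf.mul hg, K * K', fun x => ?_⟩
  rw [abs_mul]
  exact mul_le_mul (hK x) (hK' x) (abs_nonneg _) ((abs_nonneg _).trans (hK x))

/-- The Cauchy–Schwarz inequality for bounded measurable functions. -/
lemma BddMeas.integral_mul_sq_le {f g : X → ℝ} (hf : BddMeas f) (hg : BddMeas g) :
    (∫ x, f x * g x ∂μ) ^ 2 ≤ (∫ x, f x ^ 2 ∂μ) * ∫ x, g x ^ 2 ∂μ := by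
  have h : ∀ t : ℝ, 0 ≤ (∫ x, f x ^ 2 ∂μ) * (t * t) + (2 * ∫ x, f x * g x ∂μ) * t +
      ∫ x, g x ^ 2 ∂μ := by
    intro t
    have h1 : Integrable (fun x => f x ^ 2 * (t * t)) μ := by
      simp_rw [sq]; exact (hf.mul hf).integrable.mul_const _
    have h2 : Integrable (fun x => f x * g x * (2 * t)) μ := (hf.mul hg).integrable.mul_const _
    have h3 : Integrable (fun x => g x ^ 2) μ := by
      simp_rw [sq]; exact (hg.mul hg).integrable
    have : ∫ x, (f x * t + g x) ^ 2 ∂μ = (∫ x, f x ^ 2 ∂μ) * (t * t) +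
        (2 * ∫ x, f x * g x ∂μ) * t + ∫ x, g x ^ 2 ∂μ := by
      have e : ∀ x, (f x * t + g x) ^ 2 = f x ^ 2 * (t * t) + f x * g x * (2 * t) + g x ^ 2 :=
        fun x => by ring
      simp_rw [e]
      have e1 := integral_add (h1.add h2) h3
      have e2 := integral_add h1 h2
      simp only [Pi.add_apply] at e1 e2
      rw [e1, e2, integral_mul_const, integral_mul_const]
      ring
    rw [← this]
    exact integral_nonneg fun x => sq_nonneg _
  have := discrim_le_zero h
  unfold discrim at this
  nlinarith

lemma measurable_cons {n : ℕ} (z : X) :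
    Measurable fun w : Fin n → X => (Fin.cons z w : Fin (n + 1) → X) := by
  refine measurable_pi_lambda _ fun i => ?_
  refine Fin.cases ?_ (fun j => ?_) i
  · simp only [Fin.cons_zero]; exact measurable_const
  · simp only [Fin.cons_succ]; exact measurable_pi_apply j

lemma measurable_snoc {n : ℕ} (z : X) :
    Measurable fun w : Fin n → X => (Fin.snoc w z : Fin (n + 1) → X) := by
  refine measurable_pi_lambda _ fun i => ?_
  refine Fin.lastCases ?_ (fun j => ?_) i
  · simp only [Fin.snoc_last]; exact measurable_const
  · simp only [Fin.snoc_castSucc]; exact measurable_pi_apply j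

section

variable (ha : Measurable (Function.uncurry a)) (hb : ∀ x y, |a x y| ≤ 1)

include ha hb

lemma BddMeas.kernelOp {f : X → ℝ} (hf : BddMeas f) : BddMeas (kernelOp μ a f) := by
  obtain ⟨hm, K, hK⟩ := hf
  refine ⟨?_, K, fun x => ?_⟩
  · have : StronglyMeasurable (Function.uncurry fun x y => a x y * f y) :=
      (ha.mul (hm.comp measurable_snd)).stronglyMeasurable
    exact this.integral_prod_right.measurable
  · refine (norm_integral_le_of_norm_le_const (f := fun y => a x y * f y) (C := K)
      (ae_of_all μ fun y => ?_)).trans ?_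
    · rw [Real.norm_eq_abs, abs_mul]
      calc |a x y| * |f y| ≤ 1 * K := mul_le_mul (hb x y) (hK y) (abs_nonneg _) zero_le_one
        _ = K := one_mul K
    · simp

lemma BddMeas.iterate_kernelOp {f : X → ℝ} (hf : BddMeas f) (j : ℕ) :
    BddMeas ((LocalGeometry.kernelOp μ a)^[j] f) := by
  induction j with
  | zero => exact hf
  | succ j ih =>
    rw [Function.iterate_succ_apply']
    exact ih.kernelOp ha hb

lemma bddMeas_left (x : X) : BddMeas fun y => a y x :=
  ⟨ha.comp (measurable_id.prodMk measurable_const), 1, fun y => hb y x⟩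

lemma bddMeas_right (x : X) : BddMeas fun y => a x y :=
  ⟨ha.comp (measurable_const.prodMk measurable_id), 1, fun y => hb x y⟩

lemma integral_kernelOp_mul (hs : ∀ x y, a x y = a y x) {f g : X → ℝ} (hf : BddMeas f)
    (hg : BddMeas g) :
    ∫ x, kernelOp μ a f x * g x ∂μ = ∫ x, f x * kernelOp μ a g x ∂μ := by
  unfold kernelOp
  simp_rw [← integral_mul_const, ← integral_const_mul]
  rw [integral_integral_swap]
  · refine integral_congr_ae (ae_of_all _ fun y => integral_congr_ae (ae_of_all _ fun x => ?_))
    simp only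
    rw [hs x y]; ring
  · obtain ⟨hf, K, hK⟩ := hf
    obtain ⟨hg, K', hK'⟩ := hg
    refine Integrable.of_bound (C := 1 * K * K') (Measurable.aestronglyMeasurable ?_)
      (ae_of_all _ fun z => ?_)
    · exact (ha.mul (hf.comp measurable_snd)).mul (hg.comp measurable_fst)
    · simp only [Function.uncurry, Real.norm_eq_abs, abs_mul]
      have := (abs_nonneg _).trans (hK z.2)
      gcongr
      · exact hb _ _
      · exact hK _
      · exact hK' _

lemma integral_kernelOp_eq_zero (h0 : ∀ y, ∫ x, a x y ∂μ = 0) {f : X → ℝ} (hf : BddMeas f) :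
    ∫ x, kernelOp μ a f x ∂μ = 0 := by
  unfold kernelOp
  rw [integral_integral_swap]
  · simp_rw [integral_mul_const, h0, zero_mul, integral_zero]
  · obtain ⟨hf, K, hK⟩ := hf
    refine Integrable.of_bound (C := 1 * K) (Measurable.aestronglyMeasurable ?_)
      (ae_of_all _ fun z => ?_)
    · exact ha.mul (hf.comp measurable_snd)
    · simp only [Function.uncurry, Real.norm_eq_abs, abs_mul]
      gcongr
      · exact hb _ _
      · exact hK _

/-- Integrating out the interior vertices of a path iterates the kernel operator. -/
lemma integral_path_eq_iterate (n : ℕ) (z x : X) :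
    ∫ w : Fin n → X, ∏ i : Fin (n + 1),
      a (Fin.cons (α := fun _ => X) z w i) (Fin.snoc (α := fun _ => X) w x i)
      ∂(Measure.pi fun _ => μ) = (kernelOp μ a)^[n] (fun y => a y x) z := by
  induction n generalizing z with
  | zero => simp [Fin.snoc]
  | succ n ih =>
    rw [Function.iterate_succ_apply', kernelOp]
    have hmp := (measurePreserving_piFinSuccAbove (fun _ : Fin (n + 1) => μ) 0).symm
    rw [← hmp.integral_comp (MeasurableEquiv.measurableEmbedding _)]
    have hmeas : Measurable fun w : Fin (n + 1) → X => ∏ i : Fin (n + 2),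
        a (Fin.cons (α := fun _ => X) z w i) (Fin.snoc (α := fun _ => X) w x i) := by
      refine Finset.measurable_prod _ fun i _ => ?_
      refine ha.comp (Measurable.prodMk ?_ ?_)
      · exact measurable_pi_apply i |>.comp (measurable_cons z)
      · exact measurable_pi_apply i |>.comp (measurable_snoc x)
    rw [integral_prod]
    · refine integral_congr_ae (ae_of_all _ fun y => ?_)
      simp only
      rw [← ih y, ← integral_const_mul]
      refine integral_congr_ae (ae_of_all _ fun w => ?_)
      have e : (MeasurableEquiv.piFinSuccAbove (fun _ : Fin (n + 1) => X) 0).symm (y, w) =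
          (Fin.cons y w : Fin (n + 1) → X) := by
        simp [MeasurableEquiv.piFinSuccAbove, Fin.insertNthEquiv]
      simp only [e]
      rw [Fin.prod_univ_succ]
      congr 1
      refine Finset.prod_congr rfl fun i _ => ?_
      rw [← Fin.cons_snoc_eq_snoc_cons]
      simp
    · refine Integrable.of_bound (C := 1) ?_ (ae_of_all _ fun w => ?_)
      · exact (hmeas.comp (MeasurableEquiv.measurable _)).aestronglyMeasurable
      · rw [Real.norm_eq_abs, Finset.abs_prod]
        exact Finset.prod_le_one (fun _ _ => abs_nonneg _) fun _ _ => hb _ _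

/-- The integral of a product of kernels along a cycle is the trace of a power of the operator. -/
lemma integral_cycle_eq_integral_iterate (n : ℕ) :
    ∫ w : Fin (n + 1) → X, ∏ i, a (w i) (w (i + 1)) ∂(Measure.pi fun _ => μ) =
      ∫ z, (kernelOp μ a)^[n] (fun y => a y z) z ∂μ := by
  have hmp := (measurePreserving_piFinSuccAbove (fun _ : Fin (n + 1) => μ) 0).symm
  rw [← hmp.integral_comp (MeasurableEquiv.measurableEmbedding _)]
  rw [integral_prod]
  · refine integral_congr_ae (ae_of_all _ fun z => ?_)
    simp only
    rw [← integral_path_eq_iterate ha hb]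
    refine integral_congr_ae (ae_of_all _ fun w => ?_)
    have e : (MeasurableEquiv.piFinSuccAbove (fun _ : Fin (n + 1) => X) 0).symm (z, w) =
        (Fin.cons z w : Fin (n + 1) → X) := by
      simp [MeasurableEquiv.piFinSuccAbove, Fin.insertNthEquiv]
    simp only [e]
    refine Finset.prod_congr rfl fun i _ => ?_
    congr 1
    refine Fin.lastCases ?_ (fun j => ?_) i
    · simp
    · simp [Fin.coeSucc_eq_succ]
  · refine Integrable.of_bound (C := 1) ?_ (ae_of_all _ fun w => ?_)
    · refine Measurable.aestronglyMeasurable (Measurable.comp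
        (g := fun w : Fin (n + 1) → X => ∏ i, a (w i) (w (i + 1))) ?_
        (MeasurableEquiv.measurable _))
      refine Finset.measurable_prod _ fun i _ => ?_
      exact ha.comp (f := fun w : Fin (n + 1) → X => (w i, w (i + 1)))
        ((measurable_pi_apply _).prodMk (measurable_pi_apply _))
    · rw [Real.norm_eq_abs, Finset.abs_prod]
      exact Finset.prod_le_one (fun _ _ => abs_nonneg _) fun _ _ => hb _ _

end

/-- A log-convex sequence bounded by a geometric one contracts at the geometric rate from the
start: if some ratio exceeded `r`, so would all the later ones. -/
lemma le_mul_of_logConvex {b : ℕ → ℝ} {r K : ℝ} (hr : 0 < r) (hb : ∀ j, 0 ≤ b j)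
    (hconv : ∀ j, b (j + 1) ^ 2 ≤ b j * b (j + 2)) (hK : ∀ j, b j ≤ K * r ^ j) (j : ℕ) :
    b (j + 1) ≤ r * b j := by
  by_contra! h
  have hj : 0 < b j := by
    refine (hb j).lt_of_ne fun h0 => ?_
    have := hconv j
    rw [← h0, zero_mul] at this
    rw [← h0, mul_zero] at h
    nlinarith
  set ρ := b (j + 1) / b j with hρ
  have hρr : r < ρ := (lt_div_iff₀ hj).2 h
  have hρ0 : 0 < ρ := hr.trans hρr
  have key : ∀ i, 0 < b (j + i) ∧ ρ * b (j + i) ≤ b (j + i + 1) := by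
    intro i
    induction i with
    | zero => exact ⟨hj, by rw [hρ]; simp [hj.ne']⟩
    | succ i ih =>
      have h1 : 0 < b (j + i + 1) := (mul_pos hρ0 ih.1).trans_le ih.2
      refine ⟨h1, ?_⟩
      have h2 := hconv (j + i)
      have h3 : ρ * b (j + i + 1) * b (j + i) ≤ b (j + i + 2) * b (j + i) := by nlinarith
      exact le_of_mul_le_mul_right h3 ih.1
  have hpow : ∀ i, ρ ^ i * b j ≤ b (j + i) := by
    intro i
    induction i with
    | zero => simp
    | succ i ih =>
      have := (key i).2
      calc ρ ^ (i + 1) * b j = ρ * (ρ ^ i * b j) := by ring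
        _ ≤ ρ * b (j + i) := by gcongr
        _ ≤ _ := this
  have hlt : 1 < ρ / r := (one_lt_div hr).2 hρr
  obtain ⟨i, hi⟩ := pow_unbounded_of_one_lt (K * r ^ j / b j) hlt
  have h4 := (hpow i).trans (hK (j + i))
  rw [div_lt_iff₀ hj, div_pow, div_mul_eq_mul_div, lt_div_iff₀ (by positivity)] at hi
  rw [pow_add] at h4
  linarith

/-- A symmetric kernel operator whose iterates on `f` decay like `r ^ j` in the supremum norm
contracts the `L²` norm along the orbit of `f` by the factor `r`. -/
lemma integral_sq_iterate_kernelOp_le (ha : Measurable (Function.uncurry a))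
    (hb : ∀ x y, |a x y| ≤ 1) (hs : ∀ x y, a x y = a y x) {f : X → ℝ} (hf : BddMeas f)
    {r K : ℝ} (hr : 0 < r) (hK : ∀ j x, |(kernelOp μ a)^[j] f x| ≤ K * r ^ j) (j : ℕ) :
    ∫ x, ((kernelOp μ a)^[j] f x) ^ 2 ∂μ ≤ (r ^ 2) ^ j * ∫ x, f x ^ 2 ∂μ := by
  set b : ℕ → ℝ := fun j => ∫ x, ((kernelOp μ a)^[j] f x) ^ 2 ∂μ with hbdef
  have hB := fun j => hf.iterate_kernelOp (μ := μ) ha hb j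
  have hstep : ∀ j, b (j + 1) ≤ r ^ 2 * b j := by
    refine le_mul_of_logConvex (K := K ^ 2) (by positivity)
      (fun j => integral_nonneg fun x => sq_nonneg _) (fun j => ?_) fun j => ?_
    · have e : b (j + 1) = ∫ x, (kernelOp μ a)^[j] f x * (kernelOp μ a)^[j + 2] f x ∂μ := by
        have e1 : (kernelOp μ a)^[j + 1] f = kernelOp μ a ((kernelOp μ a)^[j] f) :=
          Function.iterate_succ_apply' _ _ _
        have e2 : (kernelOp μ a)^[j + 2] f = kernelOp μ a ((kernelOp μ a)^[j + 1] f) :=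
          Function.iterate_succ_apply' _ _ _
        simp only [hbdef, sq]
        rw [e2, ← integral_kernelOp_mul ha hb hs (hB j) (hB (j + 1)), ← e1]
      rw [e]
      exact (hB j).integral_mul_sq_le (hB (j + 2))
    · have : ∀ x, ((kernelOp μ a)^[j] f x) ^ 2 ≤ K ^ 2 * (r ^ 2) ^ j := by
        intro x
        calc ((kernelOp μ a)^[j] f x) ^ 2 = |(kernelOp μ a)^[j] f x| ^ 2 := (sq_abs _).symm
          _ ≤ (K * r ^ j) ^ 2 := by gcongr; exact hK j x
          _ = _ := by ring
      calc b j ≤ ∫ x, K ^ 2 * (r ^ 2) ^ j ∂μ := by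
            refine integral_mono ?_ (integrable_const _) this
            simp_rw [sq]; exact ((hB j).mul (hB j)).integrable
        _ = _ := by simp
  induction j with
  | zero => simp
  | succ j ih =>
    calc b (j + 1) ≤ r ^ 2 * b j := hstep j
      _ ≤ r ^ 2 * ((r ^ 2) ^ j * ∫ x, f x ^ 2 ∂μ) := by gcongr
      _ = _ := by ring

end KernelOp

/-! ### The uniform law on the sphere -/

section SphereUniform

variable {d : ℕ}

instance [NeZero d] : IsProbabilityMeasure (sphereUniform d) where
  measure_univ := by
    have : Nontrivial (Space d) :=
      Module.nontrivial_of_finrank_pos (R := ℝ) (by simp [Nat.pos_of_ne_zero (NeZero.ne d)])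
    rw [sphereUniform, Measure.smul_apply, smul_eq_mul]
    refine ENNReal.inv_mul_cancel ?_ (measure_ne_top _ _)
    rw [Ne, Measure.measure_univ_eq_zero]
    exact Measure.toSphere_ne_zero _

lemma lintegral_eq_lintegral_toSphere_prod [Nontrivial (Space d)]
    (h : Space d → ℝ≥0∞) :
    ∫⁻ z, h z = ∫⁻ x : Sphere d × Set.Ioi (0 : ℝ), h ((x.2 : ℝ) • (x.1 : Space d))
      ∂((volume : Measure (Space d)).toSphere.prod
        (Measure.volumeIoiPow (Module.finrank ℝ (Space d) - 1))) := by
  have hmp := Measure.measurePreserving_homeomorphUnitSphereProd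
    (volume : Measure (Space d))
  conv_lhs => rw [← restrict_compl_singleton (μ := volume) 0]
  rw [← hmp.lintegral_comp_emb (Homeomorph.measurableEmbedding _),
    ← lintegral_subtype_comap (MeasurableSet.singleton _).compl]
  refine lintegral_congr fun z => ?_
  have := congrArg Subtype.val ((homeomorphUnitSphereProd (Space d)).symm_apply_apply z)
  rw [homeomorphUnitSphereProd_symm_apply_coe] at this
  rw [this]

lemma lintegral_exp_neg_pi_norm_sq :
    ∫⁻ z : Space d, ENNReal.ofReal (Real.exp (-Real.pi * ‖z‖ ^ 2)) = 1 := by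
  rw [← ofReal_integral_eq_lintegral_ofReal]
  · have := GaussianFourier.integral_rexp_neg_mul_sq_norm (V := EuclideanSpace ℝ (Fin d))
      Real.pi_pos
    rw [this]
    simp [Real.pi_ne_zero]
  · have := GaussianFourier.integrable_cexp_neg_mul_sq_norm_add
      (V := EuclideanSpace ℝ (Fin d)) (b := (Real.pi : ℂ)) (by simpa using Real.pi_pos) 0 0
    have h2 := this.re
    refine h2.congr (ae_of_all _ fun z => ?_)
    simp only [zero_mul, add_zero]
    norm_cast
  · exact ae_of_all _ fun z => (Real.exp_pos _).le

/-- The uniform law on the sphere is the law of the direction of a centered Gaussian vector. -/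
lemma lintegral_sphereUniform [NeZero d] {F : Space d → ℝ≥0∞}
    (hF : Measurable F) :
    ∫⁻ u : Sphere d, F u ∂(sphereUniform d) =
      ∫⁻ z : Space d, F (‖z‖⁻¹ • z) * ENNReal.ofReal (Real.exp (-Real.pi * ‖z‖ ^ 2)) := by
  have hnt : Nontrivial (Space d) :=
      Module.nontrivial_of_finrank_pos (R := ℝ) (by simp [Nat.pos_of_ne_zero (NeZero.ne d)])
  have key : ∀ F : Space d → ℝ≥0∞, Measurable F →
      ∫⁻ z : Space d, F (‖z‖⁻¹ • z) * ENNReal.ofReal (Real.exp (-Real.pi * ‖z‖ ^ 2)) =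
      (∫⁻ u : Sphere d, F u ∂(volume : Measure (Space d)).toSphere) *
      ∫⁻ r : Set.Ioi (0 : ℝ), ENNReal.ofReal (Real.exp (-Real.pi * (r : ℝ) ^ 2))
        ∂(Measure.volumeIoiPow (Module.finrank ℝ (Space d) - 1)) := by
    intro F hF
    rw [← lintegral_prod_mul (by fun_prop) (by fun_prop),
      lintegral_eq_lintegral_toSphere_prod]
    refine lintegral_congr fun x => ?_
    have hr : 0 < (x.2 : ℝ) := x.2.2
    have hx : ‖(x.1 : Space d)‖ = 1 := by simp
    rw [norm_smul, hx, mul_one, Real.norm_of_nonneg hr.le, smul_smul, inv_mul_cancel₀ hr.ne',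
      one_smul]
  have h1 := key (fun _ => 1) measurable_const
  simp only [one_mul, lintegral_exp_neg_pi_norm_sq, lintegral_one] at h1
  have hinv : (∫⁻ r : Set.Ioi (0 : ℝ), ENNReal.ofReal (Real.exp (-Real.pi * (r : ℝ) ^ 2))
        ∂(Measure.volumeIoiPow (Module.finrank ℝ (Space d) - 1))) =
      ((volume : Measure (Space d)).toSphere Set.univ)⁻¹ :=
    ENNReal.eq_inv_of_mul_eq_one_left (by rw [mul_comm]; exact h1.symm)
  rw [key F hF, hinv, sphereUniform, lintegral_smul_measure, smul_eq_mul, mul_comm]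

/-- The action of a linear isometry on the sphere. -/
def sphereMap (T : Space d ≃ₗᵢ[ℝ] Space d) (u : Sphere d) :
    Sphere d := ⟨T u, by simp⟩

lemma measurable_sphereMap (T : Space d ≃ₗᵢ[ℝ] Space d) :
    Measurable (sphereMap T) :=
  (T.continuous.measurable.comp measurable_subtype_coe).subtype_mk

lemma measurePreserving_sphereMap [NeZero d]
    (T : Space d ≃ₗᵢ[ℝ] Space d) :
    MeasurePreserving (sphereMap T) (sphereUniform d) (sphereUniform d) := by
  refine ⟨measurable_sphereMap T, ?_⟩
  ext s hs
  obtain ⟨s', hs', rfl⟩ := hs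
  rw [Measure.map_apply (measurable_sphereMap T) (measurable_subtype_coe hs'),
    ← lintegral_indicator_one (measurable_subtype_coe hs'),
    ← lintegral_indicator_one (measurable_sphereMap T (measurable_subtype_coe hs'))]
  have h1 := lintegral_sphereUniform (d := d) (F := s'.indicator 1)
    (measurable_one.indicator hs')
  have h2 := lintegral_sphereUniform (d := d) (F := fun z => s'.indicator 1 (T z))
    ((measurable_one.indicator hs').comp T.continuous.measurable)
  refine (h2.trans ?_).trans h1.symm
  have h3 := T.measurePreserving.lintegral_comp_emb T.toHomeomorph.measurableEmbedding
    fun z => s'.indicator 1 (‖z‖⁻¹ • z) * ENNReal.ofReal (Real.exp (-Real.pi * ‖z‖ ^ 2))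
  rw [← h3]
  refine lintegral_congr fun z => ?_
  rw [map_smul, T.norm_map]

end SphereUniform

/-! ### Projection of a uniform point to a coordinate plane -/

lemma setLIntegral_Ioi_mul_exp_neg_pi_sq {b : ℝ} (hb : 0 ≤ b) :
    ∫⁻ r in Set.Ioi b, ENNReal.ofReal (2 * Real.pi * r * Real.exp (-Real.pi * r ^ 2)) =
      ENNReal.ofReal (Real.exp (-Real.pi * b ^ 2)) := by
  have hderiv : ∀ r ∈ Set.Ici b, HasDerivAt (fun r : ℝ => -Real.exp (-Real.pi * r ^ 2))
      (2 * Real.pi * r * Real.exp (-Real.pi * r ^ 2)) r := by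
    intro r _
    have := (((hasDerivAt_pow 2 r).const_mul (-Real.pi)).exp).neg
    refine this.congr_deriv ?_
    norm_num
    ring
  have hpos : ∀ r ∈ Set.Ioi b, 0 ≤ 2 * Real.pi * r * Real.exp (-Real.pi * r ^ 2) := by
    intro r hr
    have : 0 ≤ r := hb.trans (le_of_lt hr)
    positivity
  have hlim : Tendsto (fun r : ℝ => -Real.exp (-Real.pi * r ^ 2)) atTop (nhds (-0)) := by
    refine Tendsto.neg (Real.tendsto_exp_atBot.comp ?_)
    simp_rw [neg_mul]
    exact tendsto_neg_atTop_atBot.comp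
      (Tendsto.const_mul_atTop Real.pi_pos (tendsto_pow_atTop two_ne_zero))
  have hint := integrableOn_Ioi_deriv_of_nonneg' hderiv hpos hlim
  rw [← ofReal_integral_eq_lintegral_ofReal hint
    ((ae_restrict_iff' measurableSet_Ioi).2 (ae_of_all _ hpos)),
    integral_Ioi_of_hasDerivAt_of_tendsto' hderiv hint hlim]
  simp

/-- The tail of the norm of a planar Gaussian vector. -/
lemma lintegral_plane_gaussian_tail {a : ℝ} (ha : 0 ≤ a) :
    ∫⁻ q : ℝ × ℝ, {q : ℝ × ℝ | a ≤ q.1 ^ 2 + q.2 ^ 2}.indicator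
      (fun q => ENNReal.ofReal (Real.exp (-Real.pi * (q.1 ^ 2 + q.2 ^ 2)))) q =
      ENNReal.ofReal (Real.exp (-Real.pi * a)) := by
  obtain ⟨b, hb, rfl⟩ : ∃ b : ℝ, 0 ≤ b ∧ a = b ^ 2 :=
    ⟨√a, Real.sqrt_nonneg _, (Real.sq_sqrt ha).symm⟩
  rw [← setLIntegral_Ioi_mul_exp_neg_pi_sq hb, ← lintegral_comp_polarCoord_symm]
  have htarget : polarCoord.target = Set.Ioi (0 : ℝ) ×ˢ Set.Ioo (-Real.pi) Real.pi := rfl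
  rw [htarget, Measure.volume_eq_prod, ← Measure.prod_restrict]
  have e : ∀ p : ℝ × ℝ, {q : ℝ × ℝ | b ^ 2 ≤ q.1 ^ 2 + q.2 ^ 2}.indicator
      (fun q => ENNReal.ofReal (Real.exp (-Real.pi * (q.1 ^ 2 + q.2 ^ 2)))) (polarCoord.symm p) =
      {r : ℝ | b ^ 2 ≤ r ^ 2}.indicator
      (fun r => ENNReal.ofReal (Real.exp (-Real.pi * r ^ 2))) p.1 := by
    intro p
    have h : (p.1 * Real.cos p.2) ^ 2 + (p.1 * Real.sin p.2) ^ 2 = p.1 ^ 2 := by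
      rw [mul_pow, mul_pow, ← mul_add, Real.cos_sq_add_sin_sq, mul_one]
    simp only [polarCoord_symm_apply, Set.indicator_apply, Set.mem_ofPred_eq, h]
  simp_rw [e]
  have hm : MeasurableSet {r : ℝ | b ^ 2 ≤ r ^ 2} :=
    measurableSet_le measurable_const (by fun_prop)
  have hm2 : Measurable ({r : ℝ | b ^ 2 ≤ r ^ 2}.indicator
      (fun r => ENNReal.ofReal (Real.exp (-Real.pi * r ^ 2)))) :=
    Measurable.indicator (by fun_prop) hm
  rw [lintegral_prod _ (by fun_prop)]
  simp only [lintegral_const, Measure.restrict_apply_univ, Real.volume_Ioo, smul_eq_mul]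
  rw [setLIntegral_congr (Ioi_ae_eq_Ici (a := b)), ← lintegral_indicator measurableSet_Ici,
    ← lintegral_indicator measurableSet_Ioi]
  refine lintegral_congr_ae ?_
  have h0 : ∀ᵐ r : ℝ, r ≠ 0 := by simp [ae_iff]
  filter_upwards [h0] with r hr
  by_cases h : 0 < r
  · by_cases hbr : b ≤ r
    · have : b ^ 2 ≤ r ^ 2 := by gcongr
      simp only [Set.indicator_apply, Set.mem_Ioi, h, if_true, Set.mem_ofPred_eq, this,
        Set.mem_Ici, hbr]
      rw [← ENNReal.ofReal_mul h.le, ← ENNReal.ofReal_mul (by positivity)]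
      congr 1
      ring
    · have : ¬ b ^ 2 ≤ r ^ 2 := fun h' => hbr ((sq_le_sq₀ hb h.le).1 h')
      simp [Set.indicator_apply, this, hbr]
  · have h1 : ¬ b ≤ r := fun h' => h ((hb.trans h').lt_of_ne hr.symm)
    simp [Set.indicator_apply, h, h1]

lemma lintegral_pi_fin_add_two {m : ℕ} {h : (Fin (m + 2) → ℝ) → ℝ≥0∞} (hh : Measurable h) :
    ∫⁻ z, h z = ∫⁻ y : Fin m → ℝ, ∫⁻ q : ℝ × ℝ, h (Fin.cons q.1 (Fin.cons q.2 y)) := by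
  have hc : ∀ n, Measurable fun x : ℝ × (Fin n → ℝ) => (Fin.cons x.1 x.2 : Fin (n + 1) → ℝ) := by
    intro n
    refine measurable_pi_lambda _ fun i => ?_
    refine Fin.cases ?_ (fun j => ?_) i
    · simp only [Fin.cons_zero]; exact measurable_fst
    · simp only [Fin.cons_succ]; exact (measurable_pi_apply j).comp measurable_snd
  have step : ∀ (n : ℕ) (h : (Fin (n + 1) → ℝ) → ℝ≥0∞), Measurable h →
      ∫⁻ z, h z = ∫⁻ t : ℝ, ∫⁻ y : Fin n → ℝ, h (Fin.cons t y) := by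
    intro n h hh
    have hmp := (volume_preserving_piFinSuccAbove (fun _ : Fin (n + 1) => ℝ) 0).symm
    rw [← hmp.lintegral_comp_emb (MeasurableEquiv.measurableEmbedding _),
      Measure.volume_eq_prod, lintegral_prod]
    · refine lintegral_congr fun t => lintegral_congr fun y => ?_
      congr 1
      simp [MeasurableEquiv.piFinSuccAbove, Fin.insertNthEquiv]
    · exact (hh.comp (MeasurableEquiv.measurable _)).aemeasurable
  rw [step _ _ hh]
  have hm3 : Measurable fun x : (Fin m → ℝ) × (ℝ × ℝ) =>
      h (Fin.cons x.2.1 (Fin.cons x.2.2 x.1)) :=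
    hh.comp ((hc _).comp ((measurable_fst.comp measurable_snd).prodMk
      ((hc _).comp ((measurable_snd.comp measurable_snd).prodMk measurable_fst))))
  conv_rhs => rw [lintegral_lintegral_swap hm3.aemeasurable]
  rw [Measure.volume_eq_prod, lintegral_prod]
  · refine lintegral_congr fun t => ?_
    exact step _ _ (hh.comp ((hc _).comp (measurable_const.prodMk measurable_id)))
  · exact (hm3.lintegral_prod_left').aemeasurable

/-- The law of the norm of the projection of a uniform point of the sphere of `ℝ^{m+2}` to a
coordinate plane: the probability that it is at least `r` is `(1 - r²)^{m/2}`. -/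
lemma sphereUniform_coord_tail (m : ℕ) {r : ℝ} (hr0 : 0 ≤ r) (hr1 : r < 1) :
    sphereUniform (m + 2) {w : Sphere (m + 2) | r ^ 2 ≤ (w : Space (m + 2)) 0 ^ 2 +
      (w : Space (m + 2)) 1 ^ 2} = ENNReal.ofReal ((1 - r ^ 2) ^ ((m : ℝ) / 2)) := by
  have hr2 : 0 < 1 - r ^ 2 := by nlinarith
  set s : Set (Space (m + 2)) := {z | r ^ 2 ≤ z 0 ^ 2 + z 1 ^ 2} with hs
  have hsm : MeasurableSet s := measurableSet_le measurable_const (by fun_prop)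
  have h1 := lintegral_sphereUniform (d := m + 2) (F := s.indicator 1)
    (measurable_one.indicator hsm)
  have h2 : sphereUniform (m + 2) {w : Sphere (m + 2) | r ^ 2 ≤ (w : Space (m + 2)) 0 ^ 2 +
      (w : Space (m + 2)) 1 ^ 2} =
      ∫⁻ u : Sphere (m + 2), s.indicator 1 (u : Space (m + 2))
        ∂(sphereUniform (m + 2)) := by
    exact (lintegral_indicator_one (measurable_subtype_coe hsm)).symm
  rw [h2, h1]
  set c := r ^ 2 / (1 - r ^ 2) with hc
  have hc0 : 0 ≤ c := by positivity
  -- the density on `ℝ × ℝ × ℝ^m`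
  have h3 : ∀ z : Space (m + 2), z ≠ 0 →
      s.indicator 1 (‖z‖⁻¹ • z) * ENNReal.ofReal (Real.exp (-Real.pi * ‖z‖ ^ 2)) =
      {q : ℝ × ℝ | c * ∑ i : Fin m, z i.succ.succ ^ 2 ≤ q.1 ^ 2 + q.2 ^ 2}.indicator
      (fun q => ENNReal.ofReal (Real.exp (-Real.pi * (q.1 ^ 2 + q.2 ^ 2)))) (z 0, z 1) *
      ENNReal.ofReal (Real.exp (-Real.pi * ∑ i : Fin m, z i.succ.succ ^ 2)) := by
    intro z hz
    have hn : ‖z‖ ^ 2 = z 0 ^ 2 + z 1 ^ 2 + ∑ i : Fin m, z i.succ.succ ^ 2 := by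
      rw [EuclideanSpace.real_norm_sq_eq, Fin.sum_univ_succ, Fin.sum_univ_succ, ← add_assoc]
      rfl
    have hn0 : 0 < ‖z‖ ^ 2 := by positivity
    have hiff : ‖z‖⁻¹ • z ∈ s ↔ (z 0, z 1) ∈
        {q : ℝ × ℝ | c * ∑ i : Fin m, z i.succ.succ ^ 2 ≤ q.1 ^ 2 + q.2 ^ 2} := by
      simp only [hs, Set.mem_ofPred_eq, PiLp.smul_apply, smul_eq_mul, mul_pow, inv_pow]
      rw [← mul_add, ← div_eq_inv_mul, le_div_iff₀ hn0, hc, div_mul_eq_mul_div,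
        div_le_iff₀ hr2, hn]
      constructor <;> intro h <;> linarith
    by_cases h : ‖z‖⁻¹ • z ∈ s
    · rw [Set.indicator_of_mem h, Set.indicator_of_mem (hiff.1 h), Pi.one_apply, one_mul,
        ← ENNReal.ofReal_mul (by positivity), ← Real.exp_add, hn, mul_add (-Real.pi)]
    · rw [Set.indicator_of_notMem h, Set.indicator_of_notMem (mt hiff.2 h), zero_mul, zero_mul]
  have h4 : ∀ᵐ z : Space (m + 2), z ≠ 0 := by simp [ae_iff]
  rw [lintegral_congr_ae (h4.mono h3)]
  rw [← (PiLp.volume_preserving_toLp (Fin (m + 2))).lintegral_comp_emb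
    (MeasurableEquiv.toLp 2 _).measurableEmbedding, lintegral_pi_fin_add_two]
  · simp only [Fin.cons_zero, Fin.cons_succ, Fin.cons_one]
    have h5 : ∀ y : Fin m → ℝ, ∫⁻ q : ℝ × ℝ,
        {q : ℝ × ℝ | c * ∑ i : Fin m, y i ^ 2 ≤ q.1 ^ 2 + q.2 ^ 2}.indicator
        (fun q => ENNReal.ofReal (Real.exp (-Real.pi * (q.1 ^ 2 + q.2 ^ 2)))) (q.1, q.2) *
        ENNReal.ofReal (Real.exp (-Real.pi * ∑ i : Fin m, y i ^ 2)) =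
        ENNReal.ofReal (Real.exp (-(Real.pi * (1 + c)) * ‖WithLp.toLp 2 y‖ ^ 2)) := by
      intro y
      rw [lintegral_mul_const'' _ (by
        refine (Measurable.indicator (by fun_prop) ?_).aemeasurable
        exact measurableSet_le measurable_const (by fun_prop))]
      rw [lintegral_plane_gaussian_tail (by positivity), ← ENNReal.ofReal_mul (by positivity),
        ← Real.exp_add, EuclideanSpace.real_norm_sq_eq]
      congr 2
      ring
    simp_rw [h5]
    rw [(PiLp.volume_preserving_toLp (Fin m)).lintegral_comp_emb
      (MeasurableEquiv.toLp 2 _).measurableEmbedding (fun z : EuclideanSpace ℝ (Fin m) =>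
        ENNReal.ofReal (Real.exp (-(Real.pi * (1 + c)) * ‖z‖ ^ 2)))]
    have hb : 0 < Real.pi * (1 + c) := by positivity
    rw [← ofReal_integral_eq_lintegral_ofReal]
    · rw [GaussianFourier.integral_rexp_neg_mul_sq_norm hb, finrank_euclideanSpace_fin]
      congr 2
      rw [hc]
      field_simp
      ring
    · have := GaussianFourier.integrable_cexp_neg_mul_sq_norm_add
        (V := EuclideanSpace ℝ (Fin m)) (b := ((Real.pi * (1 + c) : ℝ) : ℂ))
        (by rw [Complex.ofReal_re]; exact hb) 0 0
      refine this.re.congr (ae_of_all _ fun z => ?_)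
      simp only [zero_mul, add_zero]
      norm_cast
    · exact ae_of_all _ fun z => (Real.exp_pos _).le
  · refine Measurable.mul ?_ (by fun_prop)
    simp only [Set.indicator_apply]
    refine Measurable.ite ?_ (by fun_prop) measurable_const
    change MeasurableSet {z : Fin (m + 2) → ℝ |
      c * ∑ i : Fin m, z i.succ.succ ^ 2 ≤ z 0 ^ 2 + z 1 ^ 2}
    exact measurableSet_le (by fun_prop) (by fun_prop)

/-! ### Orthonormal pairs, rotations and the planar tail -/

/-- The pair `x, z` is orthonormal. -/
structure OrthoPair {d : ℕ} (x z : Space d) : Prop where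
  norm_left : ‖x‖ = 1
  norm_right : ‖z‖ = 1
  inner_eq_zero : inner ℝ x z = 0

/-- The norm of the projection of `w` to the plane spanned by the orthonormal pair `x, z`. -/
def planeNorm {d : ℕ} (x z w : Space d) : ℝ := √(inner ℝ x w ^ 2 + inner ℝ z w ^ 2)

lemma planeNorm_nonneg {d : ℕ} (x z w : Space d) : 0 ≤ planeNorm x z w := Real.sqrt_nonneg _

lemma sq_planeNorm {d : ℕ} (x z w : Space d) :
    planeNorm x z w ^ 2 = inner ℝ x w ^ 2 + inner ℝ z w ^ 2 := Real.sq_sqrt (by positivity)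

lemma continuous_planeNorm {d : ℕ} (x z : Space d) : Continuous (planeNorm x z) := by
  unfold planeNorm; fun_prop

section

variable {d : ℕ} {x z : Space d} (h : OrthoPair x z)

include h

lemma OrthoPair.inner_self_left : inner ℝ x x = (1 : ℝ) := by
  rw [real_inner_self_eq_norm_sq, h.norm_left, one_pow]

lemma OrthoPair.inner_self_right : inner ℝ z z = (1 : ℝ) := by
  rw [real_inner_self_eq_norm_sq, h.norm_right, one_pow]

lemma OrthoPair.inner_eq_zero' : inner ℝ z x = (0 : ℝ) := by
  rw [real_inner_comm, h.inner_eq_zero]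

/-- The rotation by the angle `φ` in the plane of an orthonormal pair, fixing the orthogonal
complement. -/
lemma OrthoPair.exists_rotation (φ : ℝ) :
    ∃ T : Space d ≃ₗᵢ[ℝ] Space d, ∀ w, T w = w +
      ((Real.cos φ - 1) * inner ℝ x w - Real.sin φ * inner ℝ z w) • x +
      (Real.sin φ * inner ℝ x w + (Real.cos φ - 1) * inner ℝ z w) • z := by
  let L : Space d →ₗ[ℝ] Space d :=
    { toFun := fun w => w +
        ((Real.cos φ - 1) * inner ℝ x w - Real.sin φ * inner ℝ z w) • x +
        (Real.sin φ * inner ℝ x w + (Real.cos φ - 1) * inner ℝ z w) • z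
      map_add' := fun v w => by
        simp only [inner_add_right]; module
      map_smul' := fun c w => by
        simp only [inner_smul_right, RingHom.id_apply]; module }
  have hL : ∀ w, ‖L w‖ = ‖w‖ := by
    intro w
    have h1 : inner ℝ (L w) (L w) = inner ℝ w w := by
      simp only [L, LinearMap.coe_mk, AddHom.coe_mk, inner_add_left, inner_add_right,
        inner_smul_left, inner_smul_right, h.inner_self_left, h.inner_self_right,
        h.inner_eq_zero, h.inner_eq_zero', RCLike.conj_to_real]
      rw [real_inner_comm x w, real_inner_comm z w]
      have := Real.sin_sq_add_cos_sq φ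
      linear_combination ((inner ℝ x w : ℝ) ^ 2 + (inner ℝ z w : ℝ) ^ 2) * this
    rw [real_inner_self_eq_norm_sq, real_inner_self_eq_norm_sq] at h1
    exact (sq_eq_sq₀ (norm_nonneg _) (norm_nonneg _)).1 h1
  exact ⟨(LinearIsometry.mk L hL).toLinearIsometryEquiv rfl, fun w => rfl⟩

end

/-- The coordinates along an orthonormal pair look like the first two coordinates. -/
lemma OrthoPair.exists_isometry {m : ℕ} {x z : Space (m + 2)} (h : OrthoPair x z) :
    ∃ T : Space (m + 2) ≃ₗᵢ[ℝ] Space (m + 2), ∀ w, T w 0 = inner ℝ x w ∧ T w 1 = inner ℝ z w := by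
  classical
  let v : Fin (m + 2) → Space (m + 2) := fun i => if i = 0 then x else z
  have hv : Orthonormal ℝ (({0, 1} : Set (Fin (m + 2))).domRestrict v) := by
    rw [orthonormal_iff_ite]
    rintro ⟨i, hi⟩ ⟨j, hj⟩
    have h01 : (1 : Fin (m + 2)) ≠ 0 := by simp
    simp only [Subtype.mk.injEq]
    rcases hi with rfl | rfl <;> rcases hj with rfl | rfl <;>
      simp [v, Set.domRestrict, h.inner_eq_zero, h.inner_eq_zero', h01,
        h01.symm, h.norm_left, h.norm_right]
  obtain ⟨b, hb⟩ := hv.exists_orthonormalBasis_extension_of_card_eq (by simp)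
  refine ⟨b.repr, fun w => ?_⟩
  rw [b.repr_apply_apply, b.repr_apply_apply, hb 0 (by simp), hb 1 (by simp)]
  simp [v]

/-- The probability that the norm `R` of the projection of a uniform point of the sphere to a
plane satisfies `τ ≤ c R`. -/
def planarTail (m : ℕ) (τ c : ℝ) : ℝ :=
  (sphereUniform (m + 2)).real {w : Sphere (m + 2) | τ ≤ c *
    √((w : Space (m + 2)) 0 ^ 2 + (w : Space (m + 2)) 1 ^ 2)}

lemma OrthoPair.measureReal_planeNorm {m : ℕ} {x z : Space (m + 2)} (h : OrthoPair x z)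
    (τ c : ℝ) :
    (sphereUniform (m + 2)).real {w : Sphere (m + 2) | τ ≤ c * planeNorm x z w} =
      planarTail m τ c := by
  obtain ⟨T, hT⟩ := h.exists_isometry
  have hm : MeasurableSet {w : Sphere (m + 2) | τ ≤ c *
    √((w : Space (m + 2)) 0 ^ 2 + (w : Space (m + 2)) 1 ^ 2)} :=
    measurableSet_le measurable_const (by fun_prop)
  rw [planarTail, ← (measurePreserving_sphereMap T).measureReal_preimage hm.nullMeasurableSet]
  congr 1
  ext w
  simp only [Set.mem_preimage, Set.mem_ofPred_eq, sphereMap, (hT w).1, (hT w).2, planeNorm]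

lemma planarTail_nonneg (m : ℕ) (τ c : ℝ) : 0 ≤ planarTail m τ c := measureReal_nonneg

lemma planarTail_le_one (m : ℕ) (τ c : ℝ) : planarTail m τ c ≤ 1 := measureReal_le_one

lemma planarTail_mono (m : ℕ) (τ : ℝ) : Monotone (planarTail m τ) := by
  intro c c' hc
  refine measureReal_mono fun w (hw : τ ≤ _) => hw.trans ?_
  gcongr

/-- The law of the projection of a uniform point to a plane is rotation invariant, so the angular
coordinate can be averaged out. -/
lemma OrthoPair.integral_eq_average {m : ℕ} {x z : Space (m + 2)} (h : OrthoPair x z)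
    {H : ℝ × ℝ → ℝ} (hH : BddMeas H) :
    ∫ w : Sphere (m + 2), H (inner ℝ x (w : Space (m + 2)), inner ℝ z (w : Space (m + 2)))
      ∂(sphereUniform (m + 2)) =
    (2 * Real.pi)⁻¹ * ∫ φ in (0 : ℝ)..(2 * Real.pi), ∫ w : Sphere (m + 2),
      H (planeNorm x z w * Real.cos φ, planeNorm x z w * Real.sin φ)
        ∂(sphereUniform (m + 2)) := by
  obtain ⟨hHm, K, hK⟩ := hH
  set J := ∫ w : Sphere (m + 2), H (inner ℝ x (w : Space (m + 2)), inner ℝ z (w : Space (m + 2)))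
      ∂(sphereUniform (m + 2)) with hJ
  have h1 : ∀ φ : ℝ, ∫ w : Sphere (m + 2),
      H (Real.cos φ * inner ℝ x (w : Space (m + 2)) - Real.sin φ * inner ℝ z (w : Space (m + 2)),
        Real.sin φ * inner ℝ x (w : Space (m + 2)) + Real.cos φ * inner ℝ z (w : Space (m + 2)))
      ∂(sphereUniform (m + 2)) = J := by
    intro φ
    obtain ⟨T, hT⟩ := h.exists_rotation φ
    have hm2 : Measurable fun w : Sphere (m + 2) =>
        H (inner ℝ x (w : Space (m + 2)), inner ℝ z (w : Space (m + 2))) :=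
      hHm.comp (by fun_prop)
    rw [hJ]
    nth_rewrite 2 [← (measurePreserving_sphereMap T).map_eq]
    rw [integral_map (measurable_sphereMap T).aemeasurable hm2.aestronglyMeasurable]
    refine integral_congr_ae (ae_of_all _ fun w => ?_)
    simp only [sphereMap, hT, inner_add_right, inner_smul_right, h.inner_self_left,
      h.inner_self_right, h.inner_eq_zero, h.inner_eq_zero']
    congr 2 <;> ring
  have h2 : ∫ φ in (0 : ℝ)..(2 * Real.pi), J = 2 * Real.pi * J := by
    rw [intervalIntegral.integral_const, sub_zero, smul_eq_mul]
  have hswap : ∀ G : ℝ → Sphere (m + 2) → ℝ × ℝ, Measurable (Function.uncurry G) →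
      ∫ φ in (0 : ℝ)..(2 * Real.pi), ∫ w, H (G φ w) ∂(sphereUniform (m + 2)) =
      ∫ w, (∫ φ in (0 : ℝ)..(2 * Real.pi), H (G φ w)) ∂(sphereUniform (m + 2)) := by
    intro G hG
    simp_rw [intervalIntegral.integral_of_le (a := (0 : ℝ)) (b := 2 * Real.pi) (by positivity)]
    refine integral_integral_swap ?_
    exact Integrable.of_bound (hHm.comp hG).aestronglyMeasurable K (ae_of_all _ fun _ => hK _)
  have h3 : 2 * Real.pi * J = ∫ φ in (0 : ℝ)..(2 * Real.pi), ∫ w : Sphere (m + 2),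
      H (planeNorm x z w * Real.cos φ, planeNorm x z w * Real.sin φ)
        ∂(sphereUniform (m + 2)) := by
    have h5 : ∫ φ in (0 : ℝ)..(2 * Real.pi), J = ∫ φ in (0 : ℝ)..(2 * Real.pi),
        ∫ w : Sphere (m + 2), H
          (Real.cos φ * inner ℝ x (w : Space (m + 2)) - Real.sin φ * inner ℝ z (w : Space (m + 2)),
          Real.sin φ * inner ℝ x (w : Space (m + 2)) + Real.cos φ * inner ℝ z (w : Space (m + 2)))
          ∂(sphereUniform (m + 2)) :=
      intervalIntegral.integral_congr fun φ _ => (h1 φ).symm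
    rw [← h2, h5]
    have hpn := (continuous_planeNorm x z).measurable
    rw [hswap (fun φ w =>
        (Real.cos φ * inner ℝ x (w : Space (m + 2)) - Real.sin φ * inner ℝ z (w : Space (m + 2)),
        Real.sin φ * inner ℝ x (w : Space (m + 2)) + Real.cos φ * inner ℝ z (w : Space (m + 2)))),
      hswap (fun φ w => (planeNorm x z w * Real.cos φ, planeNorm x z w * Real.sin φ))]
    · refine integral_congr_ae (ae_of_all _ fun w => ?_)
      simp only
      set c : ℂ := ⟨inner ℝ x (w : Space (m + 2)), inner ℝ z (w : Space (m + 2))⟩ with hc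
      have hnorm : ‖c‖ = planeNorm x z w := by
        rw [Complex.norm_def, Complex.normSq_apply, planeNorm, sq, sq]
      have hre : inner ℝ x (w : Space (m + 2)) = planeNorm x z w * Real.cos c.arg := by
        rw [← hnorm, Complex.norm_mul_cos_arg]
      have him : inner ℝ z (w : Space (m + 2)) = planeNorm x z w * Real.sin c.arg := by
        rw [← hnorm, Complex.norm_mul_sin_arg]
      have hper : Function.Periodic (fun φ => H (planeNorm x z w * Real.cos φ,
          planeNorm x z w * Real.sin φ)) (2 * Real.pi) := by
        intro φ
        simp only [Real.cos_add_two_pi, Real.sin_add_two_pi]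
      have h4 := hper.intervalIntegral_add_eq 0 c.arg
      rw [zero_add] at h4
      have h6 := intervalIntegral.integral_comp_add_right (a := 0) (b := 2 * Real.pi)
        (fun φ => H (planeNorm x z w * Real.cos φ, planeNorm x z w * Real.sin φ)) c.arg
      rw [zero_add, add_comm (2 * Real.pi)] at h6
      rw [h4, ← h6]
      refine intervalIntegral.integral_congr fun φ _ => ?_
      simp only [Real.cos_add, Real.sin_add]
      rw [hre, him]
      congr 2 <;> ring
    · simp only [Function.uncurry_def]; fun_prop
    · simp only [Function.uncurry_def]; fun_prop
  rw [← h3, inv_mul_cancel_left₀ (by positivity)]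

/-- Any two unit vectors lie in the plane of an orthonormal pair that starts with the first. -/
lemma exists_orthoPair {m : ℕ} (x y : Sphere (m + 2)) :
    ∃ z : Space (m + 2), OrthoPair (x : Space (m + 2)) z ∧
      (y : Space (m + 2)) =
        Real.cos (Real.arccos (inner ℝ (x : Space (m + 2)) y)) • (x : Space (m + 2)) +
        Real.sin (Real.arccos (inner ℝ (x : Space (m + 2)) y)) • z := by
  have hx : ‖(x : Space (m + 2))‖ = 1 := by simp
  have hy : ‖(y : Space (m + 2))‖ = 1 := by simp
  have habs := abs_real_inner_le_norm (x : Space (m + 2)) y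
  rw [hx, hy, one_mul, abs_le] at habs
  set s : ℝ := inner ℝ (x : Space (m + 2)) y with hs
  have hxx : inner ℝ (x : Space (m + 2)) x = (1 : ℝ) := by
    rw [real_inner_self_eq_norm_sq, hx, one_pow]
  have hyy : inner ℝ (y : Space (m + 2)) y = (1 : ℝ) := by
    rw [real_inner_self_eq_norm_sq, hy, one_pow]
  have hyx : inner ℝ (y : Space (m + 2)) x = s := by rw [real_inner_comm]
  rw [Real.cos_arccos habs.1 habs.2, Real.sin_arccos]
  have hdiff : ‖(y : Space (m + 2)) - s • (x : Space (m + 2))‖ ^ 2 = 1 - s ^ 2 := by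
    rw [← real_inner_self_eq_norm_sq]
    simp only [inner_sub_left, inner_sub_right, inner_smul_left, inner_smul_right, hxx, hyy, hyx,
      ← hs, RCLike.conj_to_real]
    ring
  by_cases h1 : 1 - s ^ 2 = 0
  · have h2 : (y : Space (m + 2)) = s • (x : Space (m + 2)) := by
      rw [h1] at hdiff
      exact sub_eq_zero.1 (norm_eq_zero.1 (pow_eq_zero_iff two_ne_zero |>.1 hdiff))
    obtain ⟨z, hz, hxz⟩ : ∃ z : Space (m + 2),
        ‖z‖ = 1 ∧ inner ℝ (x : Space (m + 2)) z = (0 : ℝ) := by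
      have hne : ((ℝ ∙ (x : Space (m + 2)))ᗮ : Submodule ℝ (Space (m + 2))) ≠ ⊥ := by
        intro hbot
        have h3 := Submodule.finrank_add_finrank_orthogonal (ℝ ∙ (x : Space (m + 2)))
        rw [hbot, finrank_bot, finrank_euclideanSpace_fin] at h3
        have h4 := finrank_span_singleton (K := ℝ) (v := (x : Space (m + 2)))
          (norm_ne_zero_iff.1 (by rw [hx]; exact one_ne_zero))
        omega
      obtain ⟨v, hv, hv0⟩ := Submodule.exists_mem_ne_zero_of_ne_bot hne
      refine ⟨‖v‖⁻¹ • v, by rw [norm_smul, norm_inv, norm_norm,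
        inv_mul_cancel₀ (norm_ne_zero_iff.2 hv0)], ?_⟩
      rw [inner_smul_right, Submodule.mem_orthogonal_singleton_iff_inner_right.1 hv, mul_zero]
    refine ⟨z, ⟨hx, hz, hxz⟩, ?_⟩
    rw [h1, Real.sqrt_zero, zero_smul, add_zero, ← h2]
  · have hpos : 0 < 1 - s ^ 2 := lt_of_le_of_ne (by nlinarith) (Ne.symm h1)
    have hsq : 0 < √(1 - s ^ 2) := Real.sqrt_pos.2 hpos
    refine ⟨(√(1 - s ^ 2))⁻¹ • ((y : Space (m + 2)) - s • (x : Space (m + 2))), ⟨hx, ?_, ?_⟩, ?_⟩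
    · rw [norm_smul, norm_inv, Real.norm_of_nonneg hsq.le, ← Real.sqrt_sq (norm_nonneg (_ - _)),
        hdiff, inv_mul_cancel₀ hsq.ne']
    · rw [inner_smul_right, inner_sub_right, inner_smul_right, hxx, ← hs]
      ring
    · rw [smul_smul, mul_inv_cancel₀ hsq.ne', one_smul]
      abel

/-! ### Measures of caps and of their intersections -/

lemma planarTail_eq_of_lt {m : ℕ} {τ c : ℝ} (hτ : 0 ≤ τ) (hc : τ < c) :
    planarTail m τ c = (1 - (τ / c) ^ 2) ^ ((m : ℝ) / 2) := by
  have hc0 : 0 < c := hτ.trans_lt hc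
  have hr0 : 0 ≤ τ / c := by positivity
  have hr1 : τ / c < 1 := (div_lt_one hc0).2 hc
  have hset : {w : Sphere (m + 2) | τ ≤ c *
      √((w : Space (m + 2)) 0 ^ 2 + (w : Space (m + 2)) 1 ^ 2)} =
      {w : Sphere (m + 2) | (τ / c) ^ 2 ≤ (w : Space (m + 2)) 0 ^ 2 +
        (w : Space (m + 2)) 1 ^ 2} := by
    ext w
    simp only [Set.mem_ofPred_eq]
    rw [← div_le_iff₀' hc0, Real.le_sqrt hr0 (by positivity)]
  rw [planarTail, hset, measureReal_def, sphereUniform_coord_tail m hr0 hr1,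
    ENNReal.toReal_ofReal]
  have : 0 ≤ 1 - (τ / c) ^ 2 := by nlinarith
  positivity

lemma tendsto_one_sub_sq_rpow (m : ℕ) :
    Tendsto (fun r : ℝ => (1 - r ^ 2) ^ ((m : ℝ) / 2)) (nhdsWithin 0 (Set.Ioo 0 1)) (nhds 1) := by
  have : ContinuousAt (fun r : ℝ => (1 - r ^ 2) ^ ((m : ℝ) / 2)) 0 := by
    refine ContinuousAt.rpow_const (by fun_prop) (Or.inr (by positivity))
  have h := this.tendsto
  simp only [ne_eq, OfNat.ofNat_ne_zero, not_false_eq_true, zero_pow, sub_zero,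
    Real.one_rpow] at h
  exact h.mono_left nhdsWithin_le_nhds

/-- The projection to a plane almost surely does not vanish. -/
lemma planarTail_of_neg {m : ℕ} {τ c : ℝ} (hτ : 0 ≤ τ) (hc : c < 0) : planarTail m τ c = 0 := by
  have hbound : ∀ r ∈ Set.Ioo (0 : ℝ) 1,
      planarTail m τ c ≤ 1 - (1 - r ^ 2) ^ ((m : ℝ) / 2) := by
    intro r hr
    have hm : MeasurableSet {w : Sphere (m + 2) | r ≤ 1 *
        √((w : Space (m + 2)) 0 ^ 2 + (w : Space (m + 2)) 1 ^ 2)} :=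
      measurableSet_le measurable_const (by fun_prop)
    have h1 := probReal_compl_eq_one_sub (μ := sphereUniform (m + 2)) hm
    have h2 := planarTail_eq_of_lt (m := m) hr.1.le hr.2
    rw [planarTail] at h2
    rw [h2, div_one] at h1
    rw [← h1]
    refine measureReal_mono fun w (hw : τ ≤ _) => ?_
    simp only [Set.mem_compl_iff, Set.mem_ofPred_eq, one_mul, not_le]
    have h3 := Real.sqrt_nonneg ((w : Space (m + 2)) 0 ^ 2 + (w : Space (m + 2)) 1 ^ 2)
    have h4 : √((w : Space (m + 2)) 0 ^ 2 + (w : Space (m + 2)) 1 ^ 2) ≤ 0 := by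
      nlinarith
    exact h4.trans_lt hr.1
  refine le_antisymm ?_ (planarTail_nonneg _ _ _)
  have hlim := (tendsto_one_sub_sq_rpow m).const_sub 1
  rw [sub_self] at hlim
  have : (nhdsWithin (0 : ℝ) (Set.Ioo 0 1)).NeBot := by
    rw [nhdsWithin_Ioo_eq_nhdsGT one_pos]; infer_instance
  exact ge_of_tendsto hlim (eventually_nhdsWithin_of_forall hbound)

lemma planarTail_eq_zero_of_le {m : ℕ} (hm : m ≠ 0) {τ c : ℝ} (hτ : 0 < τ) (hc : c ≤ τ) :
    planarTail m τ c = 0 := by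
  refine le_antisymm ?_ (planarTail_nonneg _ _ _)
  have hmono : planarTail m τ c ≤ planarTail m τ τ := planarTail_mono m τ hc
  refine hmono.trans ?_
  have hlim : Tendsto (fun b : ℝ => (1 - (τ / b) ^ 2) ^ ((m : ℝ) / 2))
      (nhdsWithin τ (Set.Ioi τ)) (nhds 0) := by
    have : ContinuousAt (fun b : ℝ => (1 - (τ / b) ^ 2) ^ ((m : ℝ) / 2)) τ := by
      refine ContinuousAt.rpow_const ?_ (Or.inr (by positivity))
      exact continuousAt_const.sub ((continuousAt_const.div continuousAt_id hτ.ne').pow 2)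
    have h := this.tendsto
    rw [div_self hτ.ne', one_pow, sub_self, Real.zero_rpow (by positivity)] at h
    exact h.mono_left nhdsWithin_le_nhds
  refine ge_of_tendsto hlim (eventually_nhdsWithin_of_forall fun b hb => ?_)
  rw [← planarTail_eq_of_lt hτ.le hb]
  exact planarTail_mono m τ (le_of_lt hb)

lemma measurable_planarTail (m : ℕ) (τ : ℝ) : Measurable (planarTail m τ) :=
  (planarTail_mono m τ).measurable

lemma intervalIntegrable_planarTail (m : ℕ) (τ : ℝ) {f : ℝ → ℝ} (hf : Measurable f) (a b : ℝ) :
    IntervalIntegrable (fun t => planarTail m τ (f t)) volume a b := by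
  refine (intervalIntegrable_const (c := (1 : ℝ))).mono_fun'
    ((measurable_planarTail m τ).comp hf).aestronglyMeasurable (ae_of_all _ fun t => ?_)
  simp only [Real.norm_of_nonneg (planarTail_nonneg _ _ _)]
  exact planarTail_le_one _ _ _

lemma measurableSet_cap {d : ℕ} (τ : ℝ) (x : Space d) :
    MeasurableSet {w : Sphere d | τ ≤ inner ℝ x (w : Space d)} :=
  measurableSet_le measurable_const (by fun_prop)

/-- The measure of the intersection of the caps of height `τ` centered at `x` and `y`. -/
def capInter {d : ℕ} (τ : ℝ) (x y : Sphere d) : ℝ :=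
  (sphereUniform d).real {w : Sphere d | τ ≤ inner ℝ (x : Space d) w ∧ τ ≤ inner ℝ (y : Space d) w}

/-- The angular arcs `|φ| ≤ arccos (τ / R)` and `|φ - θ| ≤ arccos (τ / R)` cut out by two caps at
angular distance `θ` meet in an arc whose average length is an integral of the planar tail. -/
lemma integral_planarTail_min_cos (m : ℕ) {τ θ : ℝ} (hτ : 0 ≤ τ) (hθ0 : 0 ≤ θ)
    (hθ1 : θ ≤ Real.pi) :
    ∫ φ in (0 : ℝ)..(2 * Real.pi), planarTail m τ (min (Real.cos φ) (Real.cos (φ - θ))) =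
      2 * ∫ t in (θ / 2)..(Real.pi / 2), planarTail m τ (Real.cos t) := by
  have hpi := Real.pi_pos
  set F : ℝ → ℝ := fun φ => planarTail m τ (min (Real.cos φ) (Real.cos (φ - θ))) with hF
  have hper : Function.Periodic F (2 * Real.pi) := by
    intro φ
    simp only [hF, Real.cos_add_two_pi, add_sub_right_comm]
  have h1 := hper.intervalIntegral_add_eq 0 (-Real.pi + θ / 2)
  set G : ℝ → ℝ := fun ψ => planarTail m τ (min (Real.cos (ψ + θ / 2)) (Real.cos (ψ - θ / 2)))
    with hG
  have h2 : ∫ φ in (-Real.pi + θ / 2)..(-Real.pi + θ / 2 + 2 * Real.pi), F φ =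
      ∫ ψ in (-Real.pi)..Real.pi, G ψ := by
    have := intervalIntegral.integral_comp_add_right (a := -Real.pi) (b := Real.pi) F (θ / 2)
    rw [show -Real.pi + θ / 2 + 2 * Real.pi = Real.pi + θ / 2 by ring, ← this]
    refine intervalIntegral.integral_congr fun ψ _ => ?_
    simp only [hF, hG]
    congr 3
    ring
  have hGint : ∀ a b, IntervalIntegrable G volume a b := fun a b =>
    intervalIntegrable_planarTail m τ
      (f := fun ψ => min (Real.cos (ψ + θ / 2)) (Real.cos (ψ - θ / 2))) (by fun_prop) a b
  have hGeven : ∀ ψ, G (-ψ) = G ψ := by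
    intro ψ
    simp only [hG]
    rw [min_comm]
    congr 2
    · rw [← Real.cos_neg]; congr 1; ring
    · rw [← Real.cos_neg]; congr 1; ring
  have h3 : ∫ ψ in (-Real.pi)..Real.pi, G ψ = 2 * ∫ ψ in (0 : ℝ)..Real.pi, G ψ := by
    rw [← intervalIntegral.integral_add_adjacent_intervals (hGint _ 0) (hGint 0 _)]
    have := intervalIntegral.integral_comp_neg (a := 0) (b := Real.pi) G
    rw [neg_zero] at this
    rw [← this, intervalIntegral.integral_congr (g := G) fun ψ _ => hGeven ψ]
    ring
  have h4 : ∫ ψ in (0 : ℝ)..Real.pi, G ψ =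
      ∫ t in (θ / 2)..(Real.pi + θ / 2), planarTail m τ (Real.cos t) := by
    have := intervalIntegral.integral_comp_add_right (a := 0) (b := Real.pi)
      (fun t => planarTail m τ (Real.cos t)) (θ / 2)
    rw [zero_add] at this
    rw [← this]
    refine intervalIntegral.integral_congr fun ψ hψ => ?_
    rw [Set.uIcc_of_le hpi.le] at hψ
    simp only [hG]
    rw [min_eq_left]
    rw [Real.cos_add, Real.cos_sub]
    have h5 := Real.sin_nonneg_of_mem_Icc hψ
    have h6 : 0 ≤ Real.sin (θ / 2) := Real.sin_nonneg_of_nonneg_of_le_pi (by linarith) (by linarith)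
    nlinarith
  have h5 : ∫ t in (Real.pi / 2)..(Real.pi + θ / 2), planarTail m τ (Real.cos t) = 0 := by
    rw [intervalIntegral.integral_of_le (by linarith), integral_Ioc_eq_integral_Ioo]
    refine setIntegral_eq_zero_of_forall_eq_zero fun t ht => ?_
    exact planarTail_of_neg hτ (Real.cos_neg_of_pi_div_two_lt_of_lt ht.1 (by linarith [ht.2]))
  rw [zero_add] at h1
  have hWint : ∀ a b, IntervalIntegrable (fun t => planarTail m τ (Real.cos t)) volume a b :=
    fun a b => intervalIntegrable_planarTail m τ (by fun_prop) a b
  rw [h1, h2, h3, h4, ← intervalIntegral.integral_add_adjacent_intervals (hWint _ (Real.pi / 2))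
    (hWint _ _), h5, add_zero]

/-- The measure of the intersection of two caps depends on the angle `θ` of their centers through
the lower limit `θ / 2` only: a point of the plane of the centers at distance `R` from the origin lies
in both caps iff its direction lies in two arcs, and these meet around the bisector. -/
lemma capInter_eq {m : ℕ} {τ : ℝ} (hτ : 0 ≤ τ) (x y : Sphere (m + 2)) :
    capInter τ x y = Real.pi⁻¹ *
      ∫ t in (Real.arccos (inner ℝ (x : Space (m + 2)) y) / 2)..(Real.pi / 2),
        planarTail m τ (Real.cos t) := by
  obtain ⟨z, hz, hy⟩ := exists_orthoPair x y
  set θ := Real.arccos (inner ℝ (x : Space (m + 2)) y) with hθ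
  set s : Set (ℝ × ℝ) := {q | τ ≤ q.1 ∧ τ ≤ Real.cos θ * q.1 + Real.sin θ * q.2} with hs
  have hsm : MeasurableSet s := by
    refine (measurableSet_le measurable_const measurable_fst).inter ?_
    exact measurableSet_le measurable_const
      ((measurable_fst.const_mul _).add (measurable_snd.const_mul _))
  have hH : BddMeas (s.indicator (1 : ℝ × ℝ → ℝ)) := by
    refine ⟨measurable_one.indicator hsm, 1, fun q => ?_⟩
    by_cases hq : q ∈ s <;> simp [hq]
  have h1 := hz.integral_eq_average hH
  have h2 : capInter τ x y = ∫ w : Sphere (m + 2), s.indicator (1 : ℝ × ℝ → ℝ)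
      (inner ℝ (x : Space (m + 2)) (w : Space (m + 2)), inner ℝ z (w : Space (m + 2)))
      ∂(sphereUniform (m + 2)) := by
    have hm : MeasurableSet {w : Sphere (m + 2) | τ ≤ inner ℝ (x : Space (m + 2)) w ∧
        τ ≤ inner ℝ (y : Space (m + 2)) w} := (measurableSet_cap τ _).inter (measurableSet_cap τ _)
    rw [capInter, ← integral_indicator_one hm]
    refine integral_congr_ae (ae_of_all _ fun w => ?_)
    simp only [Set.indicator_apply, hs, Set.mem_ofPred_eq, hy, inner_add_left,
      real_inner_smul_left, Pi.one_apply]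
  have h3 : ∀ φ : ℝ, ∫ w : Sphere (m + 2), s.indicator (1 : ℝ × ℝ → ℝ)
      (planeNorm x z w * Real.cos φ, planeNorm x z w * Real.sin φ) ∂(sphereUniform (m + 2)) =
      planarTail m τ (min (Real.cos φ) (Real.cos (φ - θ))) := by
    intro φ
    rw [← hz.measureReal_planeNorm]
    have hm : MeasurableSet {w : Sphere (m + 2) | τ ≤ min (Real.cos φ) (Real.cos (φ - θ)) *
        planeNorm x z w} :=
      measurableSet_le measurable_const
        (((continuous_planeNorm (x : Space (m + 2)) z).comp
          continuous_subtype_val).measurable.const_mul _)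
    rw [← integral_indicator_one hm]
    refine integral_congr_ae (ae_of_all _ fun w => ?_)
    have hR := planeNorm_nonneg (x : Space (m + 2)) z w
    have hiff : τ ≤ planeNorm x z w * Real.cos φ ∧ τ ≤ Real.cos θ * (planeNorm x z w * Real.cos φ)
        + Real.sin θ * (planeNorm x z w * Real.sin φ) ↔
        τ ≤ min (Real.cos φ) (Real.cos (φ - θ)) * planeNorm x z w := by
      rw [min_mul_of_nonneg _ _ hR, le_min_iff, Real.cos_sub]
      refine and_congr (by rw [mul_comm]) ?_
      refine Iff.of_eq (congrArg _ ?_)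
      ring
    simp only [Set.indicator_apply, hs, Set.mem_ofPred_eq, hiff, Pi.one_apply]
  rw [h2, h1, intervalIntegral.integral_congr fun φ _ => h3 φ,
    integral_planarTail_min_cos m hτ (Real.arccos_nonneg _) (Real.arccos_le_pi _), mul_inv]
  ring

/-- The measure of a cap. -/
lemma measureReal_cap {m : ℕ} {τ : ℝ} (hτ : 0 ≤ τ) (x : Sphere (m + 2)) :
    (sphereUniform (m + 2)).real {w : Sphere (m + 2) | τ ≤ inner ℝ (x : Space (m + 2)) w} =
      Real.pi⁻¹ * ∫ t in (0 : ℝ)..(Real.pi / 2), planarTail m τ (Real.cos t) := by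
  have h := capInter_eq hτ x x
  have hx : inner ℝ (x : Space (m + 2)) x = (1 : ℝ) := by
    rw [real_inner_self_eq_norm_sq]; simp
  rw [hx, Real.arccos_one, zero_div] at h
  rw [← h, capInter]
  simp only [and_self]

/-! ### The threshold as a quantile -/

/-- The measure of a cap of height `τ ≥ 0` on the sphere of `ℝ^{m+2}`. -/
def capMeasure (m : ℕ) (τ : ℝ) : ℝ :=
  Real.pi⁻¹ * ∫ t in (0 : ℝ)..(Real.pi / 2), planarTail m τ (Real.cos t)

lemma innerTail_eq_integral {d : ℕ} [NeZero d] (t : ℝ) :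
    innerTail d t = ∫ x : Sphere d,
      (sphereUniform d).real {w : Sphere d | t ≤ inner ℝ (x : Space d) (w : Space d)}
      ∂(sphereUniform d) := by
  have hm : MeasurableSet {x : Sphere d × Sphere d | t ≤ inner ℝ (x.1 : Space d) (x.2 : Space d)} :=
    measurableSet_le measurable_const (by fun_prop)
  rw [innerTail, ← integral_indicator_one hm, integral_prod]
  · refine integral_congr_ae (ae_of_all _ fun x => ?_)
    simp only
    rw [← integral_indicator_one (measurableSet_cap t (x : Space d))]
    rfl
  · exact (integrable_const (1 : ℝ)).indicator hm

lemma innerTail_eq_capMeasure {m : ℕ} {t : ℝ} (ht : 0 ≤ t) :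
    innerTail (m + 2) t = capMeasure m t := by
  rw [innerTail_eq_integral]
  simp_rw [measureReal_cap ht]
  simp [capMeasure]

lemma innerTail_eq_zero {m : ℕ} {t : ℝ} (ht : 1 < t) : innerTail (m + 2) t = 0 := by
  have : {x : Sphere (m + 2) × Sphere (m + 2) | t ≤ inner ℝ (x.1 : Space (m + 2))
      (x.2 : Space (m + 2))} = ∅ := by
    refine Set.eq_empty_of_forall_notMem fun x hx => ?_
    have h1 := real_inner_le_norm (x.1 : Space (m + 2)) (x.2 : Space (m + 2))
    have h2 : ‖(x.1 : Space (m + 2))‖ = 1 := by simp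
    have h3 : ‖(x.2 : Space (m + 2))‖ = 1 := by simp
    rw [h2, h3, one_mul] at h1
    exact absurd (ht.trans_le hx) (not_lt.2 h1)
  rw [innerTail]
  change Measure.real _ {x : Sphere (m + 2) × Sphere (m + 2) | t ≤ inner ℝ (x.1 : Space (m + 2))
      (x.2 : Space (m + 2))} = 0
  rw [this, measureReal_empty]

lemma innerTail_antitone (m : ℕ) : Antitone (innerTail (m + 2)) := fun _ _ h =>
  measureReal_mono fun _ hx => h.trans hx

lemma planarTail_eq_max {m : ℕ} (hm : m ≠ 0) {τ c : ℝ} (hτ : 0 ≤ τ) (hc : 0 < c) :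
    planarTail m τ c = (max 0 (1 - (τ / c) ^ 2)) ^ ((m : ℝ) / 2) := by
  have h0 : 0 ≤ τ / c := by positivity
  rcases lt_or_ge τ c with h | h
  · have h1 : τ / c < 1 := (div_lt_one hc).2 h
    rw [planarTail_eq_of_lt hτ h, max_eq_right (by nlinarith)]
  · have h1 : 1 ≤ τ / c := (one_le_div hc).2 h
    rw [planarTail_eq_zero_of_le hm (hc.trans_le h) h, max_eq_left (by nlinarith),
      Real.zero_rpow (by positivity)]

lemma capMeasure_eq {m : ℕ} (hm : m ≠ 0) {τ : ℝ} (hτ : 0 ≤ τ) :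
    capMeasure m τ = Real.pi⁻¹ * ∫ t in (0 : ℝ)..(Real.pi / 2),
      (max 0 (1 - (τ / Real.cos t) ^ 2)) ^ ((m : ℝ) / 2) := by
  have hpi := Real.pi_pos
  rw [capMeasure, intervalIntegral.integral_of_le (by positivity),
    intervalIntegral.integral_of_le (by positivity), integral_Ioc_eq_integral_Ioo,
    integral_Ioc_eq_integral_Ioo]
  congr 1
  refine setIntegral_congr_fun measurableSet_Ioo fun t ht => ?_
  exact planarTail_eq_max hm hτ (Real.cos_pos_of_mem_Ioo ⟨by linarith [ht.1], ht.2⟩)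

lemma continuousOn_capMeasure {m : ℕ} (hm : m ≠ 0) : ContinuousOn (capMeasure m) (Set.Ici 0) := by
  have h : Continuous fun τ : ℝ => Real.pi⁻¹ * ∫ t in (0 : ℝ)..(Real.pi / 2),
      (max 0 (1 - (τ / Real.cos t) ^ 2)) ^ ((m : ℝ) / 2) := by
    refine continuous_const.mul ?_
    refine intervalIntegral.continuous_of_dominated_interval (bound := fun _ => 1) ?_ ?_ ?_ ?_
    · intro τ
      exact Measurable.aestronglyMeasurable (by fun_prop)
    · intro τ
      refine ae_of_all _ fun t _ => ?_
      rw [Real.norm_of_nonneg (by positivity)]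
      refine Real.rpow_le_one (le_max_left _ _) (max_le zero_le_one ?_) (by positivity)
      nlinarith [sq_nonneg (τ / Real.cos t)]
    · exact intervalIntegrable_const
    · refine ae_of_all _ fun t _ => ?_
      refine Continuous.rpow_const (by fun_prop) fun _ => Or.inr (by positivity)
  exact h.continuousOn.congr fun τ hτ => capMeasure_eq hm hτ

lemma capMeasure_zero {m : ℕ} (hm : m ≠ 0) : capMeasure m 0 = 1 / 2 := by
  rw [capMeasure_eq hm le_rfl]
  simp only [zero_div, ne_eq, OfNat.ofNat_ne_zero, not_false_eq_true, zero_pow, sub_zero,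
    zero_le_one, sup_of_le_right, Real.one_rpow]
  rw [intervalIntegral.integral_const]
  have := Real.pi_pos
  simp only [sub_zero, smul_eq_mul, mul_one]
  field_simp

lemma capMeasure_one {m : ℕ} (hm : m ≠ 0) : capMeasure m 1 = 0 := by
  have : ∀ t : ℝ, planarTail m 1 (Real.cos t) = 0 := fun t =>
    planarTail_eq_zero_of_le hm one_pos (Real.cos_le_one t)
  simp [capMeasure, this]

/-- For `0 < p ≤ 1/2` the threshold is nonnegative and is an exact quantile. -/
lemma threshold_spec {m : ℕ} (hm : m ≠ 0) {p : ℝ} (hp0 : 0 < p) (hp : p ≤ 1 / 2) :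
    0 ≤ threshold p (m + 2) ∧ capMeasure m (threshold p (m + 2)) = p := by
  have hcont := continuousOn_capMeasure hm
  obtain ⟨t₀, ht₀, hpt₀⟩ : p ∈ capMeasure m '' Set.Icc 0 1 := by
    refine intermediate_value_Icc' zero_le_one (hcont.mono fun t ht => ht.1) ?_
    rw [capMeasure_zero hm, capMeasure_one hm]
    exact ⟨hp0.le, hp⟩
  have hmem : t₀ ∈ {t : ℝ | p ≤ innerTail (m + 2) t} := by
    rw [Set.mem_ofPred_eq, innerTail_eq_capMeasure ht₀.1, hpt₀]
  have hbdd : BddAbove {t : ℝ | p ≤ innerTail (m + 2) t} := by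
    refine ⟨1, fun t ht => ?_⟩
    by_contra! h
    rw [Set.mem_ofPred_eq, innerTail_eq_zero h] at ht
    linarith
  have ht₀τ : t₀ ≤ threshold p (m + 2) := le_csSup hbdd hmem
  have hτ0 := ht₀.1.trans ht₀τ
  refine ⟨hτ0, le_antisymm ?_ ?_⟩
  · have h := innerTail_antitone m ht₀τ
    rwa [innerTail_eq_capMeasure hτ0, innerTail_eq_capMeasure ht₀.1, hpt₀] at h
  · rcases ht₀τ.eq_or_lt with h | h
    · rw [← h, hpt₀]
    · -- the bound `p ≤ capMeasure` holds at points arbitrarily close to the supremum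
      have hlim : Tendsto (capMeasure m)
          (nhdsWithin (threshold p (m + 2)) (Set.Ioo t₀ (threshold p (m + 2))))
          (nhds (capMeasure m (threshold p (m + 2)))) :=
        (hcont _ hτ0).mono_left (nhdsWithin_mono _ fun t ht => ht₀.1.trans ht.1.le)
      have : (nhdsWithin (threshold p (m + 2)) (Set.Ioo t₀ (threshold p (m + 2)))).NeBot := by
        rw [nhdsWithin_Ioo_eq_nhdsLT h]; infer_instance
      refine ge_of_tendsto hlim (eventually_nhdsWithin_of_forall fun t ht => ?_)
      obtain ⟨s, hs, hts⟩ := exists_lt_of_lt_csSup ⟨t₀, hmem⟩ ht.2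
      rw [← innerTail_eq_capMeasure (ht₀.1.trans ht.1.le)]
      exact le_trans hs (innerTail_antitone m hts.le)

/-! ### Quantitative estimates for caps -/

/-- The standing assumptions of the quantitative estimates: caps of height `τ` on the sphere of
`ℝ^{m+2}` have measure `p ≤ 1/2`, and `m` is large compared with `log (1/p)`. -/
structure Regime (m : ℕ) (p τ : ℝ) : Prop where
  large : 1000 ≤ m
  p_pos : 0 < p
  p_le : p ≤ 1 / 2
  log_le : 300 * Real.log (1 / p) ^ 4 ≤ m
  tau_nonneg : 0 ≤ τ
  cap : capMeasure m τ = p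

section

variable {m : ℕ} {p τ : ℝ} (h : Regime m p τ)

include h

lemma Regime.m_ne : m ≠ 0 := by have := h.large; omega

lemma Regime.large' : (1000 : ℝ) ≤ m := by exact_mod_cast h.large

lemma Regime.log_ge : 0.69 ≤ Real.log (1 / p) := by
  have h1 : Real.log 2 ≤ Real.log (1 / p) := by
    refine Real.log_le_log (by norm_num) ?_
    rw [le_div_iff₀ h.p_pos]
    linarith [h.p_le]
  have := Real.log_two_gt_d9
  linarith

lemma Regime.exp_neg_log : Real.exp (-Real.log (1 / p)) = p := by
  rw [one_div, Real.log_inv, neg_neg, Real.exp_log h.p_pos]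

lemma Regime.pow_log_le {i : ℕ} (hi : i ≤ 4) : 300 * Real.log (1 / p) ^ i ≤ m := by
  have h0 := h.log_ge
  rcases le_total (Real.log (1 / p)) 1 with h1 | h1
  · have := pow_le_one₀ (n := i) (by linarith) h1
    linarith [h.large']
  · have := pow_le_pow_right₀ h1 hi
    linarith [h.log_le]

lemma Regime.log_le_one : 300 * Real.log (1 / p) ≤ m := by
  simpa using h.pow_log_le (i := 1) (by norm_num)

lemma Regime.planarTail_one_ge : 2 * p ≤ planarTail m τ 1 := by
  have hpi := Real.pi_pos
  have h1 : ∫ t in (0 : ℝ)..(Real.pi / 2), planarTail m τ (Real.cos t) ≤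
      ∫ t in (0 : ℝ)..(Real.pi / 2), planarTail m τ 1 := by
    refine intervalIntegral.integral_mono_on (by positivity)
      (intervalIntegrable_planarTail m τ (by fun_prop) _ _) intervalIntegrable_const fun t _ => ?_
    exact planarTail_mono m τ (Real.cos_le_one t)
  rw [intervalIntegral.integral_const, sub_zero, smul_eq_mul] at h1
  have h2 := h.cap
  rw [capMeasure] at h2
  have h3 : p ≤ Real.pi⁻¹ * (Real.pi / 2 * planarTail m τ 1) := by
    rw [← h2]; gcongr
  have h4 : Real.pi⁻¹ * (Real.pi / 2 * planarTail m τ 1) = planarTail m τ 1 / 2 := by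
    field_simp
  linarith

lemma Regime.tau_lt_one : τ < 1 := by
  by_contra! h1
  have h2 := h.planarTail_one_ge
  rw [planarTail_eq_zero_of_le h.m_ne (by linarith) h1] at h2
  linarith [h.p_pos]

lemma Regime.sq_tau_mul_le : τ ^ 2 * m ≤ 2 * Real.log (1 / p) := by
  have h1 := h.planarTail_one_ge
  rw [planarTail_eq_of_lt h.tau_nonneg h.tau_lt_one, div_one] at h1
  have h2 : 0 ≤ 1 - τ ^ 2 := by nlinarith [h.tau_nonneg, h.tau_lt_one]
  have h3 : (1 - τ ^ 2) ^ ((m : ℝ) / 2) ≤ Real.exp (-(τ ^ 2 * m / 2)) := by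
    calc (1 - τ ^ 2) ^ ((m : ℝ) / 2) ≤ (Real.exp (-τ ^ 2)) ^ ((m : ℝ) / 2) := by
          refine Real.rpow_le_rpow h2 ?_ (by positivity)
          linarith [Real.add_one_le_exp (-τ ^ 2)]
      _ = _ := by rw [← Real.exp_mul]; congr 1; ring
  have h4 : p ≤ Real.exp (-(τ ^ 2 * m / 2)) := by linarith [h.p_pos]
  have h5 := Real.log_le_log h.p_pos h4
  rw [Real.log_exp] at h5
  rw [one_div, Real.log_inv]
  linarith

lemma Regime.sq_tau_le : τ ^ 2 ≤ 1 / 150 := by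
  have h1 := h.sq_tau_mul_le
  have h2 := h.log_le_one
  have h3 := h.large'
  nlinarith [sq_nonneg τ]

/-- The lower bound for the measure of a cap: the density of the tail exceeds it by at most a
factor of order `√log (1/p)`. -/
lemma Regime.planarTail_one_le :
    planarTail m τ 1 ≤ 17 * √(Real.log (1 / p)) * p := by
  have hL := h.log_ge
  set L := Real.log (1 / p) with hLdef
  have hpi := Real.pi_pos
  have hsL : 0 < √L := Real.sqrt_pos.2 (by linarith)
  have hsqL : √L ^ 2 = L := Real.sq_sqrt (by linarith)
  -- the angle up to which the tail is at least `3/4` of its value at `0`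
  set δ := 1 / (4 * √L) with hδ
  have hδ0 : 0 < δ := by positivity
  have hδL : δ ^ 2 * L = 1 / 16 := by rw [hδ, div_pow, mul_pow, hsqL]; field_simp; norm_num
  have hδ2 : δ ^ 2 ≤ 1 / 4 := by nlinarith
  have hδ1 : δ ≤ 1 / 2 := by nlinarith
  have hcos : 1 - δ ^ 2 / 2 ≤ Real.cos δ := Real.one_sub_sq_div_two_le_cos
  have hcos0 : 0 < Real.cos δ := by linarith
  have hcos2 : 1 - δ ^ 2 ≤ Real.cos δ ^ 2 := by nlinarith
  have hτ2 := h.sq_tau_le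
  have hτ0 := h.tau_nonneg
  have hτc : τ < Real.cos δ := by nlinarith
  have hq : (τ / Real.cos δ) ^ 2 ≤ τ ^ 2 * (1 + 2 * δ ^ 2) := by
    rw [div_pow, div_le_iff₀ (by positivity)]
    have h1 : 1 ≤ (1 + 2 * δ ^ 2) * Real.cos δ ^ 2 := by nlinarith [sq_nonneg δ]
    nlinarith [sq_nonneg τ]
  have hx : 0 ≤ δ ^ 2 * τ ^ 2 := by positivity
  have hδτ : δ ^ 2 * τ ^ 2 ≤ 1 / 4 := by nlinarith [sq_nonneg τ]
  have hbase : (1 - τ ^ 2) * (1 - 4 * δ ^ 2 * τ ^ 2) ≤ 1 - (τ / Real.cos δ) ^ 2 := by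
    nlinarith [sq_nonneg τ]
  have h1τ : 0 ≤ 1 - τ ^ 2 := by linarith
  have hbern : 3 / 4 ≤ (1 - 4 * δ ^ 2 * τ ^ 2) ^ ((m : ℝ) / 2) := by
    have h1 := one_add_mul_self_le_rpow_one_add (s := -(4 * δ ^ 2 * τ ^ 2)) (by linarith)
      (p := (m : ℝ) / 2) (by linarith [h.large'])
    have h2 := h.sq_tau_mul_le
    have h3 : δ ^ 2 * (τ ^ 2 * m) ≤ δ ^ 2 * (2 * L) := by gcongr
    rw [← sub_eq_add_neg] at h1
    linarith
  have hlow : 3 / 4 * planarTail m τ 1 ≤ planarTail m τ (Real.cos δ) := by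
    rw [planarTail_eq_of_lt hτ0 h.tau_lt_one, planarTail_eq_of_lt hτ0 hτc, div_one]
    calc 3 / 4 * (1 - τ ^ 2) ^ ((m : ℝ) / 2)
        ≤ (1 - 4 * δ ^ 2 * τ ^ 2) ^ ((m : ℝ) / 2) * (1 - τ ^ 2) ^ ((m : ℝ) / 2) := by gcongr
      _ = ((1 - τ ^ 2) * (1 - 4 * δ ^ 2 * τ ^ 2)) ^ ((m : ℝ) / 2) := by
          rw [Real.mul_rpow h1τ (by linarith), mul_comm]
      _ ≤ _ := Real.rpow_le_rpow (mul_nonneg h1τ (by linarith)) hbase (by positivity)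
  have hW : ∀ a b, IntervalIntegrable (fun t => planarTail m τ (Real.cos t)) volume a b :=
    fun a b => intervalIntegrable_planarTail m τ (by fun_prop) a b
  have hπδ : δ ≤ Real.pi / 2 := by linarith [Real.pi_gt_three]
  have hint : δ * planarTail m τ (Real.cos δ) ≤
      ∫ t in (0 : ℝ)..(Real.pi / 2), planarTail m τ (Real.cos t) := by
    rw [← intervalIntegral.integral_add_adjacent_intervals (hW 0 δ) (hW δ _)]
    have h1 : 0 ≤ ∫ t in δ..(Real.pi / 2), planarTail m τ (Real.cos t) :=
      intervalIntegral.integral_nonneg hπδ fun _ _ => planarTail_nonneg _ _ _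
    have h2 : ∫ t in (0 : ℝ)..δ, planarTail m τ (Real.cos δ) ≤
        ∫ t in (0 : ℝ)..δ, planarTail m τ (Real.cos t) := by
      refine intervalIntegral.integral_mono_on hδ0.le intervalIntegrable_const (hW _ _)
        fun t ht => planarTail_mono m τ ?_
      exact Real.cos_le_cos_of_nonneg_of_le_pi ht.1 (by linarith) ht.2
    rw [intervalIntegral.integral_const, sub_zero, smul_eq_mul] at h2
    linarith
  have hp := h.cap
  rw [capMeasure] at hp
  have h5 : Real.pi * p = ∫ t in (0 : ℝ)..(Real.pi / 2), planarTail m τ (Real.cos t) := by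
    rw [← hp, mul_inv_cancel_left₀ hpi.ne']
  have h6 : δ * (3 / 4 * planarTail m τ 1) ≤ Real.pi * p := by
    rw [h5]; exact (mul_le_mul_of_nonneg_left hlow hδ0.le).trans hint
  have h7 : planarTail m τ 1 * (3 / 4) ≤ 4 * √L * (Real.pi * p) := by
    rw [hδ, one_div, inv_mul_le_iff₀ (by positivity)] at h6
    linarith
  have h8 : 4 * √L * (Real.pi * p) ≤ 4 * √L * (3.15 * p) := by
    have := h.p_pos
    have := Real.pi_lt_d2
    gcongr
  have h9 : 0 ≤ √L * p := mul_nonneg hsL.le h.p_pos.le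
  linarith

/-- The planar tail at half the angle of two points with inner product `s`. -/
lemma Regime.planarTail_half_angle_le {s c : ℝ} (hs0 : 0 ≤ s) (hc0 : 0 < c)
    (hc : c ^ 2 = (1 + s) / 2) :
    planarTail m τ c ≤ planarTail m τ 1 ^ 2 * Real.exp (4 * Real.log (1 / p) * s) := by
  have hτ2 := h.sq_tau_le
  have hτs : 0 ≤ τ ^ 2 * s := by positivity
  have h1 : 0 ≤ 1 - τ ^ 2 := by linarith
  rw [planarTail_eq_max h.m_ne h.tau_nonneg hc0, planarTail_eq_of_lt h.tau_nonneg h.tau_lt_one,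
    div_one]
  have hbase : max 0 (1 - (τ / c) ^ 2) ≤ (1 - τ ^ 2) ^ 2 * Real.exp (4 * τ ^ 2 * s) := by
    refine max_le (by positivity) ?_
    have h2 : (1 - τ ^ 2) ^ 2 * (1 + 4 * τ ^ 2 * s) ≤
        (1 - τ ^ 2) ^ 2 * Real.exp (4 * τ ^ 2 * s) := by
      gcongr
      linarith [Real.add_one_le_exp (4 * τ ^ 2 * s)]
    refine le_trans ?_ h2
    have h3 : 2 * τ ^ 2 * (1 - s) ≤ (τ / c) ^ 2 := by
      rw [div_pow, hc, le_div_iff₀ (by linarith)]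
      nlinarith [sq_nonneg τ, mul_nonneg (sq_nonneg τ) (sq_nonneg s)]
    have h4 : 1 / 2 ≤ (1 - τ ^ 2) ^ 2 := by nlinarith
    nlinarith [mul_le_mul_of_nonneg_left h4 hτs]
  calc (max 0 (1 - (τ / c) ^ 2)) ^ ((m : ℝ) / 2)
      ≤ ((1 - τ ^ 2) ^ 2 * Real.exp (4 * τ ^ 2 * s)) ^ ((m : ℝ) / 2) :=
        Real.rpow_le_rpow (le_max_left _ _) hbase (by positivity)
    _ = ((1 - τ ^ 2) ^ ((m : ℝ) / 2)) ^ 2 * Real.exp (2 * (τ ^ 2 * m) * s) := by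
        rw [Real.mul_rpow (by positivity) (by positivity), ← Real.exp_mul, ← Real.rpow_natCast,
          ← Real.rpow_mul h1, ← Real.rpow_mul_natCast h1]
        congr 2
        · push_cast; ring
        · ring
    _ ≤ _ := by
        have h2 : 2 * (τ ^ 2 * m) * s ≤ 4 * Real.log (1 / p) * s :=
          mul_le_mul_of_nonneg_right (by linarith [h.sq_tau_mul_le]) hs0
        exact mul_le_mul_of_nonneg_left (Real.exp_le_exp.2 h2) (sq_nonneg _)

/-- The measure of the intersection of two caps is close to its value for orthogonal centers. -/
lemma Regime.abs_capInter_sub_le (x y : Sphere (m + 2)) :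
    |capInter τ x y - Real.pi⁻¹ * ∫ t in (Real.pi / 4)..(Real.pi / 2), planarTail m τ (Real.cos t)|
      ≤ 73 * Real.log (1 / p) * p ^ 2 * (|inner ℝ (x : Space (m + 2)) y| *
        Real.exp (4 * Real.log (1 / p) * |inner ℝ (x : Space (m + 2)) y|)) := by
  have hpi := Real.pi_pos
  have hL := h.log_ge
  have hx : ‖(x : Space (m + 2))‖ = 1 := by simp
  have hy : ‖(y : Space (m + 2))‖ = 1 := by simp
  have habs := abs_real_inner_le_norm (x : Space (m + 2)) y
  rw [hx, hy, one_mul] at habs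
  rw [capInter_eq h.tau_nonneg]
  set s : ℝ := inner ℝ (x : Space (m + 2)) y with hs
  have habs' := abs_le.1 habs
  set θ := Real.arccos s with hθ
  have hθ0 : 0 ≤ θ := Real.arccos_nonneg s
  have hθ1 : θ ≤ Real.pi := Real.arccos_le_pi s
  have hcosθ : Real.cos θ = s := Real.cos_arccos habs'.1 habs'.2
  have hW : ∀ a b, IntervalIntegrable (fun t => planarTail m τ (Real.cos t)) volume a b :=
    fun a b => intervalIntegrable_planarTail m τ (by fun_prop) a b
  set Q := planarTail m τ 1 with hQ
  have hQ0 : 0 ≤ Q := planarTail_nonneg _ _ _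
  have hD : ∀ t ∈ Set.uIoc (θ / 2) (Real.pi / 4), ‖planarTail m τ (Real.cos t)‖ ≤
      Q ^ 2 * Real.exp (4 * Real.log (1 / p) * |s|) := by
    intro t ht
    rw [Real.norm_of_nonneg (planarTail_nonneg _ _ _)]
    obtain ⟨ht1, ht2⟩ := ht
    have ht3 : t ≤ Real.pi := ht2.trans (max_le (by linarith) (by linarith))
    rcases le_total θ (Real.pi / 2) with h2 | h2
    · rw [min_eq_left (by linarith)] at ht1
      have hs0 : 0 ≤ s := by
        rw [← hcosθ]; exact Real.cos_nonneg_of_mem_Icc ⟨by linarith, h2⟩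
      rw [abs_of_nonneg hs0]
      refine (planarTail_mono m τ (Real.cos_le_cos_of_nonneg_of_le_pi (by linarith) ht3
        ht1.le)).trans (h.planarTail_half_angle_le hs0
          (Real.cos_pos_of_mem_Ioo ⟨by linarith, by linarith⟩) ?_)
      rw [Real.cos_sq, mul_div_cancel₀ _ two_ne_zero, hcosθ]
      ring
    · rw [min_eq_right (by linarith)] at ht1
      refine (planarTail_mono m τ (Real.cos_le_cos_of_nonneg_of_le_pi (by linarith) ht3
        ht1.le)).trans ((h.planarTail_half_angle_le (s := 0) le_rfl
          (Real.cos_pos_of_mem_Ioo ⟨by linarith, by linarith⟩) ?_).trans ?_)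
      · rw [Real.cos_pi_div_four, div_pow, Real.sq_sqrt (by norm_num)]
        norm_num
      · gcongr
        exact abs_nonneg s
  have hlen : |Real.pi / 4 - θ / 2| ≤ Real.pi / 4 * |s| := by
    have h1 : Real.pi / 4 - θ / 2 = Real.arcsin s / 2 := by
      rw [hθ, Real.arccos]; ring
    have h2 := Real.mul_abs_le_abs_sin (x := Real.arcsin s)
      (abs_le.2 ⟨Real.neg_pi_div_two_le_arcsin s, Real.arcsin_le_pi_div_two s⟩)
    rw [Real.sin_arcsin habs'.1 habs'.2] at h2
    rw [h1, abs_div, abs_two]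
    rw [div_mul_eq_mul_div, div_le_iff₀ hpi] at h2
    linarith
  have hint := intervalIntegral.norm_integral_le_of_norm_le_const hD
  rw [Real.norm_eq_abs] at hint
  rw [← intervalIntegral.integral_add_adjacent_intervals (hW (θ / 2) (Real.pi / 4)) (hW _ _),
    mul_add, add_sub_cancel_right, abs_mul, abs_of_pos (inv_pos.2 hpi)]
  have hQ2 : Q ^ 2 ≤ 289 * Real.log (1 / p) * p ^ 2 := by
    calc Q ^ 2 ≤ (17 * √(Real.log (1 / p)) * p) ^ 2 := by gcongr; exact h.planarTail_one_le
      _ = _ := by rw [mul_pow, mul_pow, Real.sq_sqrt (by linarith)]; norm_num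
  set X := Real.exp (4 * Real.log (1 / p) * |s|) with hX
  have hX0 : 0 < X := Real.exp_pos _
  calc Real.pi⁻¹ * |∫ t in (θ / 2)..(Real.pi / 4), planarTail m τ (Real.cos t)|
      ≤ Real.pi⁻¹ * (289 * Real.log (1 / p) * p ^ 2 * X * (Real.pi / 4 * |s|)) := by
        gcongr
        refine hint.trans ?_
        gcongr
    _ = 289 / 4 * Real.log (1 / p) * p ^ 2 * (|s| * X) := by field_simp
    _ ≤ _ := by
        have : 0 ≤ Real.log (1 / p) := by linarith
        gcongr
        norm_num

end

/-! ### Gaussian tails of projections -/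

/-- The projection of a uniform point to a plane is subgaussian. -/
lemma planarTail_one_le_exp {m : ℕ} (hm : m ≠ 0) {r : ℝ} (hr : 0 ≤ r) :
    planarTail m r 1 ≤ Real.exp (-(r ^ 2 * m / 2)) := by
  rcases lt_or_ge r 1 with h | h
  · rw [planarTail_eq_of_lt hr h, div_one]
    calc (1 - r ^ 2) ^ ((m : ℝ) / 2) ≤ (Real.exp (-r ^ 2)) ^ ((m : ℝ) / 2) := by
          refine Real.rpow_le_rpow (by nlinarith) ?_ (by positivity)
          linarith [Real.add_one_le_exp (-r ^ 2)]
      _ = _ := by rw [← Real.exp_mul]; congr 1; ring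
  · rw [planarTail_eq_zero_of_le hm (by linarith) h]
    positivity

lemma planeNorm_le_one {d : ℕ} {x z : Space d} (h : OrthoPair x z) (w : Sphere d) :
    planeNorm x z w ≤ 1 := by
  have h1 := h.inner_self_left
  have h2 := h.inner_self_right
  have hw : inner ℝ (w : Space d) (w : Space d) = (1 : ℝ) := by
    rw [real_inner_self_eq_norm_sq]; simp
  -- the residual of the projection has nonnegative square norm
  have h3 : 0 ≤ inner ℝ
      ((w : Space d) - (inner ℝ x (w : Space d) : ℝ) • x - (inner ℝ z (w : Space d) : ℝ) • z)
      ((w : Space d) - (inner ℝ x (w : Space d) : ℝ) • x - (inner ℝ z (w : Space d) : ℝ) • z) :=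
    real_inner_self_nonneg
  simp only [inner_sub_left, inner_sub_right, real_inner_smul_left, real_inner_smul_right, h1, h2,
    h.inner_eq_zero, h.inner_eq_zero', hw, real_inner_comm x (w : Space d),
    real_inner_comm z (w : Space d)] at h3
  rw [planeNorm]
  refine Real.sqrt_le_one.2 ?_
  nlinarith

lemma bddMeas_planeNorm {d : ℕ} {x z : Space d} (h : OrthoPair x z) {F : ℝ → ℝ}
    (hF : Continuous F) : BddMeas fun w : Sphere d => F (planeNorm x z w) := by
  refine ⟨(hF.comp ((continuous_planeNorm x z).comp continuous_subtype_val)).measurable, ?_⟩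
  obtain ⟨K, hK⟩ := (isCompact_Icc (a := (0 : ℝ)) (b := 1)).exists_bound_of_continuousOn
    hF.continuousOn
  exact ⟨K, fun w => hK _ ⟨planeNorm_nonneg _ _ _, planeNorm_le_one h w⟩⟩

/-- The exponential moment of the squared norm of the projection to a plane. -/
lemma integral_exp_sq_planeNorm_le {m : ℕ} (hm : m ≠ 0) {x z : Space (m + 2)}
    (h : OrthoPair x z) :
    ∫ w : Sphere (m + 2), Real.exp (m * planeNorm x z w ^ 2 / 4) ∂(sphereUniform (m + 2)) ≤ 2 := by
  have hm0 : (0 : ℝ) < m := by positivity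
  have hint : Integrable (fun w : Sphere (m + 2) => Real.exp (m * planeNorm x z w ^ 2 / 4))
      (sphereUniform (m + 2)) :=
    (bddMeas_planeNorm h (F := fun t => Real.exp (m * t ^ 2 / 4)) (by fun_prop)).integrable
  rw [hint.integral_eq_integral_meas_le (ae_of_all _ fun w => (Real.exp_pos _).le)]
  have hpow : IntegrableOn (fun t : ℝ => t ^ (-2 : ℝ)) (Set.Ioi 1) :=
    integrableOn_Ioi_rpow_of_lt (by norm_num) one_pos
  set G : ℝ → ℝ := fun t => (sphereUniform (m + 2)).real
    {w : Sphere (m + 2) | t ≤ Real.exp (m * planeNorm x z w ^ 2 / 4)} with hG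
  have hG1 : ∀ t, G t ≤ 1 := fun t => measureReal_le_one
  have hG0 : ∀ t, 0 ≤ G t := fun t => measureReal_nonneg
  have hGanti : Antitone G := fun s t hst => measureReal_mono fun w hw => hst.trans hw
  have hG2 : ∀ t ∈ Set.Ioi (1 : ℝ), G t ≤ t ^ (-2 : ℝ) := by
    intro t ht
    have ht0 : (0 : ℝ) < t := one_pos.trans ht
    have hlog : 0 < Real.log t := Real.log_pos ht
    set r := √(4 * Real.log t / m) with hr
    have hr2 : r ^ 2 = 4 * Real.log t / m := Real.sq_sqrt (by positivity)
    have hsub : G t ≤ planarTail m r 1 := by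
      rw [← h.measureReal_planeNorm]
      refine measureReal_mono fun w hw => ?_
      rw [Set.mem_ofPred_eq] at hw ⊢
      rw [one_mul]
      have h1 := Real.log_le_log ht0 hw
      rw [Real.log_exp] at h1
      refine Real.sqrt_le_iff.2 ⟨planeNorm_nonneg _ _ _, ?_⟩
      rw [div_le_iff₀ hm0]
      linarith
    refine (hsub.trans (planarTail_one_le_exp hm (Real.sqrt_nonneg _))).trans_eq ?_
    rw [hr2, Real.rpow_def_of_pos ht0]
    congr 1
    field_simp
    ring
  have hGI1 : IntegrableOn G (Set.Ioc 0 1) := by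
    refine Measure.integrableOn_of_bounded (M := 1) (by simp) hGanti.measurable.aestronglyMeasurable
      (ae_of_all _ fun t => ?_)
    rw [Real.norm_of_nonneg (hG0 t)]
    exact hG1 t
  have hGI2 : IntegrableOn G (Set.Ioi 1) := by
    refine hpow.mono' hGanti.measurable.aestronglyMeasurable ?_
    refine (ae_restrict_iff' measurableSet_Ioi).2 (ae_of_all _ fun t ht => ?_)
    rw [Real.norm_of_nonneg (hG0 t)]
    exact hG2 t ht
  rw [← Set.Ioc_union_Ioi_eq_Ioi zero_le_one, setIntegral_union (Set.Ioc_disjoint_Ioi_same)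
    measurableSet_Ioi hGI1 hGI2]
  have h1 : ∫ t in Set.Ioc (0 : ℝ) 1, G t ≤ 1 := by
    calc ∫ t in Set.Ioc (0 : ℝ) 1, G t ≤ ∫ t in Set.Ioc (0 : ℝ) 1, (1 : ℝ) :=
          setIntegral_mono hGI1 (by simp) fun t => hG1 t
      _ = 1 := by simp
  have h2 : ∫ t in Set.Ioi (1 : ℝ), G t ≤ 1 := by
    calc ∫ t in Set.Ioi (1 : ℝ), G t ≤ ∫ t in Set.Ioi (1 : ℝ), t ^ (-2 : ℝ) :=
          setIntegral_mono_on hGI2 hpow measurableSet_Ioi hG2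
      _ = 1 := by rw [integral_Ioi_rpow_of_lt (by norm_num) one_pos]; norm_num
  linarith

lemma integral_exp_sq_inner_le {m : ℕ} (hm : m ≠ 0) (x : Sphere (m + 2)) :
    ∫ y : Sphere (m + 2), Real.exp (m * (inner ℝ (x : Space (m + 2)) y : ℝ) ^ 2 / 4)
      ∂(sphereUniform (m + 2)) ≤ 2 := by
  obtain ⟨z, hz, -⟩ := exists_orthoPair x x
  have hle : ∀ y : Sphere (m + 2), Real.exp (m * (inner ℝ (x : Space (m + 2)) y : ℝ) ^ 2 / 4) ≤
      Real.exp (m * planeNorm x z y ^ 2 / 4) := by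
    intro y
    rw [sq_planeNorm]
    gcongr
    nlinarith [sq_nonneg (inner ℝ z (y : Space (m + 2)) : ℝ)]
  have hint := (bddMeas_planeNorm hz (F := fun t => Real.exp (m * t ^ 2 / 4))
    (by fun_prop)).integrable (μ := sphereUniform (m + 2))
  refine le_trans (integral_mono (hint.mono' ?_ (ae_of_all _ fun y => ?_)) hint hle)
    (integral_exp_sq_planeNorm_le hm hz)
  · exact Measurable.aestronglyMeasurable (by fun_prop)
  · rw [Real.norm_of_nonneg (Real.exp_pos _).le]
    exact hle y

section

variable {m : ℕ} {p τ : ℝ} (h : Regime m p τ)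

include h

/-- Either `ρ` is at most of order `√(log (1/p) / m)`, or the Gaussian weight pays for both the
exponential factor and a factor `p`. -/
lemma Regime.mul_exp_le {ρ : ℝ} (hρ : 0 ≤ ρ) :
    ρ * Real.exp (4 * Real.log (1 / p) * ρ) ≤ 11 * √(Real.log (1 / p) / m) +
      2 * p / √m * Real.exp (m * ρ ^ 2 / 4) := by
  have hL := h.log_ge
  have hp := h.exp_neg_log
  have hm := h.large'
  have hLm := h.log_le_one
  have hL3 := h.pow_log_le (i := 3) (by norm_num)
  set L := Real.log (1 / p) with hLdef
  have hsm : 0 < √(m : ℝ) := Real.sqrt_pos.2 (by linarith)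
  have hsq : √(m : ℝ) ^ 2 = m := Real.sq_sqrt (by linarith)
  set q := √(L / m) with hq
  have hq0 : 0 ≤ q := Real.sqrt_nonneg _
  have hq2 : q ^ 2 = L / m := Real.sq_sqrt (by positivity)
  have hq2m : q ^ 2 * m = L := by rw [hq2]; field_simp
  have hp0 := h.p_pos
  rcases le_total ρ (4 * q) with h1 | h1
  · have h2 : 4 * L * ρ ≤ 1 := by
      have h3 : (16 * L * q) ^ 2 ≤ 1 ^ 2 := by
        rw [mul_pow, hq2, mul_div_assoc', div_le_iff₀ (by linarith)]
        nlinarith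
      have h4 := (sq_le_sq₀ (by positivity) zero_le_one).1 h3
      nlinarith
    have h5 : Real.exp (4 * L * ρ) ≤ 2.75 := by
      refine (Real.exp_le_exp.2 h2).trans ?_
      have := Real.exp_one_lt_d9
      linarith
    have h6 : ρ * Real.exp (4 * L * ρ) ≤ 4 * q * 2.75 := by gcongr
    have h7 : 0 ≤ 2 * p / √m * Real.exp (m * ρ ^ 2 / 4) := by positivity
    linarith
  · have hρL : 16 * L ≤ m * ρ ^ 2 := by
      have : (4 * q) ^ 2 ≤ ρ ^ 2 := by gcongr
      nlinarith
    have hρ32 : 32 * L ≤ m * ρ := by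
      have h2 : 64 * L ≤ m := by linarith
      by_contra! h3
      have h4 : m * ρ * (m * ρ) < 32 * L * (32 * L) := by
        have : 0 ≤ m * ρ := by positivity
        nlinarith
      nlinarith
    have e1 : Real.exp (m * ρ ^ 2 / 4) = Real.exp (m * ρ ^ 2 / 16) * Real.exp (m * ρ ^ 2 / 16) *
        Real.exp (m * ρ ^ 2 / 8) := by
      rw [← Real.exp_add, ← Real.exp_add]; congr 1; ring
    have e2 : 1 ≤ p * Real.exp (m * ρ ^ 2 / 16) := by
      rw [← hp, ← Real.exp_add]
      exact Real.one_le_exp (by linarith)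
    have e3 : Real.exp (4 * L * ρ) ≤ Real.exp (m * ρ ^ 2 / 8) := by
      refine Real.exp_le_exp.2 ?_
      nlinarith
    have e4 : √m * ρ ≤ 2 * Real.exp (m * ρ ^ 2 / 16) := by
      have := Real.add_one_le_exp (m * ρ ^ 2 / 16)
      nlinarith [sq_nonneg (√m * ρ - 4)]
    have h7 : 0 ≤ 11 * q := by positivity
    have h8 : ρ * Real.exp (4 * L * ρ) ≤ 2 * p / √m * Real.exp (m * ρ ^ 2 / 4) := by
      rw [div_mul_eq_mul_div, le_div_iff₀ hsm, e1]
      calc ρ * Real.exp (4 * L * ρ) * √m = (√m * ρ) * Real.exp (4 * L * ρ) := by ring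
        _ ≤ (2 * Real.exp (m * ρ ^ 2 / 16)) * Real.exp (m * ρ ^ 2 / 8) := by gcongr
        _ ≤ (2 * Real.exp (m * ρ ^ 2 / 16)) * Real.exp (m * ρ ^ 2 / 8) *
            (p * Real.exp (m * ρ ^ 2 / 16)) := le_mul_of_one_le_right (by positivity) e2
        _ = _ := by ring
    linarith

/-- The weight in the deviation of the two-step kernel is dominated, after squaring, by `m⁻¹` times
a function with bounded integral; the quadratic exponent absorbs the linear one. -/
lemma Regime.sq_mul_exp_le (s : ℝ) :
    (|s| * Real.exp (4 * Real.log (1 / p) * |s|)) ^ 2 ≤ 24 / m * Real.exp (m * s ^ 2 / 4) := by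
  have hL := h.log_ge
  have hm := h.large'
  have hL2 := h.pow_log_le (i := 2) (by norm_num)
  set L := Real.log (1 / p) with hLdef
  have hm0 : (0 : ℝ) < m := by linarith
  have e0 : (|s| * Real.exp (4 * L * |s|)) ^ 2 = s ^ 2 * Real.exp (8 * L * |s|) := by
    rw [mul_pow, sq_abs, ← Real.exp_nat_mul]; congr 2; push_cast; ring
  have e1 : 8 * L * |s| ≤ m * s ^ 2 / 8 + 1 := by
    have h1 : 0 ≤ (m * |s| - 32 * L) ^ 2 := sq_nonneg _
    have h2 : (m * |s| - 32 * L) ^ 2 = m ^ 2 * s ^ 2 - 64 * L * |s| * m + 1024 * L ^ 2 := by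
      rw [← sq_abs s]; ring
    have h3 : 8 * L * |s| * m ≤ (m * s ^ 2 / 8 + 1) * m := by nlinarith
    exact le_of_mul_le_mul_right h3 hm0
  have e2 : s ^ 2 ≤ 8 / m * Real.exp (m * s ^ 2 / 8) := by
    rw [div_mul_eq_mul_div, le_div_iff₀ hm0]
    have := Real.add_one_le_exp (m * s ^ 2 / 8)
    linarith
  have e3 : Real.exp 1 ≤ 3 := by have := Real.exp_one_lt_d9; linarith
  rw [e0]
  calc s ^ 2 * Real.exp (8 * L * |s|)
      ≤ 8 / m * Real.exp (m * s ^ 2 / 8) * Real.exp (m * s ^ 2 / 8 + 1) := by gcongr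
    _ = 8 / m * Real.exp 1 * Real.exp (m * s ^ 2 / 4) := by
        rw [Real.exp_add, show m * s ^ 2 / 4 = m * s ^ 2 / 8 + m * s ^ 2 / 8 by ring, Real.exp_add]
        ring
    _ ≤ 8 / m * 3 * Real.exp (m * s ^ 2 / 4) := by gcongr
    _ = _ := by ring

end

/-! ### Lipschitz contraction of the kernel operator -/

lemma BddMeas.comp_continuous {X : Type*} [MeasurableSpace X] {f : X → ℝ} (hf : BddMeas f)
    {F : ℝ → ℝ} (hF : Continuous F) : BddMeas fun x => F (f x) := by
  obtain ⟨hm, K, hK⟩ := hf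
  obtain ⟨C, hC⟩ := (isCompact_Icc (a := -K) (b := K)).exists_bound_of_continuousOn hF.continuousOn
  exact ⟨hF.measurable.comp hm, C, fun x => hC _ (abs_le.1 (hK x))⟩

lemma BddMeas.add_const {X : Type*} [MeasurableSpace X] {f : X → ℝ} (hf : BddMeas f) (c : ℝ) :
    BddMeas fun x => f x + c :=
  hf.comp_continuous (F := fun t => t + c) (by fun_prop)

/-- The spherical cap of height `τ` centered at `x`. -/
def sphereCap {d : ℕ} (τ : ℝ) (x : Sphere d) : Set (Sphere d) :=
  {w | τ ≤ inner ℝ (x : Space d) (w : Space d)}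

lemma capKernel_eq {d : ℕ} (p τ : ℝ) (x y : Sphere d) :
    capKernel p τ x y = (sphereCap τ x).indicator 1 y - p := by
  by_cases hy : τ ≤ inner ℝ (x : Space d) (y : Space d)
  · have h1 : y ∈ sphereCap τ x := hy
    rw [Set.indicator_of_mem h1, capKernel, eq_true hy, centered_true]; simp
  · have h1 : y ∉ sphereCap τ x := hy
    rw [Set.indicator_of_notMem h1, capKernel, eq_false hy, centered_false]; simp

lemma measurableSet_sphereCap {d : ℕ} (τ : ℝ) (x : Sphere d) : MeasurableSet (sphereCap τ x) :=
  measurableSet_cap τ (x : Space d)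

/-- The map `f` is Lipschitz with constant `K` for the chordal distance. -/
def LipBound {d : ℕ} (K : ℝ) (f : Sphere d → ℝ) : Prop :=
  ∀ x y : Sphere d, |f x - f y| ≤ K * ‖(x : Space d) - y‖

lemma norm_sub_sq_sphere {d : ℕ} (x y : Sphere d) :
    ‖(x : Space d) - y‖ ^ 2 = 2 - 2 * inner ℝ (x : Space d) (y : Space d) := by
  rw [norm_sub_sq_real]; simp; ring

lemma inner_mem_Icc {d : ℕ} (x y : Sphere d) :
    -1 ≤ (inner ℝ (x : Space d) (y : Space d) : ℝ) ∧
      (inner ℝ (x : Space d) (y : Space d) : ℝ) ≤ 1 := by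
  have habs := abs_real_inner_le_norm (x : Space d) (y : Space d)
  have h1 : ‖(x : Space d)‖ = 1 := by simp
  have h2 : ‖(y : Space d)‖ = 1 := by simp
  rw [h1, h2, one_mul] at habs
  exact abs_le.1 habs

/-- Any point of the sphere is taken to any other by a rotation that moves each point `w` by the
length of the chord times the norm of the projection of `w` to the plane of rotation. -/
lemma exists_rotation_sphere {m : ℕ} (x y : Sphere (m + 2)) :
    ∃ (z : Space (m + 2)) (T : Space (m + 2) ≃ₗᵢ[ℝ] Space (m + 2)),
      OrthoPair (x : Space (m + 2)) z ∧ T x = y ∧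
      ∀ w, ‖T w - w‖ = ‖(x : Space (m + 2)) - y‖ * planeNorm x z w := by
  obtain ⟨z, hz, hy⟩ := exists_orthoPair x y
  have hI := inner_mem_Icc x y
  have hcos := Real.cos_arccos hI.1 hI.2
  have hd := norm_sub_sq_sphere x y
  rw [← hcos] at hd
  set φ := Real.arccos (inner ℝ (x : Space (m + 2)) y) with hφ
  obtain ⟨T, hT⟩ := hz.exists_rotation φ
  have h1 := hz.inner_self_left
  have h2 := hz.inner_self_right
  refine ⟨z, T, hz, ?_, fun w => ?_⟩
  · rw [hT, h1, hz.inner_eq_zero', hy]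
    module
  · have hsq : ‖T w - w‖ ^ 2 = (‖(x : Space (m + 2)) - y‖ * planeNorm x z w) ^ 2 := by
      have e : T w - w = ((Real.cos φ - 1) * inner ℝ (x : Space (m + 2)) w -
          Real.sin φ * inner ℝ z w) • (x : Space (m + 2)) +
          (Real.sin φ * inner ℝ (x : Space (m + 2)) w + (Real.cos φ - 1) * inner ℝ z w) • z := by
        rw [hT]; abel
      rw [e, mul_pow, hd, sq_planeNorm, ← real_inner_self_eq_norm_sq]
      simp only [inner_add_left, inner_add_right, real_inner_smul_left, real_inner_smul_right, h1,
        h2, hz.inner_eq_zero, hz.inner_eq_zero']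
      have := Real.sin_sq_add_cos_sq φ
      linear_combination ((inner ℝ (x : Space (m + 2)) w) ^ 2 + (inner ℝ z w) ^ 2) * this
    exact (sq_eq_sq₀ (norm_nonneg _) (mul_nonneg (norm_nonneg _) (planeNorm_nonneg _ _ _))).1 hsq

lemma kernelOp_capKernel_eq {m : ℕ} (p τ : ℝ) {f : Sphere (m + 2) → ℝ} (hf : BddMeas f)
    (x : Sphere (m + 2)) :
    kernelOp (sphereUniform (m + 2)) (capKernel p τ) f x =
      (∫ y in sphereCap τ x, f y ∂(sphereUniform (m + 2))) -
        p * ∫ y, f y ∂(sphereUniform (m + 2)) := by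
  have e : ∀ y, capKernel p τ x y * f y = (sphereCap τ x).indicator f y - p * f y := by
    intro y
    rw [capKernel_eq, sub_mul]
    by_cases hy : y ∈ sphereCap τ x <;> simp [hy]
  rw [kernelOp]
  simp_rw [e]
  rw [integral_sub (hf.integrable.indicator (measurableSet_sphereCap τ x))
    (hf.integrable.const_mul p),
    integral_indicator (measurableSet_sphereCap τ x), integral_const_mul]

section

variable {m : ℕ} {p τ : ℝ} (h : Regime m p τ)

include h

lemma Regime.measureReal_cap (x : Sphere (m + 2)) :
    (sphereUniform (m + 2)).real (sphereCap τ x) = p :=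
  (LocalGeometry.measureReal_cap h.tau_nonneg x).trans h.cap

lemma Regime.abs_capKernel_le (x y : Sphere (m + 2)) : |capKernel p τ x y| ≤ 1 :=
  abs_centered_le h.p_pos.le (by linarith [h.p_le]) _

lemma Regime.integral_capKernel (x : Sphere (m + 2)) :
    ∫ y, capKernel p τ x y ∂(sphereUniform (m + 2)) = 0 := by
  have h1 := kernelOp_capKernel_eq p τ (f := fun _ => 1) ⟨measurable_const, 1, fun _ => by simp⟩ x
  rw [kernelOp] at h1
  simpa [h.measureReal_cap x] using h1

lemma Regime.bddMeas_capKernel (x : Sphere (m + 2)) : BddMeas fun y => capKernel p τ y x :=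
  bddMeas_left (measurable_capKernel p τ) h.abs_capKernel_le x

/-- The two-step kernel is the excess of the measure of the intersection of two caps over its
value for independent events. -/
lemma Regime.kernelOp_capKernel (x y : Sphere (m + 2)) :
    kernelOp (sphereUniform (m + 2)) (capKernel p τ) (fun w => capKernel p τ w x) y =
      capInter τ x y - p ^ 2 := by
  rw [kernelOp_capKernel_eq p τ (h.bddMeas_capKernel x)]
  simp_rw [capKernel_comm p τ _ x]
  rw [h.integral_capKernel, mul_zero, sub_zero]
  simp_rw [capKernel_eq]
  rw [integral_sub, integral_indicator_one (measurableSet_sphereCap τ x)]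
  · rw [setIntegral_const, h.measureReal_cap,
      measureReal_restrict_apply (measurableSet_sphereCap τ x)]
    simp only [smul_eq_mul, sq]
    rfl
  · exact (integrable_const (1 : ℝ)).indicator (measurableSet_sphereCap τ x)
  · exact integrable_const _

lemma Regime.bddMeas_capInter (x : Sphere (m + 2)) : BddMeas fun y => capInter τ x y := by
  have h1 := ((h.bddMeas_capKernel x).kernelOp (μ := sphereUniform (m + 2))
    (measurable_capKernel p τ) h.abs_capKernel_le).add_const (p ^ 2)
  refine (congrArg BddMeas (funext fun y => ?_)).mp h1
  rw [h.kernelOp_capKernel]; ring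

/-- A nonnegative function with a Gaussian tail at scale `m ^ (-1/2)` has integral at most of
order `p √(log (1/p) / m)` over a set of measure `p`; the exponential weight is harmless. -/
lemma Regime.setIntegral_cap_le {ρ : Sphere (m + 2) → ℝ} (hρ : BddMeas ρ) (h0 : ∀ w, 0 ≤ ρ w)
    (hexp : ∫ w, Real.exp (m * ρ w ^ 2 / 4) ∂(sphereUniform (m + 2)) ≤ 2) (x : Sphere (m + 2)) :
    ∫ w in sphereCap τ x, ρ w * Real.exp (4 * Real.log (1 / p) * ρ w) ∂(sphereUniform (m + 2)) ≤
      16 * (p * √(Real.log (1 / p) / m)) := by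
  have hL := h.log_ge
  have hm := h.large'
  have hp0 := h.p_pos
  have hE : BddMeas fun w => Real.exp (m * ρ w ^ 2 / 4) :=
    hρ.comp_continuous (F := fun t => Real.exp (m * t ^ 2 / 4)) (by fun_prop)
  have hF : BddMeas fun w => ρ w * Real.exp (4 * Real.log (1 / p) * ρ w) :=
    hρ.comp_continuous (F := fun t => t * Real.exp (4 * Real.log (1 / p) * t)) (by fun_prop)
  set L := Real.log (1 / p) with hLdef
  have hsm : 0 < √(m : ℝ) := Real.sqrt_pos.2 (by linarith)
  have hq : √(L / m) = √L / √m := Real.sqrt_div (by linarith) _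
  have hsL : 0.8 ≤ √L := Real.le_sqrt_of_sq_le (by linarith)
  have hIE : ∫ w in sphereCap τ x, Real.exp (m * ρ w ^ 2 / 4) ∂(sphereUniform (m + 2)) ≤ 2 :=
    (setIntegral_le_integral hE.integrable (ae_of_all _ fun w => (Real.exp_pos _).le)).trans hexp
  calc ∫ w in sphereCap τ x, ρ w * Real.exp (4 * L * ρ w) ∂(sphereUniform (m + 2))
      ≤ ∫ w in sphereCap τ x, (11 * √(L / m) + 2 * p / √m * Real.exp (m * ρ w ^ 2 / 4))
          ∂(sphereUniform (m + 2)) := by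
        refine setIntegral_mono hF.integrable.integrableOn ?_ fun w => h.mul_exp_le (h0 w)
        exact ((integrable_const _).add (hE.integrable.const_mul _)).integrableOn
    _ = p * (11 * √(L / m)) + 2 * p / √m *
          ∫ w in sphereCap τ x, Real.exp (m * ρ w ^ 2 / 4) ∂(sphereUniform (m + 2)) := by
        rw [integral_add (integrable_const _) (hE.integrable.integrableOn.const_mul _),
          setIntegral_const, integral_const_mul, h.measureReal_cap, smul_eq_mul]
    _ ≤ p * (11 * √(L / m)) + 2 * p / √m * 2 := by gcongr
    _ = (11 * √L + 4) * p / √m := by rw [hq]; ring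
    _ ≤ (16 * √L) * p / √m := by gcongr; linarith
    _ = _ := by rw [hq]; ring

lemma Regime.setIntegral_cap_planeNorm_le {x z : Space (m + 2)} (hz : OrthoPair x z)
    (y : Sphere (m + 2)) :
    ∫ w in sphereCap τ y, planeNorm x z w ∂(sphereUniform (m + 2)) ≤
      16 * (p * √(Real.log (1 / p) / m)) := by
  have hL := h.log_ge
  have hR : BddMeas fun w : Sphere (m + 2) => planeNorm x z w :=
    bddMeas_planeNorm hz (F := id) continuous_id
  refine le_trans (setIntegral_mono hR.integrable.integrableOn ?_ fun w => ?_)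
    (h.setIntegral_cap_le hR (fun w => planeNorm_nonneg _ _ _)
      (integral_exp_sq_planeNorm_le h.m_ne hz) y)
  · exact (hR.comp_continuous (F := fun t => t * Real.exp (4 * Real.log (1 / p) * t))
      (by fun_prop)).integrable.integrableOn
  · have h1 := planeNorm_nonneg x z w
    exact le_mul_of_one_le_right h1 (Real.one_le_exp (by positivity))

/-- The kernel operator contracts the Lipschitz seminorm: to compare its values at `x` and `y`,
rotate `x` to `y` and the cap around `x` with it. -/
lemma Regime.lipBound_kernelOp {K : ℝ} {f : Sphere (m + 2) → ℝ} (hf : BddMeas f)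
    (hK : LipBound K f) :
    LipBound (K * (16 * (p * √(Real.log (1 / p) / m))))
      (kernelOp (sphereUniform (m + 2)) (capKernel p τ) f) := by
  intro x y
  obtain ⟨z, T, hz, hTx, hT⟩ := exists_rotation_sphere x y
  have hmp := measurePreserving_sphereMap T
  have hfT : BddMeas fun w => f (sphereMap T w) := by
    obtain ⟨h1, C, h2⟩ := hf
    exact ⟨h1.comp (measurable_sphereMap T), C, fun w => h2 _⟩
  have hR : BddMeas fun w : Sphere (m + 2) => planeNorm x z w :=
    bddMeas_planeNorm hz (F := id) continuous_id
  have hmem : ∀ w, sphereMap T w ∈ sphereCap τ y ↔ w ∈ sphereCap τ x := by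
    intro w
    simp only [sphereCap, sphereMap, Set.mem_ofPred_eq, ← hTx, T.inner_map_map]
  have e1 : ∫ w in sphereCap τ y, f w ∂(sphereUniform (m + 2)) =
      ∫ w in sphereCap τ x, f (sphereMap T w) ∂(sphereUniform (m + 2)) := by
    rw [← integral_indicator (measurableSet_sphereCap τ y),
      ← integral_indicator (measurableSet_sphereCap τ x)]
    have h1 := integral_map (μ := sphereUniform (m + 2)) (measurable_sphereMap T).aemeasurable
      (f := (sphereCap τ y).indicator f)
      (hf.1.indicator (measurableSet_sphereCap τ y)).aestronglyMeasurable
    rw [hmp.map_eq] at h1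
    rw [h1]
    refine integral_congr_ae (ae_of_all _ fun w => ?_)
    by_cases hw : w ∈ sphereCap τ x
    · simp only [Set.indicator_of_mem hw, Set.indicator_of_mem ((hmem w).2 hw)]
    · simp only [Set.indicator_of_notMem hw, Set.indicator_of_notMem (mt (hmem w).1 hw)]
  rw [kernelOp_capKernel_eq p τ hf, kernelOp_capKernel_eq p τ hf, sub_sub_sub_cancel_right, e1,
    ← integral_sub hf.integrable.integrableOn hfT.integrable.integrableOn]
  have hKn : 0 ≤ K * ‖(x : Space (m + 2)) - y‖ := (abs_nonneg _).trans (hK x y)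
  calc |∫ w in sphereCap τ x, (f w - f (sphereMap T w)) ∂(sphereUniform (m + 2))|
      ≤ ∫ w in sphereCap τ x, K * ‖(x : Space (m + 2)) - y‖ * planeNorm x z w
          ∂(sphereUniform (m + 2)) := by
        refine norm_integral_le_of_norm_le (μ := (sphereUniform (m + 2)).restrict (sphereCap τ x))
          (f := fun w => f w - f (sphereMap T w)) (hR.integrable.integrableOn.const_mul _)
          (ae_of_all _ fun w => ?_)
        rw [mul_assoc, ← hT w, norm_sub_rev (T _)]
        exact hK w (sphereMap T w)
    _ = K * ‖(x : Space (m + 2)) - y‖ * ∫ w in sphereCap τ x, planeNorm x z w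
          ∂(sphereUniform (m + 2)) := integral_const_mul _ _
    _ ≤ K * ‖(x : Space (m + 2)) - y‖ * (16 * (p * √(Real.log (1 / p) / m))) := by
        gcongr; exact h.setIntegral_cap_planeNorm_le hz x
    _ = _ := by ring

/-- Nearby caps overlap: the angle is at most `π / 2` times the chord. -/
lemma Regime.sub_capInter_le (x y : Sphere (m + 2)) :
    p - capInter τ x y ≤ 1 / 4 * ‖(x : Space (m + 2)) - y‖ := by
  have hpi := Real.pi_pos
  have hI := inner_mem_Icc x y
  have hd := norm_sub_sq_sphere x y
  rw [← Real.cos_arccos hI.1 hI.2] at hd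
  rw [capInter_eq h.tau_nonneg]
  have hθ0 := Real.arccos_nonneg (inner ℝ (x : Space (m + 2)) y)
  have hθ1 := Real.arccos_le_pi (inner ℝ (x : Space (m + 2)) y)
  set θ := Real.arccos (inner ℝ (x : Space (m + 2)) y) with hθ
  have hint : ∀ a b, IntervalIntegrable (fun t => planarTail m τ (Real.cos t)) volume a b :=
    fun a b => intervalIntegrable_planarTail m τ (by fun_prop) a b
  have h1 : p = Real.pi⁻¹ * ((∫ t in (0 : ℝ)..(θ / 2), planarTail m τ (Real.cos t)) +
      ∫ t in (θ / 2)..(Real.pi / 2), planarTail m τ (Real.cos t)) := by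
    rw [intervalIntegral.integral_add_adjacent_intervals (hint _ _) (hint _ _)]
    exact h.cap.symm
  have h2 : ∫ t in (0 : ℝ)..(θ / 2), planarTail m τ (Real.cos t) ≤ θ / 2 := by
    calc _ ≤ ∫ t in (0 : ℝ)..(θ / 2), (1 : ℝ) :=
          intervalIntegral.integral_mono_on (by positivity) (hint _ _) intervalIntegrable_const
            fun t _ => planarTail_le_one _ _ _
      _ = _ := by simp
  have h3 : 2 * θ / Real.pi ≤ ‖(x : Space (m + 2)) - y‖ := by
    have h4 := Real.mul_le_sin (x := θ / 2) (by positivity) (by linarith)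
    have h5 : Real.cos θ = 1 - 2 * Real.sin (θ / 2) ^ 2 := by
      have h6 := Real.cos_sq' (θ / 2)
      have h7 := Real.cos_two_mul (θ / 2)
      rw [show 2 * (θ / 2) = θ by ring] at h7
      linarith
    refine (sq_le_sq₀ (by positivity) (norm_nonneg _)).1 ?_
    rw [hd, h5]
    have h8 : 2 * θ / Real.pi = 2 * (2 / Real.pi * (θ / 2)) := by ring
    rw [h8]
    have h9 : 0 ≤ 2 / Real.pi * (θ / 2) := by positivity
    nlinarith
  have h4 : p - Real.pi⁻¹ * ∫ t in (θ / 2)..(Real.pi / 2), planarTail m τ (Real.cos t) =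
      Real.pi⁻¹ * ∫ t in (0 : ℝ)..(θ / 2), planarTail m τ (Real.cos t) := by
    linear_combination h1
  rw [h4]
  calc _ ≤ Real.pi⁻¹ * (θ / 2) := by gcongr
    _ = 1 / 4 * (2 * θ / Real.pi) := by ring
    _ ≤ _ := by gcongr

lemma Regime.lipBound_capInter (x : Sphere (m + 2)) : LipBound (1 / 4) (capInter τ x) := by
  have key : ∀ y y' : Sphere (m + 2), capInter τ x y - capInter τ x y' ≤
      1 / 4 * ‖(y : Space (m + 2)) - y'‖ := by
    intro y y'
    have h1 : capInter τ x y ≤ capInter τ x y' +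
        (sphereUniform (m + 2)).real (sphereCap τ y \ (sphereCap τ y ∩ sphereCap τ y')) := by
      refine le_trans (measureReal_mono fun w hw => ?_) (measureReal_union_le _ _)
      by_cases hw' : w ∈ sphereCap τ y'
      · exact Or.inl ⟨hw.1, hw'⟩
      · exact Or.inr ⟨hw.2, fun h2 => hw' h2.2⟩
    rw [measureReal_sdiff Set.inter_subset_left
      ((measurableSet_sphereCap τ y).inter (measurableSet_sphereCap τ y')), h.measureReal_cap] at h1
    have h2 : (sphereUniform (m + 2)).real (sphereCap τ y ∩ sphereCap τ y') = capInter τ y y' := rfl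
    rw [h2] at h1
    linarith [h.sub_capInter_le y y']
  intro y y'
  refine abs_sub_le_iff.2 ⟨key y y', ?_⟩
  rw [norm_sub_rev]
  exact key y' y

end

/-! ### Bound for the cycle integral -/

lemma abs_integral_le_of_abs_le {X : Type*} [MeasurableSpace X] {μ : Measure X}
    [IsProbabilityMeasure μ] {f : X → ℝ} {C : ℝ} (hC : ∀ x, |f x| ≤ C) : |∫ x, f x ∂μ| ≤ C := by
  have := norm_integral_le_of_norm_le_const (μ := μ) (f := f) (C := C) (ae_of_all μ hC)
  simpa using this

lemma bddMeas_inner_weight {m : ℕ} (p : ℝ) (x : Sphere (m + 2)) :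
    BddMeas fun y : Sphere (m + 2) => |(inner ℝ (x : Space (m + 2)) y : ℝ)| *
      Real.exp (4 * Real.log (1 / p) * |(inner ℝ (x : Space (m + 2)) y : ℝ)|) := by
  have h1 : BddMeas fun y : Sphere (m + 2) => (inner ℝ (x : Space (m + 2)) y : ℝ) :=
    ⟨by fun_prop, 1, fun y => abs_le.2 (inner_mem_Icc x y)⟩
  exact h1.comp_continuous (F := fun t => |t| * Real.exp (4 * Real.log (1 / p) * |t|))
    (by fun_prop)

section

variable {m : ℕ} {p τ : ℝ} (h : Regime m p τ)

include h

lemma Regime.integral_sq_inner_weight_le (x : Sphere (m + 2)) :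
    ∫ y : Sphere (m + 2), (|(inner ℝ (x : Space (m + 2)) y : ℝ)| *
      Real.exp (4 * Real.log (1 / p) * |(inner ℝ (x : Space (m + 2)) y : ℝ)|)) ^ 2
      ∂(sphereUniform (m + 2)) ≤ 48 / m := by
  have hm := h.large'
  have hE : BddMeas fun y : Sphere (m + 2) =>
      Real.exp (m * (inner ℝ (x : Space (m + 2)) y : ℝ) ^ 2 / 4) :=
    BddMeas.comp_continuous (f := fun y : Sphere (m + 2) => (inner ℝ (x : Space (m + 2)) y : ℝ))
      ⟨by fun_prop, 1, fun y => abs_le.2 (inner_mem_Icc x y)⟩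
      (F := fun t => Real.exp (m * t ^ 2 / 4)) (by fun_prop)
  calc _ ≤ ∫ y : Sphere (m + 2), 24 / m *
        Real.exp (m * (inner ℝ (x : Space (m + 2)) y : ℝ) ^ 2 / 4) ∂(sphereUniform (m + 2)) :=
        integral_mono ((bddMeas_inner_weight p x).comp_continuous (F := fun t => t ^ 2)
          (by fun_prop)).integrable (hE.integrable.const_mul _) fun y => h.sq_mul_exp_le _
    _ = 24 / m * ∫ y : Sphere (m + 2),
        Real.exp (m * (inner ℝ (x : Space (m + 2)) y : ℝ) ^ 2 / 4) ∂(sphereUniform (m + 2)) :=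
        integral_const_mul _ _
    _ ≤ 24 / m * 2 := by gcongr; exact integral_exp_sq_inner_le h.m_ne x
    _ = _ := by ring

/-- A first moment bound, from the second moment by the Cauchy–Schwarz inequality. -/
lemma Regime.integral_inner_weight_le (x : Sphere (m + 2)) :
    ∫ y : Sphere (m + 2), |(inner ℝ (x : Space (m + 2)) y : ℝ)| *
      Real.exp (4 * Real.log (1 / p) * |(inner ℝ (x : Space (m + 2)) y : ℝ)|)
      ∂(sphereUniform (m + 2)) ≤ 9 * √(Real.log (1 / p) / m) := by
  have hL := h.log_ge
  have hm := h.large'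
  have h1 := (bddMeas_inner_weight p x).integral_mul_sq_le (μ := sphereUniform (m + 2))
    (g := fun _ => 1) ⟨measurable_const, 1, fun _ => by simp⟩
  have h2 := h.integral_sq_inner_weight_le x
  simp only [mul_one, one_pow, integral_const, probReal_univ, smul_eq_mul] at h1
  refine abs_le_of_sq_le_sq' ((h1.trans h2).trans ?_) (by positivity) |>.2
  rw [mul_pow, Real.sq_sqrt (by positivity), mul_div_assoc']
  gcongr
  linarith

lemma Regime.setIntegral_inner_weight_le (x : Sphere (m + 2)) :
    ∫ y in sphereCap τ x, |(inner ℝ (x : Space (m + 2)) y : ℝ)| *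
      Real.exp (4 * Real.log (1 / p) * |(inner ℝ (x : Space (m + 2)) y : ℝ)|)
      ∂(sphereUniform (m + 2)) ≤ 16 * (p * √(Real.log (1 / p) / m)) := by
  refine h.setIntegral_cap_le (ρ := fun y => |(inner ℝ (x : Space (m + 2)) y : ℝ)|)
    ⟨by fun_prop, 1, fun y => ?_⟩ (fun y => abs_nonneg _) ?_ x
  · rw [abs_abs]; exact abs_le.2 (inner_mem_Icc x y)
  · simp only [sq_abs]
    exact integral_exp_sq_inner_le h.m_ne x

lemma Regime.integral_capInter_sub (x : Sphere (m + 2)) :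
    ∫ y, (capInter τ x y - p ^ 2) ∂(sphereUniform (m + 2)) = 0 := by
  simp_rw [← h.kernelOp_capKernel]
  refine integral_kernelOp_eq_zero (measurable_capKernel p τ) h.abs_capKernel_le (fun y => ?_)
    (h.bddMeas_capKernel x)
  simp_rw [capKernel_comm p τ _ y]
  exact h.integral_capKernel y

lemma Regime.bddMeas_capInter_sub (x : Sphere (m + 2)) :
    BddMeas fun y => capInter τ x y - p ^ 2 := by
  simpa only [sub_eq_add_neg] using (h.bddMeas_capInter x).add_const (-p ^ 2)

/-- The two-step kernel in `L²`. The mean minimizes the square deviation, so the mean may be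
replaced by the measure of the intersection of orthogonal caps. -/
lemma Regime.integral_sq_capInter_sub_le (x : Sphere (m + 2)) :
    ∫ y, (capInter τ x y - p ^ 2) ^ 2 ∂(sphereUniform (m + 2)) ≤
      255792 * (m * (p * √(Real.log (1 / p) / m)) ^ 4) := by
  have hL := h.log_ge
  have hm := h.large'
  have hD := h.abs_capInter_sub_le x
  have hW2 := h.integral_sq_inner_weight_le x
  have hW := bddMeas_inner_weight p x
  have hf := h.bddMeas_capInter_sub x
  have h0 := h.integral_capInter_sub x
  set L := Real.log (1 / p) with hLdef
  set c := Real.pi⁻¹ * ∫ t in (Real.pi / 4)..(Real.pi / 2), planarTail m τ (Real.cos t) with hc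
  set q := √(L / m) with hq
  have hq2 : q ^ 2 = L / m := Real.sq_sqrt (by positivity)
  have hg : BddMeas fun y => capInter τ x y - c := by
    simpa only [sub_eq_add_neg] using (h.bddMeas_capInter x).add_const (-c)
  have hle : ∫ y, (capInter τ x y - p ^ 2) ^ 2 ∂(sphereUniform (m + 2)) ≤
      ∫ y, (capInter τ x y - c) ^ 2 ∂(sphereUniform (m + 2)) := by
    have e : ∀ y, (capInter τ x y - c) ^ 2 = (capInter τ x y - p ^ 2) ^ 2 +
        (2 * (p ^ 2 - c) * (capInter τ x y - p ^ 2) + (p ^ 2 - c) ^ 2) := fun y => by ring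
    simp_rw [e]
    have hI : Integrable (fun y => 2 * (p ^ 2 - c) * (capInter τ x y - p ^ 2) + (p ^ 2 - c) ^ 2)
        (sphereUniform (m + 2)) :=
      (hf.comp_continuous (F := fun t => 2 * (p ^ 2 - c) * t + (p ^ 2 - c) ^ 2)
        (by fun_prop)).integrable
    rw [integral_add (hf.comp_continuous (F := fun t => t ^ 2) (by fun_prop)).integrable hI,
      integral_add (hf.integrable.const_mul _) (integrable_const _), integral_const_mul, h0]
    simp only [mul_zero, zero_add, integral_const, probReal_univ, smul_eq_mul, one_mul,
      le_add_iff_nonneg_right]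
    positivity
  refine hle.trans ?_
  calc _ ≤ ∫ y : Sphere (m + 2), (73 * L * p ^ 2) ^ 2 *
        (|(inner ℝ (x : Space (m + 2)) y : ℝ)| *
          Real.exp (4 * L * |(inner ℝ (x : Space (m + 2)) y : ℝ)|)) ^ 2
        ∂(sphereUniform (m + 2)) := by
        refine integral_mono (hg.comp_continuous (F := fun t => t ^ 2) (by fun_prop)).integrable
          ((hW.comp_continuous (F := fun t => t ^ 2) (by fun_prop)).integrable.const_mul _)
          fun y => ?_
        rw [← mul_pow, ← sq_abs]
        exact pow_le_pow_left₀ (abs_nonneg _) (hD y) 2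
    _ ≤ (73 * L * p ^ 2) ^ 2 * (48 / m) := by
        rw [integral_const_mul]; gcongr
    _ = 255792 * (m * (p ^ 4 * (L / m) ^ 2)) := by field_simp; ring
    _ = _ := by rw [← hq2]; ring

/-- The three-step kernel on the diagonal. The kernel is concentrated on a cap of measure `p`,
where the deviation of the two-step kernel is integrated. -/
lemma Regime.abs_integral_capKernel_mul_le (x : Sphere (m + 2)) :
    |∫ y, capKernel p τ x y * (capInter τ x y - p ^ 2) ∂(sphereUniform (m + 2))| ≤
      1825 * (m * (p * √(Real.log (1 / p) / m)) ^ 3) := by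
  have hL := h.log_ge
  have hm := h.large'
  have hp := h.p_pos
  have hD := h.abs_capInter_sub_le x
  have hW1 := h.integral_inner_weight_le x
  have hWc := h.setIntegral_inner_weight_le x
  have hW := bddMeas_inner_weight p x
  set L := Real.log (1 / p) with hLdef
  set c := Real.pi⁻¹ * ∫ t in (Real.pi / 4)..(Real.pi / 2), planarTail m τ (Real.cos t) with hc
  set q := √(L / m) with hq
  have hq2 : q ^ 2 = L / m := Real.sq_sqrt (by positivity)
  have hg : BddMeas fun y => capInter τ x y - c := by
    simpa only [sub_eq_add_neg] using (h.bddMeas_capInter x).add_const (-c)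
  have ha : BddMeas fun y => capKernel p τ x y :=
    bddMeas_right (measurable_capKernel p τ) h.abs_capKernel_le x
  have e1 : ∫ y, capKernel p τ x y * (capInter τ x y - p ^ 2) ∂(sphereUniform (m + 2)) =
      kernelOp (sphereUniform (m + 2)) (capKernel p τ) (fun y => capInter τ x y - c) x := by
    have e : ∀ y, capKernel p τ x y * (capInter τ x y - p ^ 2) =
        capKernel p τ x y * (capInter τ x y - c) + (c - p ^ 2) * capKernel p τ x y :=
      fun y => by ring
    simp_rw [e]
    rw [integral_add (ha.mul hg).integrable (ha.integrable.const_mul _), integral_const_mul,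
      h.integral_capKernel, mul_zero, add_zero, kernelOp]
  have hcap : |∫ y in sphereCap τ x, (capInter τ x y - c) ∂(sphereUniform (m + 2))| ≤
      73 * L * p ^ 2 * (16 * (p * q)) := by
    refine (norm_integral_le_of_norm_le (f := fun y => capInter τ x y - c)
      ((hW.integrable (μ := sphereUniform (m + 2))).const_mul (73 * L * p ^ 2)).integrableOn
      (ae_of_all _ fun y => hD y)).trans ?_
    rw [integral_const_mul]
    gcongr
  have hall : |∫ y, (capInter τ x y - c) ∂(sphereUniform (m + 2))| ≤
      73 * L * p ^ 2 * (9 * q) := by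
    refine (norm_integral_le_of_norm_le (f := fun y => capInter τ x y - c)
      ((hW.integrable (μ := sphereUniform (m + 2))).const_mul (73 * L * p ^ 2))
      (ae_of_all _ fun y => hD y)).trans ?_
    rw [integral_const_mul]
    gcongr
  rw [e1, kernelOp_capKernel_eq p τ hg]
  calc _ ≤ 73 * L * p ^ 2 * (16 * (p * q)) + p * (73 * L * p ^ 2 * (9 * q)) := by
        refine (abs_sub _ _).trans (add_le_add hcap ?_)
        rw [abs_mul, abs_of_pos hp]
        gcongr
    _ = 1825 * (m * (p ^ 3 * (L / m) * q)) := by field_simp; ring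
    _ = _ := by rw [← hq2]; ring

lemma Regime.lipBound_iterate (x : Sphere (m + 2)) (j : ℕ) :
    LipBound (1 / 4 * (16 * (p * √(Real.log (1 / p) / m))) ^ j)
      ((kernelOp (sphereUniform (m + 2)) (capKernel p τ))^[j] fun y => capInter τ x y - p ^ 2) := by
  induction j with
  | zero =>
    intro y y'
    simpa using h.lipBound_capInter x y y'
  | succ j ih =>
    rw [Function.iterate_succ_apply', pow_succ, ← mul_assoc]
    exact h.lipBound_kernelOp ((h.bddMeas_capInter_sub x).iterate_kernelOp
      (measurable_capKernel p τ) h.abs_capKernel_le j) ih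

/-- A Lipschitz function of mean zero is bounded by its Lipschitz constant times the diameter. -/
lemma Regime.abs_iterate_le (x : Sphere (m + 2)) (j : ℕ) (y : Sphere (m + 2)) :
    |(kernelOp (sphereUniform (m + 2)) (capKernel p τ))^[j] (fun y => capInter τ x y - p ^ 2) y| ≤
      1 / 2 * (16 * (p * √(Real.log (1 / p) / m))) ^ j := by
  have hlip := h.lipBound_iterate x j
  have hB := (h.bddMeas_capInter_sub x).iterate_kernelOp (μ := sphereUniform (m + 2))
    (measurable_capKernel p τ) h.abs_capKernel_le j
  have hp := h.p_pos
  have h0 : ∫ y, (kernelOp (sphereUniform (m + 2)) (capKernel p τ))^[j]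
      (fun y => capInter τ x y - p ^ 2) y ∂(sphereUniform (m + 2)) = 0 := by
    cases j with
    | zero => exact h.integral_capInter_sub x
    | succ j =>
      simp_rw [Function.iterate_succ_apply']
      refine integral_kernelOp_eq_zero (measurable_capKernel p τ) h.abs_capKernel_le (fun y => ?_)
        ((h.bddMeas_capInter_sub x).iterate_kernelOp (measurable_capKernel p τ)
          h.abs_capKernel_le j)
      simp_rw [capKernel_comm p τ _ y]
      exact h.integral_capKernel y
  set f := (kernelOp (sphereUniform (m + 2)) (capKernel p τ))^[j]
    (fun y => capInter τ x y - p ^ 2) with hf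
  have e : f y = ∫ w, (f y - f w) ∂(sphereUniform (m + 2)) := by
    rw [integral_sub (integrable_const _) hB.integrable, h0]; simp
  rw [e]
  refine abs_integral_le_of_abs_le fun w => ?_
  refine (hlip y w).trans ?_
  have h2 : ‖(y : Space (m + 2)) - w‖ ≤ 2 := by
    refine (norm_sub_le _ _).trans ?_
    have h3 : ‖(y : Space (m + 2))‖ = 1 := by simp
    have h4 : ‖(w : Space (m + 2))‖ = 1 := by simp
    rw [h3, h4]; norm_num
  have h5 : 0 ≤ (16 * (p * √(Real.log (1 / p) / m))) ^ j := by positivity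
  nlinarith

/-- The signed weight of a planted cycle of length `j + 3` is of order `m ε ^ (j + 3)` with
`ε = p √(log (1/p) / m)`. -/
lemma Regime.abs_cycleIntegral_le (j : ℕ) :
    |cycleIntegral (j + 3) (m + 2) p τ| ≤
      255792 * (m * (16 * (p * √(Real.log (1 / p) / m))) ^ (j + 3)) := by
  have hp := h.p_pos
  have hL := h.log_ge
  have hm := h.large'
  have ha : Measurable (Function.uncurry (capKernel (d := m + 2) p τ)) := measurable_capKernel p τ
  have hb := h.abs_capKernel_le
  have hε : 0 < p * √(Real.log (1 / p) / m) := by positivity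
  have h3 := fun z => h.abs_integral_capKernel_mul_le z
  have h2 := fun z => h.integral_sq_capInter_sub_le z
  have hK := h.abs_iterate_le
  set ε := p * √(Real.log (1 / p) / m) with hεdef
  have hcyc : cycleIntegral (j + 3) (m + 2) p τ =
      ∫ z, (kernelOp (sphereUniform (m + 2)) (capKernel p τ))^[j + 2]
        (fun y => capKernel p τ y z) z ∂(sphereUniform (m + 2)) :=
    integral_cycle_eq_integral_iterate ha hb (j + 2)
  rw [hcyc]
  refine abs_integral_le_of_abs_le fun z => ?_
  have e1 : kernelOp (sphereUniform (m + 2)) (capKernel p τ) (fun y => capKernel p τ y z) =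
      fun y => capInter τ z y - p ^ 2 := funext fun y => h.kernelOp_capKernel z y
  rw [show j + 2 = (j + 1) + 1 from rfl, Function.iterate_succ_apply, e1]
  -- the triangle is the three-step kernel; a longer cycle pairs two rows of the two-step kernel
  cases j with
  | zero =>
    refine (h3 z).trans ?_
    have : 0 ≤ m * ε ^ 3 := by positivity
    rw [mul_pow]
    nlinarith
  | succ i =>
    have hf := h.bddMeas_capInter_sub z
    have hfi := hf.iterate_kernelOp (μ := sphereUniform (m + 2)) ha hb i
    have e2 : (kernelOp (sphereUniform (m + 2)) (capKernel p τ))^[i + 1 + 1]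
        (fun y => capInter τ z y - p ^ 2) z =
        ∫ y, (capInter τ z y - p ^ 2) * (kernelOp (sphereUniform (m + 2)) (capKernel p τ))^[i]
          (fun y => capInter τ z y - p ^ 2) y ∂(sphereUniform (m + 2)) := by
      rw [Function.iterate_succ_apply', Function.iterate_succ_apply', kernelOp]
      simp_rw [capKernel_comm p τ z]
      rw [← integral_kernelOp_mul ha hb (capKernel_comm p τ) (h.bddMeas_capKernel z) hfi, e1]
    rw [e2]
    have hCS := hf.integral_mul_sq_le (μ := sphereUniform (m + 2)) hfi
    have hit := integral_sq_iterate_kernelOp_le (μ := sphereUniform (m + 2)) ha hb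
      (capKernel_comm p τ) hf (r := 16 * ε) (K := 1 / 2) (by positivity) (hK z) i
    set A := ∫ y, (capInter τ z y - p ^ 2) ^ 2 ∂(sphereUniform (m + 2)) with hA
    have hA0 : 0 ≤ A := integral_nonneg fun y => sq_nonneg _
    have h4 : |∫ y, (capInter τ z y - p ^ 2) *
        (kernelOp (sphereUniform (m + 2)) (capKernel p τ))^[i]
          (fun y => capInter τ z y - p ^ 2) y ∂(sphereUniform (m + 2))| ≤ (16 * ε) ^ i * A := by
      refine abs_le_of_sq_le_sq (hCS.trans ?_) (by positivity)
      calc _ ≤ A * (((16 * ε) ^ 2) ^ i * A) := by gcongr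
        _ = _ := by rw [← pow_mul, mul_comm 2 i, pow_mul]; ring
    refine h4.trans ?_
    calc (16 * ε) ^ i * A ≤ (16 * ε) ^ i * (255792 * (m * ε ^ 4)) := by gcongr; exact h2 z
      _ ≤ (16 * ε) ^ i * (255792 * (m * (16 * ε) ^ 4)) := by gcongr; linarith
      _ = _ := by ring

end

/-! ### From separation to the dimension bound -/

lemma signalRatio_nonneg {n : ℕ} {p k : ℝ} (hp0 : 0 < p) (hp1 : p ≤ 1 / 2) :
    0 ≤ signalRatio n p k := by
  have : 0 ≤ Real.log (1 / p) := Real.log_nonneg (by rw [le_div_iff₀ hp0]; linarith)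
  unfold signalRatio
  positivity

/-- If the null standard deviation of the signed cycle count is at most `c` times the signal, then
the dimension obeys the polynomial bound. All powers of the number of cycles beyond the first are
bounded by the number of vertex sequences. -/
lemma pow_le_of_sqrt_variance_le {j n m : ℕ} {p : I} {k c : ℝ} (hn : j + 3 ≤ n) (hk0 : 0 ≤ k)
    (hkn : k ≤ n) (h : Regime m p (threshold p (m + 2)))
    (hsep : √(variance (signedCycleCount (j + 3) n p) (nullLaw n p)) ≤
      c * |(∫ G, signedCycleCount (j + 3) n p G ∂(plantedLaw n p (m + 2) k)) -
        ∫ G, signedCycleCount (j + 3) n p G ∂(nullLaw n p)|) :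
    (m : ℝ) ^ (j + 1) ≤
      c ^ 2 * (255792 ^ 2 * 512 ^ (j + 3)) * signalRatio n p k ^ (j + 3) := by
  rw [variance_signedCycleCount_nullLaw, integral_signedCycleCount_nullLaw, sub_zero,
    integral_signedCycleCount_plantedLaw p hk0 hkn] at hsep
  have hT := h.abs_cycleIntegral_le j
  have hp0 := h.p_pos
  have hp1 := h.p_le
  have hL := h.log_ge
  have hm := h.large'
  have hN1 : (0 : ℝ) < (cycles (j + 3) n).card := by exact_mod_cast card_cycles_pos hn
  have hN2 : ((cycles (j + 3) n).card : ℝ) ≤ (n : ℝ) ^ (j + 3) := by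
    exact_mod_cast card_cycles_le (j + 3) n
  have hn0 : (0 : ℝ) < n := by exact_mod_cast (by omega : 0 < n)
  unfold signalRatio
  set N := ((cycles (j + 3) n).card : ℝ) with hN
  set q : ℝ := (p : ℝ) with hq
  set T := cycleIntegral (j + 3) (m + 2) q (threshold q (m + 2)) with hTdef
  set L := Real.log (1 / q) with hLdef
  set s := √(L / m) with hs
  have hs2 : s ^ 2 = L / m := Real.sq_sqrt (by positivity)
  have hsq := pow_le_pow_left₀ (Real.sqrt_nonneg _) hsep 2
  have hq1 : 0 ≤ 1 - q := by linarith
  rw [Real.sq_sqrt (by positivity), abs_mul, abs_mul, abs_of_pos hN1,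
    abs_of_nonneg (by positivity : 0 ≤ (k / n) ^ (j + 3))] at hsq
  have h1 : N * (q * (1 / 2)) ^ (j + 3) ≤ N * ((q : ℝ) * (1 - q)) ^ (j + 3) := by
    gcongr; linarith
  have h2 : (c * (N * ((k / n) ^ (j + 3) * |T|))) ^ 2 ≤
      N * (q * (1 / 2)) ^ (j + 3) * (c ^ 2 * (255792 ^ 2 * 512 ^ (j + 3)) *
        (k ^ 2 * q * L / n) ^ (j + 3) / m ^ (j + 1)) := by
    calc (c * (N * ((k / n) ^ (j + 3) * |T|))) ^ 2
        = c ^ 2 * N * N * ((k / n) ^ (j + 3)) ^ 2 * |T| ^ 2 := by ring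
      _ ≤ c ^ 2 * N * n ^ (j + 3) * ((k / n) ^ (j + 3)) ^ 2 *
          (255792 * (m * (16 * (q * s)) ^ (j + 3))) ^ 2 := by gcongr
      _ = c ^ 2 * N * 255792 ^ 2 * m ^ 2 *
          (n * (k / n) ^ 2 * (256 * (q ^ 2 * s ^ 2))) ^ (j + 3) := by
          rw [mul_pow (255792 : ℝ), mul_pow (m : ℝ), ← pow_mul, mul_comm (j + 3) 2, pow_mul,
            ← pow_mul (16 * (q * s)), mul_comm (j + 3) 2, pow_mul (16 * (q * s))]
          rw [show (16 * (q * s)) ^ 2 = 256 * (q ^ 2 * s ^ 2) by ring, mul_pow _ (256 * _),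
            mul_pow (n : ℝ)]
          ring
      _ = c ^ 2 * N * 255792 ^ 2 * m ^ 2 *
          (q * (1 / 2) * 512 * (k ^ 2 * q * L / n) / m) ^ (j + 3) := by
          rw [hs2]; congr 2; field_simp; ring
      _ = _ := by
          rw [div_pow, mul_pow _ (k ^ 2 * q * L / n), mul_pow _ (512 : ℝ)]
          have e : (m : ℝ) ^ (j + 3) = m ^ 2 * m ^ (j + 1) := by ring
          rw [e]
          field_simp
  have h3 := (h1.trans hsq).trans h2
  have h4 : 0 < N * (q * (1 / 2)) ^ (j + 3) := by positivity
  have h5 := le_of_mul_le_mul_left ((mul_one _).le.trans h3) h4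
  rwa [le_div_iff₀ (by positivity), one_mul] at h5

/-- Since `(5 L) ^ 4 = 625 L ^ 4`, the passage from `d` to `m = d - 2` leaves `300 L ^ 4 ≤ m`. -/
lemma regime_of_le {d : ℕ} {p : ℝ} (hp0 : 0 < p) (hp1 : p ≤ 1 / 2) (hd : 2000 ≤ d)
    (hlog : (5 * Real.log (1 / p)) ^ 4 ≤ d) :
    ∃ m, d = m + 2 ∧ Regime m p (threshold p (m + 2)) := by
  obtain ⟨m, rfl⟩ : ∃ m, d = m + 2 := ⟨d - 2, by omega⟩
  have hm : m ≠ 0 := by omega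
  obtain ⟨h1, h2⟩ := threshold_spec hm hp0 hp1
  refine ⟨m, rfl, by omega, hp0, hp1, ?_, h1, h2⟩
  have h3 : (1000 : ℝ) ≤ m := by exact_mod_cast (by omega : 1000 ≤ m)
  push_cast at hlog
  rw [mul_pow] at hlog
  linarith

lemma le_mul_rpow_of_pow_le {j : ℕ} {x C R : ℝ} (hC : 0 ≤ C) (hR : 0 ≤ R)
    (h : x ^ (j + 1) ≤ C ^ (j + 1) * R ^ (j + 3)) :
    x ≤ C * R ^ (((j + 3 : ℕ) : ℝ) / (((j + 3 : ℕ) : ℝ) - 2)) := by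
  refine le_of_pow_le_pow_left₀ (n := j + 1) (by omega) (by positivity) (h.trans_eq ?_)
  rw [mul_pow, ← Real.rpow_natCast (R ^ _), ← Real.rpow_mul hR, ← Real.rpow_natCast R (j + 3)]
  congr 2
  push_cast
  have : (j : ℝ) + 3 - 2 ≠ 0 := by
    have : (0 : ℝ) ≤ j := by positivity
    linarith
  field_simp
  ring

end LocalGeometry

end

open LocalGeometry in
theorem proposition2p9 :
    ∃ d₀ : ℕ, ∀ (ℓ : ℕ), 3 ≤ ℓ →
      ∀ (p : ℕ → unitInterval) (d : ℕ → ℕ) (k : ℕ → ℝ),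
        (∀ᶠ n in atTop, 0 < (p n : ℝ) ∧ (p n : ℝ) ≤ 1 / 2) →
        (∀ᶠ n in atTop, 0 ≤ k n ∧ k n ≤ n) →
        Tendsto k atTop atTop →
        (∀ᶠ n in atTop, d₀ ≤ d n ∧ (5 * Real.log (1 / (p n : ℝ))) ^ 4 ≤ (d n : ℝ)) →
        StrongSeparation (fun n => plantedLaw n (p n) (d n) (k n)) (fun n => nullLaw n (p n))
          (fun n => signedCycleCount ℓ n (p n)) →
        ((fun n => (d n : ℝ)) =o[atTop]
            (fun n => signalRatio n (p n) (k n) ^ ((ℓ : ℝ) / ((ℓ : ℝ) - 2)))) ∧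
          -- among all cycle lengths, the bound is largest for triangles
          (∀ᶠ n in atTop, ∀ m : ℕ, 4 ≤ m →
            signalRatio n (p n) (k n) ^ ((m : ℝ) / ((m : ℝ) - 2)) <
              signalRatio n (p n) (k n) ^ (3 : ℝ)) := by
  refine ⟨2000, fun ℓ hℓ p d k hp hk _ hd hsep => ?_⟩
  obtain ⟨j, rfl⟩ : ∃ j, ℓ = j + 3 := ⟨ℓ - 3, by omega⟩
  have key : ∀ C : ℝ, 0 < C → ∀ᶠ n in atTop, (d n : ℝ) ≤
      C * signalRatio n (p n) (k n) ^ (((j + 3 : ℕ) : ℝ) / (((j + 3 : ℕ) : ℝ) - 2)) := by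
    intro C hC
    -- the separation constant that makes the polynomial bound come out with the factor `C`
    set c : ℝ := √((C / 2) ^ (j + 1) / (255792 ^ 2 * 512 ^ (j + 3))) with hc
    have hc2 : c ^ 2 * (255792 ^ 2 * 512 ^ (j + 3)) = (C / 2) ^ (j + 1) := by
      rw [hc, Real.sq_sqrt (by positivity)]
      field_simp
    filter_upwards [hp, hk, hd, isLittleO_iff.1 hsep (show 0 < c by positivity),
      eventually_ge_atTop (j + 3)] with n hpn hkn hdn hsn hn
    obtain ⟨m, hm, hreg⟩ := regime_of_le hpn.1 hpn.2 hdn.1 hdn.2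
    rw [hm] at hsn ⊢
    rw [Real.norm_of_nonneg (by positivity), Real.norm_eq_abs] at hsn
    have h1 := pow_le_of_sqrt_variance_le hn hkn.1 hkn.2 hreg ((le_max_left _ _).trans hsn)
    rw [hc2] at h1
    have hR := signalRatio_nonneg (n := n) (k := k n) hpn.1 hpn.2
    refine le_mul_rpow_of_pow_le hC.le hR ?_
    have hm2 := hreg.large'
    calc ((m + 2 : ℕ) : ℝ) ^ (j + 1) ≤ (2 * (m : ℝ)) ^ (j + 1) := by
          gcongr; push_cast; linarith
      _ = 2 ^ (j + 1) * (m : ℝ) ^ (j + 1) := mul_pow _ _ _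
      _ ≤ 2 ^ (j + 1) * ((C / 2) ^ (j + 1) * signalRatio n (p n) (k n) ^ (j + 3)) := by gcongr
      _ = _ := by rw [div_pow]; field_simp
  refine ⟨isLittleO_iff.2 fun C hC => ?_, ?_⟩
  · filter_upwards [key C hC, hp] with n hn hpn
    have hR := signalRatio_nonneg (n := n) (k := k n) hpn.1 hpn.2
    rwa [Real.norm_of_nonneg (by positivity), Real.norm_of_nonneg (by positivity)]
  · filter_upwards [key 1 one_pos, hp, hd] with n hn hpn hdn m hm
    have hR := signalRatio_nonneg (n := n) (k := k n) hpn.1 hpn.2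
    have hd2 : (2000 : ℝ) ≤ d n := by exact_mod_cast hdn.1
    have h1 : 1 < signalRatio n (p n) (k n) := by
      by_contra! hle
      have h2 := Real.rpow_le_one hR hle
        (show 0 ≤ ((j + 3 : ℕ) : ℝ) / (((j + 3 : ℕ) : ℝ) - 2) by
          push_cast
          exact div_nonneg (by positivity) (by linarith [(Nat.cast_nonneg j : (0 : ℝ) ≤ j)]))
      linarith
    have hm4 : (4 : ℝ) ≤ m := by exact_mod_cast hm
    refine Real.rpow_lt_rpow_of_exponent_lt h1 ?_
    rw [div_lt_iff₀ (by linarith)]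
    linarith
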